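/- For an integer $k\ge 2$ let $E^0_{2k}(\tau)=\sum_{n>0}\sigma_{2k-1}(n)e^{2\pi i n\tau}$ ($\operatorname{Im}\tau>0$). An index consists of $r\ge 0$ and integers $k_1,\dots,k_r\ge 2$, $\alpha_1,\dots,\alpha_r\ge 1$. For an index and $\tau$ in the upper half plane put $$\mathrm{Int}(\mathbf k;\boldsymbol\alpha)(\tau)=\int_{\tau<\tau_1<\cdots<\tau_r<i\infty}E^0_{2k_1}(\tau_1)\tau_1^{\alpha_1-1}\cdots E^0_{2k_r}(\tau_r)\tau_r^{\alpha_r-1}\,d\tau_r\cdots d\tau_1,$$ $$L(\mathbf k;\boldsymbol\alpha)(\tau)=(2\pi i)^{-\alpha_1-\cdots-\alpha_r}\sum_{n_1,\dots,n_r>0}\frac{\sigma_{2k_1-1}(n_1)\cdots\sigma_{2k_r-1}(n_r)}{(n_1+\cdots+n_r)^{\alpha_1}(n_2+\cdots+n_r)^{\alpha_2}\cdots n_r^{\alpha_r}}e^{2\pi i(n_1+\cdots+n_r)\tau},$$ both equal to $1$ if $r=0$. Fix $c\in\mathbb C$. A number $v$ is called the regularized value of $f$ at $\tau=0$ if, as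 $\tau\to0$ along the positive imaginary axis, $f(\tau)=\sum_{m,j\ge0}a_{m,j}\,\tau^{-m}(\log\tau-c)^j+o(1)$ with finitely many nonzero $a_{m,j}\in\mathbb{C}$, and $v=a_{0,0}$. (The number $c$ only normalizes the logarithm.) The following holds for every choice of $c$. (1) For every index, $L(\mathbf k;\boldsymbol\alpha)(\tau)$ and $\mathrm{Int}(\mathbf k;\boldsymbol\alpha)(\tau)$ have a unique regularized value at $\tau=0$, denoted $L(\mathbf k;\boldsymbol\alpha)$ and $\mathrm{Int}(\mathbf k;\boldsymbol\alpha)$. For $r\ge1$ it is given by analytic continuation wherever that is finite: the functions $$s\mapsto\sum_{n_1,\dots,n_r>0}\frac{\sigma_{2k_1-1}(n_1)\cdots\sigma_{2k_r-1}(n_r)}{(n_1+\cdots+n_r)^{s}(n_2+\cdots+n_r)^{\alpha_2}\cdots n_r^{\alpha_r}},\qquad s\mapsto\int_{0<\tau_1<\cdots<\tau_r<i\infty}E^0_{2k_1}(\tau_1)\tau_1^{s-1}E^0_{2k_2}(\tau_2)\tau_2^{\alpha_2-1}\cdots E^0_{2k_r}(\tau_r)\tau_r^{\alpha_r-1}\,d\tau_r\cdots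 d\tau_1$$ (the integral being taken along the imaginary axis, with the principal branch of $\tau_1^{s-1}$) converge for $\operatorname{Re}s$ large and extend meromorphically to $\mathbb C$; if the first extension has a finite limit $w$ at $s=\alpha_1$, then $L(\mathbf k;\boldsymbol\alpha)=(2\pi i)^{-\alpha_1-\cdots-\alpha_r}w$, and if the second has a finite limit $w$ at $s=\alpha_1$, then $\mathrm{Int}(\mathbf k;\boldsymbol\alpha)=w$. Let $\mathcal{MEL}$ and $\mathcal{IEI}$ be the $\mathbb Q$-subspaces of $\mathbb C$ spanned by all $L(\mathbf k;\boldsymbol\alpha)$ and by all $\mathrm{Int}(\mathbf k;\boldsymbol\alpha)$ respectively. On each of them let $L^n$, $M^n$, $W^n$ be the span of those generators with $r\le n$, with $\sum k_i\le n$, with $\sum\alpha_i\le n$ respectively (length, upper weight and lower weight filtrations), and let $Fil_{l,j,k}^{L,M,W}=L^l\cap M^j\cap W^k$. (2) $\mathcal{MEL}$ and $\mathcal{IEI}$ are $\mathbb Q$-subalgebras of $\mathbb C$. (3) $\mathcal{MEL}=\mathcal{IEI}$, and $L^n(\mathcal{MEL})=L^n(\mathcal{IEI})$, $M^n(\mathcal{MEL})=M^n(\mathcal{IEI})$,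 $W^n(\mathcal{MEL})=W^n(\mathcal{IEI})$ for all $n\ge0$. (4) $Fil^{L,M,W}_{l_1,j_1,k_1}(\mathcal{MEL})\cdot Fil^{L,M,W}_{l_2,j_2,k_2}(\mathcal{MEL})\subseteq Fil^{L,M,W}_{l_1+l_2,\,j_1+j_2,\,k_1+k_2}(\mathcal{MEL})$ for all $l_1,j_1,k_1,l_2,j_2,k_2\ge0$. -/

import Mathlib

open Filter Topology Set MeasureTheory

namespace IterEis

noncomputable section

/-- The cusp part `E⁰_{2k}(τ) = ∑_{n>0} σ_{2k-1}(n) e^{2πinτ}` of the Hecke normalized Eisenstein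
series of weight `2k`. -/
def cuspEis (k : ℕ) (τ : ℂ) : ℂ :=
  ∑' n : ℕ+, (ArithmeticFunction.sigma (2 * k - 1) (n : ℕ) : ℂ) *
    Complex.exp (2 * Real.pi * Complex.I * (n : ℂ) * τ)

/-- The iterated Eisenstein `τ`-integral
`∫_{τ<τ₁<⋯<τ_r<i∞} E⁰_{2k₁}(τ₁) τ₁^{α₁-1} ⋯ E⁰_{2k_r}(τ_r) τ_r^{α_r-1} dτ_r ⋯ dτ₁`
along the vertical ray `τ₁ = τ + iy`, `y > 0`; the innermost variable is the last one. -/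
def iterInt : (r : ℕ) → (Fin r → ℕ) → (Fin r → ℕ) → ℂ → ℂ
  | 0, _, _, _ => 1
  | r + 1, k, α, τ =>
      ∫ y in Ioi (0 : ℝ),
        cuspEis (k 0) (τ + Complex.I * y) * (τ + Complex.I * y) ^ (α 0 - 1) *
          iterInt r (Fin.tail k) (Fin.tail α) (τ + Complex.I * y) * Complex.I

/-- The tail sum `n_i + n_{i+1} + ⋯ + n_r`. -/
def tailSum {r : ℕ} (n : Fin r → ℕ+) (i : Fin r) : ℕ := ∑ j ∈ Finset.Ici i, (n j : ℕ)

/-- The multiple Eisenstein L-series `L^{(0)}(E⁰_{2k₁},…,E⁰_{2k_r}; α₁,…,α_r)(τ)`. -/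
def multL (r : ℕ) (k α : Fin r → ℕ) (τ : ℂ) : ℂ :=
  ((2 * Real.pi * Complex.I) ^ (∑ i, α i))⁻¹ *
    ∑' n : Fin r → ℕ+,
      (∏ i, (ArithmeticFunction.sigma (2 * k i - 1) (n i : ℕ) : ℂ)) /
        (∏ i, (tailSum n i : ℂ) ^ α i) *
        Complex.exp (2 * Real.pi * Complex.I * (∑ i, (n i : ℂ)) * τ)

/-- `v` is the regularized value at `τ = 0` of a function `f` on the upper half plane: as `τ → 0`
along the imaginary axis, `f(τ)` is, up to a term tending to `0`, a polynomial in `τ⁻¹` and in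
`log τ - c`, and `v` is its constant term. The number `c` fixes the normalization of the logarithm
(the tangential base point at `0`); it is irrelevant when no power `(log τ - c)^j`, `j ≥ 1`, occurs
with `τ⁰`. -/
def IsRegValue (c : ℂ) (f : ℂ → ℂ) (v : ℂ) : Prop :=
  ∃ (N : ℕ) (a : ℕ → ℕ → ℂ), a 0 0 = v ∧
    Tendsto (fun y : ℝ => f (Complex.I * y) -
        ∑ m ∈ Finset.range (N + 1), ∑ j ∈ Finset.range (N + 1),
          a m j * ((Complex.I * y)⁻¹) ^ m * (Complex.log (Complex.I * y) - c) ^ j)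
      (𝓝[>] 0) (𝓝 0)

/-- The indices: `k_i ≥ 2` and `α_i ≥ 1` for all `i`. -/
def Admissible {r : ℕ} (k α : Fin r → ℕ) : Prop := ∀ i, 2 ≤ k i ∧ 1 ≤ α i

/-- A family of functions of `τ` with the same index set as `iterInt` and `multL`. -/
abbrev Family : Type := (r : ℕ) → (Fin r → ℕ) → (Fin r → ℕ) → ℂ → ℂ

/-- The `ℚ`-span of the regularized values at `τ = 0` of those members of the family `F` with
admissible index `(r, k, α)` that satisfy `P`. -/
def regSpan (c : ℂ) (F : Family) (P : (r : ℕ) → (Fin r → ℕ) → (Fin r → ℕ) → Prop) :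
    Submodule ℚ ℂ :=
  Submodule.span ℚ
    {v : ℂ | ∃ (r : ℕ) (k α : Fin r → ℕ), Admissible k α ∧ P r k α ∧ IsRegValue c (F r k α) v}

/-- The space spanned by all regularized values of the family `F`. -/
def total (c : ℂ) (F : Family) : Submodule ℚ ℂ := regSpan c F (fun _ _ _ => True)

/-- The length filtration. -/
def lengthFil (c : ℂ) (F : Family) (n : ℕ) : Submodule ℚ ℂ := regSpan c F (fun r _ _ => r ≤ n)

/-- The upper weight filtration. -/
def upperFil (c : ℂ) (F : Family) (n : ℕ) : Submodule ℚ ℂ :=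
  regSpan c F (fun _ k _ => ∑ i, k i ≤ n)

/-- The lower weight filtration. -/
def lowerFil (c : ℂ) (F : Family) (n : ℕ) : Submodule ℚ ℂ :=
  regSpan c F (fun _ _ α => ∑ i, α i ≤ n)

/-- `Fil^{L,M,W}_{l,j,k} = L^l ∩ M^j ∩ W^k`. -/
def fil (c : ℂ) (F : Family) (l j k : ℕ) : Submodule ℚ ℂ :=
  lengthFil c F l ⊓ upperFil c F j ⊓ lowerFil c F k

/-- The space of multiple Eisenstein L-functions. -/
def MEL (c : ℂ) : Submodule ℚ ℂ := total c multL

/-- The space of iterated Eisenstein integrals. -/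
def IEI (c : ℂ) : Submodule ℚ ℂ := total c iterInt

/-- The general term of the multiple Dirichlet series in which the exponent `α₁` is replaced by the
complex variable `s`. -/
def dirichletTerm {r : ℕ} (k α : Fin (r + 1) → ℕ) (s : ℂ) (n : Fin (r + 1) → ℕ+) : ℂ :=
  (∏ i, (ArithmeticFunction.sigma (2 * k i - 1) (n i : ℕ) : ℂ)) /
    ((tailSum n 0 : ℂ) ^ s * ∏ i : Fin r, (tailSum n i.succ : ℂ) ^ α i.succ)

/-- The integrand of the iterated integral from `0` to `i∞` in which the exponent `α₁` is replaced
by the complex variable `s`. -/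
def mellinIntegrand {r : ℕ} (k α : Fin (r + 1) → ℕ) (s : ℂ) (y : ℝ) : ℂ :=
  cuspEis (k 0) (Complex.I * y) * (Complex.I * y) ^ (s - 1) *
    iterInt r (Fin.tail k) (Fin.tail α) (Complex.I * y) * Complex.I

end

end IterEis

/-! Everything rests on the behaviour of `E⁰_{2k}` at the cusp `0`. Modularity of the full
Eisenstein series under `τ ↦ -1/τ` gives `E⁰_{2k}(τ) = (B_{2k}/4k)(1 - τ^{-2k})` up to a function
flat at `0` (`hasExp_eis`): a Laurent polynomial with rational coefficients. Both families arise
from the constant `1` by multiplying with some `E⁰_{2k}`, in the case of the integrals also with a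
power of `τ`, and taking the primitive that decays at `i∞`, up to sign (`hasDerivAt_intW`,
`serW_zero`, `hasDerivAt_serW_succ`). The monomials `τ^m (log τ - c)^j` have primitives of the same
kind with rational coefficients. So, inductively, every member of either family equals an element of
`LogLaurent` modulo flat functions, and each integration brings in just one new number, the constant
of integration, which is the new regularized value. All coefficients of an expansion are therefore
rational combinations of regularized values of the same family and of no larger weight
(`exists_hasExp_intW`, `exists_hasExp_serW_mem`). Uniqueness holds because distinct monomials with
`m ≤ 0` have distinct orders of growth and none tends to `0` (`coeff_eq_zero_of_tendsto`).

Products: iterated integrals multiply by shuffles (`intW_mul_intW`). Taking constant terms is not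
multiplicative, since nonconstant terms can multiply to constants, but the error consists of
products of regularized values of proper suffixes and is absorbed by induction
(`isRegValue_mul_mem`).

Comparison: integration by parts trades powers of `τ` for exponents `α`, so each nonempty member of
one family is a rational combination of functions `τ^m` times members of the other
(`intW_mem_powSpan_serW`, `serW_mem_powSpan_intW`). The constant term of `τ^m f` is a coefficient of
the expansion of `f`, hence in the span of regularized values. With `τ^m` counted as lower weight
`m`, weights do not grow, so the spaces agree together with their filtrations (`regFil_multL_eq`). A
general letter weight `p + q k + s α` treats length, upper weight and lower weight at once.

Continuation: subtracting the expansion on `(0, 1]` leaves a function whose Mellin transform is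
entire, while `(log τ - c)^j` contributes a pole of order `j + 1` at `0`. If `s M(s)` has a finite
limit at `0`, no logarithm accompanies `τ^0` and the limit is the constant term
(`exists_mellin_continuation`). The Dirichlet series and the integral with variable exponent are
both, after a shift by `α₁`, equal to `s M(s)` times an entire factor with value `1` at `0`. -/

namespace IterEis

noncomputable section

/-! ### Laurent polynomials in `τ` and a logarithm -/

/-- Laurent polynomials in `τ` with coefficients in the polynomials in a logarithm of `τ`; the
exponent `(m, j)` stands for `τ ^ m * (log τ - c) ^ j`. -/
abbrev LogLaurent : Type := AddMonoidAlgebra ℂ (ℤ × ℕ)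

/-- The normalized logarithm on the imaginary axis. -/
def logAt (c : ℂ) (y : ℝ) : ℂ := Complex.log (Complex.I * y) - c

/-- The value of a monomial at `τ = iy`. -/
def monoAt (c : ℂ) (x : ℤ × ℕ) (y : ℝ) : ℂ := (Complex.I * y) ^ x.1 * logAt c y ^ x.2

/-- The value of an element of `LogLaurent` at `τ = iy`. -/
def evalAt (c : ℂ) (P : LogLaurent) (y : ℝ) : ℂ := P.coeff.sum fun x a => a * monoAt c x y

lemma evalAt_zero (c : ℂ) (y : ℝ) : evalAt c 0 y = 0 := by simp [evalAt]

lemma evalAt_add (c : ℂ) (P Q : LogLaurent) (y : ℝ) :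
    evalAt c (P + Q) y = evalAt c P y + evalAt c Q y := by
  simp only [evalAt, AddMonoidAlgebra.coeff_add]
  exact Finsupp.sum_add_index' (by simp) (by intros; ring)

lemma evalAt_single (c : ℂ) (x : ℤ × ℕ) (a : ℂ) (y : ℝ) :
    evalAt c (AddMonoidAlgebra.single x a) y = a * monoAt c x y := by
  simp [evalAt]

lemma evalAt_smul (c : ℂ) (a : ℂ) (P : LogLaurent) (y : ℝ) :
    evalAt c (a • P) y = a * evalAt c P y := by
  induction P using AddMonoidAlgebra.induction_linear with
  | zero => simp [evalAt_zero]
  | add x z hx hz => simp only [smul_add, evalAt_add, hx, hz]; ring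
  | single m r => rw [AddMonoidAlgebra.smul_single, evalAt_single, evalAt_single]; simp [mul_assoc]

lemma evalAt_neg (c : ℂ) (P : LogLaurent) (y : ℝ) : evalAt c (-P) y = -evalAt c P y := by
  have := evalAt_smul c (-1) P y
  simpa using this

lemma evalAt_sub (c : ℂ) (P Q : LogLaurent) (y : ℝ) :
    evalAt c (P - Q) y = evalAt c P y - evalAt c Q y := by
  rw [sub_eq_add_neg, evalAt_add, evalAt_neg, sub_eq_add_neg]

lemma monoAt_add (c : ℂ) (x z : ℤ × ℕ) {y : ℝ} (hy : 0 < y) :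
    monoAt c (x + z) y = monoAt c x y * monoAt c z y := by
  have h : Complex.I * (y : ℂ) ≠ 0 := by simp [hy.ne']
  simp only [monoAt, Prod.fst_add, Prod.snd_add, zpow_add₀ h, pow_add]
  ring

lemma evalAt_mul (c : ℂ) (P Q : LogLaurent) {y : ℝ} (hy : 0 < y) :
    evalAt c (P * Q) y = evalAt c P y * evalAt c Q y := by
  induction P using AddMonoidAlgebra.induction_linear with
  | zero => simp [evalAt_zero]
  | add x z hx hz => simp only [add_mul, evalAt_add, hx, hz]
  | single m r =>
    induction Q using AddMonoidAlgebra.induction_linear with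
    | zero => simp [evalAt_zero]
    | add x z hx hz => simp only [mul_add, evalAt_add, hx, hz]
    | single n s =>
      rw [AddMonoidAlgebra.single_mul_single, evalAt_single, evalAt_single, evalAt_single,
        monoAt_add c m n hy]
      ring

/-! ### Asymptotics -/

/-- `f(y)` vanishes to infinite order as `y → 0⁺`. -/
def FlatAtZero (f : ℝ → ℂ) : Prop := ∀ N : ℕ, f =O[𝓝[>] 0] fun y : ℝ => y ^ N

/-- `f(y)` decays faster than any power of `y` as `y → ∞`. -/
def RapidDecay (f : ℝ → ℂ) : Prop := ∀ N : ℕ, f =O[atTop] fun y : ℝ => (y ^ N)⁻¹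

/-- `P` is the asymptotic expansion of `f` as `y → 0⁺`. -/
def HasExp (c : ℂ) (f : ℝ → ℂ) (P : LogLaurent) : Prop := FlatAtZero fun y => f y - evalAt c P y

lemma FlatAtZero.add {f g : ℝ → ℂ} (hf : FlatAtZero f) (hg : FlatAtZero g) :
    FlatAtZero fun y => f y + g y := fun N => (hf N).add (hg N)

lemma FlatAtZero.congr {f g : ℝ → ℂ} (hf : FlatAtZero f) (h : f =ᶠ[𝓝[>] 0] g) : FlatAtZero g :=
  fun N => (hf N).congr' h EventuallyEq.rfl

lemma FlatAtZero.const_mul {f : ℝ → ℂ} (hf : FlatAtZero f) (a : ℂ) :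
    FlatAtZero fun y => a * f y := fun N => (hf N).const_mul_left a

lemma FlatAtZero.tendsto {f : ℝ → ℂ} (hf : FlatAtZero f) : Tendsto f (𝓝[>] 0) (𝓝 0) := by
  refine (hf 1).trans_tendsto ?_
  simp only [pow_one]
  exact tendsto_id.mono_left nhdsWithin_le_nhds

/-- Functions of at most polynomial growth at `0`. -/
def ModerateAtZero (f : ℝ → ℂ) : Prop := ∃ M : ℕ, f =O[𝓝[>] 0] fun y : ℝ => (y ^ M)⁻¹

lemma FlatAtZero.mul_moderate {f g : ℝ → ℂ} (hf : FlatAtZero f) (hg : ModerateAtZero g) :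
    FlatAtZero fun y => f y * g y := by
  obtain ⟨M, hM⟩ := hg
  intro N
  refine ((hf (N + M)).mul hM).congr' EventuallyEq.rfl ?_
  filter_upwards [self_mem_nhdsWithin] with y hy
  have hy : (0 : ℝ) < y := hy
  field_simp
  ring

lemma pow_inv_isBigO_zero {M N : ℕ} (h : M ≤ N) :
    (fun y : ℝ => (y ^ M)⁻¹) =O[𝓝[>] 0] fun y : ℝ => (y ^ N)⁻¹ := by
  refine Asymptotics.IsBigO.of_bound 1 ?_
  filter_upwards [Ioo_mem_nhdsGT (zero_lt_one (α := ℝ))] with y hy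
  have h0 : 0 < y := hy.1
  rw [Real.norm_of_nonneg (by positivity), Real.norm_of_nonneg (by positivity), one_mul]
  exact inv_anti₀ (by positivity) (pow_le_pow_of_le_one h0.le hy.2.le h)

lemma ModerateAtZero.add {f g : ℝ → ℂ} (hf : ModerateAtZero f) (hg : ModerateAtZero g) :
    ModerateAtZero fun y => f y + g y := by
  obtain ⟨M, hM⟩ := hf
  obtain ⟨N, hN⟩ := hg
  exact ⟨max M N, (hM.trans (pow_inv_isBigO_zero (le_max_left _ _))).add
    (hN.trans (pow_inv_isBigO_zero (le_max_right _ _)))⟩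

lemma ModerateAtZero.mul {f g : ℝ → ℂ} (hf : ModerateAtZero f) (hg : ModerateAtZero g) :
    ModerateAtZero fun y => f y * g y := by
  obtain ⟨M, hM⟩ := hf
  obtain ⟨N, hN⟩ := hg
  exact ⟨M + N, (hM.mul hN).congr_right fun y => by rw [pow_add, mul_inv]⟩

lemma ModerateAtZero.const (a : ℂ) : ModerateAtZero fun _ => a :=
  ⟨0, by simpa using Asymptotics.isBigO_const_const a (one_ne_zero (α := ℝ)) _⟩

lemma FlatAtZero.moderate {f : ℝ → ℂ} (hf : FlatAtZero f) : ModerateAtZero f :=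
  ⟨0, by simpa using hf 0⟩

lemma logAt_eq (c : ℂ) {y : ℝ} (hy : 0 < y) :
    logAt c y = (Real.log y : ℂ) + (Real.pi / 2 * Complex.I - c) := by
  have : Complex.I * (y : ℂ) = (y : ℂ) * Complex.I := mul_comm _ _
  rw [logAt, this, Complex.log_ofReal_mul hy Complex.I_ne_zero, Complex.log_I]
  ring

lemma tendsto_pow_mul_logAt (c : ℂ) (j : ℕ) {n : ℕ} (hn : n ≠ 0) :
    Tendsto (fun y : ℝ => (y : ℂ) ^ n * logAt c y ^ j) (𝓝[>] 0) (𝓝 0) := by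
  have h1 : (fun y : ℝ => Real.log y ^ j) =o[𝓝[>] 0] fun y : ℝ => y⁻¹ := by
    have := (Real.isLittleO_pow_log_id_atTop (n := j)).comp_tendsto tendsto_inv_nhdsGT_zero
    refine Asymptotics.IsLittleO.of_norm_left (this.norm_left.congr_left fun y => ?_)
    simp [Real.log_inv]
  have h2 : (fun y : ℝ => logAt c y ^ j) =O[𝓝[>] 0] fun y : ℝ => Real.log y ^ j := by
    refine Asymptotics.IsBigO.pow ?_ j
    have h3 : (fun _ : ℝ => Real.pi / 2 * Complex.I - c) =O[𝓝[>] 0] Real.log := by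
      refine (Asymptotics.isLittleO_const_left.2 (Or.inr ?_)).isBigO
      exact tendsto_abs_atBot_atTop.comp Real.tendsto_log_nhdsGT_zero
    have h4 : (fun y : ℝ => (Real.log y : ℂ)) =O[𝓝[>] 0] Real.log :=
      Asymptotics.isBigO_of_le _ fun y => by simp
    refine (h4.add h3).congr' ?_ EventuallyEq.rfl
    filter_upwards [self_mem_nhdsWithin] with y hy
    rw [logAt_eq c hy]
  have h5 : (fun y : ℝ => (y : ℂ) ^ n) =O[𝓝[>] 0] fun y : ℝ => y := by
    refine Asymptotics.IsBigO.of_bound 1 ?_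
    filter_upwards [Ioo_mem_nhdsGT (zero_lt_one (α := ℝ))] with y hy
    have h0 : 0 < y := hy.1
    rw [norm_pow, Complex.norm_real, one_mul, Real.norm_of_nonneg h0.le]
    exact pow_le_of_le_one h0.le hy.2.le hn
  have h6 := h5.mul_isLittleO (h2.trans_isLittleO h1)
  refine (Asymptotics.isLittleO_one_iff ℝ).1 (h6.congr' EventuallyEq.rfl ?_)
  filter_upwards [self_mem_nhdsWithin] with y hy
  exact mul_inv_cancel₀ (ne_of_gt hy)

lemma tendsto_norm_logAt (c : ℂ) : Tendsto (fun y : ℝ => ‖logAt c y‖) (𝓝[>] 0) atTop := by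
  have h1 : Tendsto (fun y : ℝ => ‖(Real.log y : ℂ)‖ - ‖Real.pi / 2 * Complex.I - c‖) (𝓝[>] 0)
      atTop := by
    refine tendsto_atTop_add_const_right _ _ ?_
    simp only [Complex.norm_real, Real.norm_eq_abs]
    exact tendsto_abs_atBot_atTop.comp Real.tendsto_log_nhdsGT_zero
  refine tendsto_atTop_mono' _ ?_ h1
  filter_upwards [self_mem_nhdsWithin] with y hy
  rw [logAt_eq c hy]
  have := norm_sub_le ((Real.log y : ℂ) + (Real.pi / 2 * Complex.I - c))
    (Real.pi / 2 * Complex.I - c)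
  simp only [add_sub_cancel_right] at this
  linarith

lemma moderate_monoAt (c : ℂ) (x : ℤ × ℕ) : ModerateAtZero (monoAt c x) := by
  refine ModerateAtZero.mul ⟨x.1.natAbs, ?_⟩ ⟨1, ?_⟩
  · refine Asymptotics.IsBigO.of_bound 1 ?_
    filter_upwards [Ioo_mem_nhdsGT (zero_lt_one (α := ℝ))] with y hy
    have h0 : 0 < y := hy.1
    rw [Real.norm_of_nonneg (by positivity), one_mul, norm_zpow, norm_mul, Complex.norm_I, one_mul,
      Complex.norm_real, Real.norm_of_nonneg h0.le, ← zpow_natCast, ← zpow_neg]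
    refine zpow_le_zpow_right_of_le_one₀ h0 hy.2.le ?_
    omega
  · have h := (tendsto_pow_mul_logAt c x.2 one_ne_zero).isBigO_one ℝ
    have h' : (fun y : ℝ => ((y : ℂ) ^ 1)⁻¹) =O[𝓝[>] 0] fun y : ℝ => (y ^ 1)⁻¹ :=
      Asymptotics.isBigO_of_le _ fun y => by simp
    refine (h.mul h').congr' ?_ (.of_forall fun y => one_mul _)
    filter_upwards [self_mem_nhdsWithin] with y hy
    have hy : (y : ℂ) ≠ 0 := by exact_mod_cast (ne_of_gt hy : y ≠ 0)
    field_simp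

lemma moderate_evalAt (c : ℂ) (P : LogLaurent) : ModerateAtZero (evalAt c P) := by
  induction P using AddMonoidAlgebra.induction_linear with
  | zero =>
    have : evalAt c 0 = fun _ => 0 := funext fun y => evalAt_zero c y
    exact this ▸ ModerateAtZero.const 0
  | add x z hx hz =>
    have : evalAt c (x + z) = fun y => evalAt c x y + evalAt c z y :=
      funext fun y => evalAt_add c x z y
    exact this ▸ hx.add hz
  | single m r =>
    have : evalAt c (AddMonoidAlgebra.single m r) = fun y => r * monoAt c m y :=
      funext fun y => evalAt_single c m r y
    exact this ▸ (ModerateAtZero.const r).mul (moderate_monoAt c m)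

lemma HasExp.moderate {c : ℂ} {f : ℝ → ℂ} {P : LogLaurent} (h : HasExp c f P) :
    ModerateAtZero f := by
  have := FlatAtZero.moderate h |>.add (moderate_evalAt c P)
  simpa using this

lemma HasExp.add {c : ℂ} {f g : ℝ → ℂ} {P Q : LogLaurent} (hf : HasExp c f P)
    (hg : HasExp c g Q) : HasExp c (fun y => f y + g y) (P + Q) := by
  refine (FlatAtZero.add hf hg).congr (.of_forall fun y => ?_)
  simp only [evalAt_add]; ring

lemma HasExp.const_mul {c : ℂ} {f : ℝ → ℂ} {P : LogLaurent} (hf : HasExp c f P) (a : ℂ) :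
    HasExp c (fun y => a * f y) (a • P) := by
  refine (FlatAtZero.const_mul hf a).congr (.of_forall fun y => ?_)
  simp only [evalAt_smul]; ring

lemma HasExp.mul {c : ℂ} {f g : ℝ → ℂ} {P Q : LogLaurent} (hf : HasExp c f P)
    (hg : HasExp c g Q) : HasExp c (fun y => f y * g y) (P * Q) := by
  refine ((FlatAtZero.mul_moderate hf hg.moderate).add
    (FlatAtZero.mul_moderate hg (moderate_evalAt c P))).congr ?_
  filter_upwards [self_mem_nhdsWithin] with y hy
  rw [evalAt_mul c P Q hy]; ring

lemma HasExp.congr {c : ℂ} {f g : ℝ → ℂ} {P : LogLaurent} (hf : HasExp c f P)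
    (h : ∀ y, 0 < y → f y = g y) : HasExp c g P := by
  refine FlatAtZero.congr hf ?_
  filter_upwards [self_mem_nhdsWithin] with y hy
  rw [h y hy]

lemma FlatAtZero.hasExp {c : ℂ} {f : ℝ → ℂ} (hf : FlatAtZero f) : HasExp c f 0 := by
  simpa [HasExp, evalAt_zero] using hf

lemma hasExp_evalAt (c : ℂ) (P : LogLaurent) : HasExp c (evalAt c P) P := by
  intro N
  simpa using Asymptotics.isBigO_zero _ _

/-! ### Uniqueness of expansions -/

lemma monoAt_ne_zero {c : ℂ} (x : ℤ × ℕ) {y : ℝ} (hy : 0 < y) (h : logAt c y ≠ 0) :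
    monoAt c x y ≠ 0 :=
  mul_ne_zero (zpow_ne_zero _ (by simp [hy.ne'])) (pow_ne_zero _ h)

lemma tendsto_monoAt_div (c : ℂ) {x x₀ : ℤ × ℕ} (h : x₀.1 < x.1 ∨ x₀.1 = x.1 ∧ x.2 < x₀.2) :
    Tendsto (fun y : ℝ => monoAt c x y / monoAt c x₀ y) (𝓝[>] 0) (𝓝 0) := by
  rw [tendsto_zero_iff_norm_tendsto_zero]
  rcases h with h | ⟨h, h'⟩
  · obtain ⟨n, hn⟩ := Int.eq_ofNat_of_zero_le (a := x.1 - x₀.1) (by omega)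
    have hn0 : n ≠ 0 := by rintro rfl; omega
    refine squeeze_zero' (.of_forall fun _ => norm_nonneg _) ?_
      (tendsto_zero_iff_norm_tendsto_zero.1 (tendsto_pow_mul_logAt c x.2 hn0))
    filter_upwards [self_mem_nhdsWithin, (tendsto_norm_logAt c).eventually_ge_atTop 1] with y hy hl
    have hy : (0 : ℝ) < y := hy
    have hI : Complex.I * (y : ℂ) ≠ 0 := by simp [hy.ne']
    have e : monoAt c x y / monoAt c x₀ y =
        (Complex.I * y) ^ (x.1 - x₀.1) * logAt c y ^ x.2 / logAt c y ^ x₀.2 := by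
      rw [zpow_sub₀ hI, monoAt, monoAt]
      field_simp
    rw [e, hn, norm_div, norm_mul, norm_mul, norm_pow, norm_pow, norm_zpow, norm_mul,
      Complex.norm_I, one_mul, zpow_natCast, norm_pow]
    -- Once the logarithm has norm at least `1`, dividing by its power from `x₀` only decreases the
    -- norm.
    exact div_le_self (by positivity) (one_le_pow₀ hl)
  · obtain ⟨d, hd⟩ := Nat.exists_eq_add_of_lt h'
    have h1 : Tendsto (fun y : ℝ => (‖logAt c y‖ ^ (d + 1))⁻¹) (𝓝[>] 0) (𝓝 0) :=
      tendsto_inv_atTop_zero.comp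
        ((tendsto_pow_atTop (Nat.succ_ne_zero d)).comp (tendsto_norm_logAt c))
    refine h1.congr' ?_
    filter_upwards [self_mem_nhdsWithin, (tendsto_norm_logAt c).eventually_ge_atTop 1] with y hy hl
    have hy : (0 : ℝ) < y := hy
    have hI : Complex.I * (y : ℂ) ≠ 0 := by simp [hy.ne']
    have hl0 : logAt c y ≠ 0 := norm_pos_iff.1 (by linarith)
    have e : monoAt c x y / monoAt c x₀ y = (logAt c y ^ (d + 1))⁻¹ := by
      have hz := zpow_ne_zero x.1 hI
      rw [monoAt, monoAt, h, hd, add_assoc, pow_add]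
      field_simp
    rw [e, norm_inv, norm_pow]

/-- Divide by the dominant monomial of the support: the quotient tends to its nonzero coefficient.
If some exponent of `τ` is nonpositive, so is that of the dominant monomial, which then has norm at
least `1` near `0`; hence the quotient also tends to `0`, a contradiction. -/
theorem coeff_eq_zero_of_tendsto {c : ℂ} {P : LogLaurent}
    (h : Tendsto (evalAt c P) (𝓝[>] 0) (𝓝 0)) (x : ℤ × ℕ) (hx : x.1 ≤ 0) : P.coeff x = 0 := by
  by_contra hne
  -- Dominance near `0` is lexicographic: the smaller power of `τ` first, then the larger power of
  -- the logarithm, hence the sign.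
  obtain ⟨z, hz, hmin⟩ := Finset.exists_min_image P.coeff.support
    (fun x => toLex (x.1, -(x.2 : ℤ))) ⟨x, by simpa using hne⟩
  have hz0 : P.coeff z ≠ 0 := by simpa using hz
  have hz1 : z.1 ≤ 0 := by
    have := hmin x (by simpa using hne)
    rw [Prod.Lex.le_iff] at this
    simp only [ofLex_toLex] at this
    omega
  have h1 : Tendsto (fun y : ℝ => evalAt c P y / monoAt c z y) (𝓝[>] 0) (𝓝 (P.coeff z)) := by
    have h2 : ∀ᶠ y : ℝ in 𝓝[>] 0, ∑ x ∈ P.coeff.support,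
        P.coeff x * (monoAt c x y / monoAt c z y) = evalAt c P y / monoAt c z y :=
      .of_forall fun y => by simp only [evalAt, Finsupp.sum, Finset.sum_div, mul_div_assoc]
    refine Tendsto.congr' h2 ?_
    have h3 : P.coeff z = ∑ x ∈ P.coeff.support, P.coeff x * (if x = z then 1 else 0) := by
      simp [hz0]
    rw [h3]
    refine tendsto_finsetSum _ fun x hx => Tendsto.const_mul _ ?_
    split_ifs with hxz
    · subst hxz
      refine tendsto_const_nhds.congr' ?_
      filter_upwards [self_mem_nhdsWithin, (tendsto_norm_logAt c).eventually_ge_atTop 1]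
        with y hy hl
      exact (div_self (monoAt_ne_zero x hy (norm_pos_iff.1 (by linarith)))).symm
    · refine tendsto_monoAt_div c ?_
      have := hmin x hx
      rw [Prod.Lex.le_iff] at this
      simp only [ofLex_toLex] at this
      have : ¬ (x.1 = z.1 ∧ x.2 = z.2) := fun h => hxz (Prod.ext h.1 h.2)
      omega
  have h4 : Tendsto (fun y : ℝ => evalAt c P y / monoAt c z y) (𝓝[>] 0) (𝓝 0) := by
    rw [tendsto_zero_iff_norm_tendsto_zero] at h ⊢
    refine squeeze_zero' (.of_forall fun _ => norm_nonneg _) ?_ h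
    filter_upwards [Ioo_mem_nhdsGT (zero_lt_one (α := ℝ)),
      (tendsto_norm_logAt c).eventually_ge_atTop 1] with y hy hl
    rw [norm_div]
    refine div_le_self (norm_nonneg _) ?_
    have h0 : 0 < y := hy.1
    rw [monoAt, norm_mul, norm_pow, norm_zpow, norm_mul, Complex.norm_I, one_mul,
      Complex.norm_real, Real.norm_of_nonneg h0.le]
    exact one_le_mul_of_one_le_of_one_le (one_le_zpow_of_nonpos₀ h0 hy.2.le hz1) (one_le_pow₀ hl)
  exact hz0 (tendsto_nhds_unique h1 h4)

lemma HasExp.unique {c : ℂ} {f : ℝ → ℂ} {P Q : LogLaurent} (hP : HasExp c f P)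
    (hQ : HasExp c f Q) (x : ℤ × ℕ) (hx : x.1 ≤ 0) : P.coeff x = Q.coeff x := by
  have h : FlatAtZero fun y => evalAt c (Q - P) y := by
    refine (FlatAtZero.add hP (FlatAtZero.const_mul hQ (-1))).congr (.of_forall fun y => ?_)
    simp only [evalAt_sub]; ring
  have := coeff_eq_zero_of_tendsto h.tendsto x hx
  rw [AddMonoidAlgebra.coeff_sub, Finsupp.sub_apply, sub_eq_zero] at this
  exact this.symm

/-! ### Regularized values -/

lemma tendsto_monoAt_zero (c : ℂ) {x : ℤ × ℕ} (hx : 0 < x.1) :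
    Tendsto (monoAt c x) (𝓝[>] 0) (𝓝 0) := by
  refine (tendsto_monoAt_div c (x₀ := 0) (Or.inl hx)).congr fun y => ?_
  simp [monoAt]

lemma evalAt_finsetSum {ι : Type*} (c : ℂ) (s : Finset ι) (P : ι → LogLaurent) (y : ℝ) :
    evalAt c (∑ i ∈ s, P i) y = ∑ i ∈ s, evalAt c (P i) y := by
  induction s using Finset.cons_induction with
  | empty => simp [evalAt_zero]
  | cons a s ha ih => rw [Finset.sum_cons, Finset.sum_cons, evalAt_add, ih]

/-- Positive powers of `τ` tend to `0` even when multiplied by logarithms, so admitting them changes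
nothing; it allows working in a ring. -/
lemma isRegValue_iff {c : ℂ} {f : ℂ → ℂ} {v : ℂ} :
    IsRegValue c f v ↔ ∃ P : LogLaurent, P.coeff 0 = v ∧
      Tendsto (fun y : ℝ => f (Complex.I * y) - evalAt c P y) (𝓝[>] 0) (𝓝 0) := by
  constructor
  · rintro ⟨N, a, rfl, h⟩
    refine ⟨∑ m ∈ Finset.range (N + 1), ∑ j ∈ Finset.range (N + 1),
      AddMonoidAlgebra.single (-(m : ℤ), j) (a m j), ?_, h.congr fun y => ?_⟩
    · simp only [AddMonoidAlgebra.coeff_sum, AddMonoidAlgebra.coeff_single, Finsupp.finsetSum_apply]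
      rw [Finset.sum_eq_single 0, Finset.sum_eq_single 0]
      · exact Finsupp.single_eq_same
      · intro j _ hj
        rw [Finsupp.single_apply, if_neg]
        simp [Prod.ext_iff, hj]
      · simp
      · intro m _ hm
        refine Finset.sum_eq_zero fun j _ => ?_
        rw [Finsupp.single_apply, if_neg]
        simp [Prod.ext_iff, hm]
      · simp
    · simp only [evalAt_finsetSum, evalAt_single, monoAt, zpow_neg, zpow_natCast, inv_pow, logAt,
        mul_assoc]
  · rintro ⟨P, rfl, h⟩
    set S := P.coeff.support
    set N := S.sup fun x => max x.1.natAbs x.2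
    refine ⟨N, fun m j => P.coeff (-(m : ℤ), j), by simp; rfl, ?_⟩
    have h1 : Tendsto (fun y : ℝ => ∑ x ∈ S with 0 < x.1, P.coeff x * monoAt c x y)
        (𝓝[>] 0) (𝓝 0) := by
      have h0 := Finset.sum_const_zero (M := ℂ) (s := S.filter fun x => 0 < x.1)
      rw [← h0]
      refine tendsto_finsetSum _ fun x hx => ?_
      simpa using (tendsto_monoAt_zero c (Finset.mem_filter.1 hx).2).const_mul (P.coeff x)
    have h2 := h.add h1
    rw [add_zero] at h2
    refine h2.congr fun y => ?_
    have h3 : ∑ m ∈ Finset.range (N + 1), ∑ j ∈ Finset.range (N + 1),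
          P.coeff (-(m : ℤ), j) * ((Complex.I * y)⁻¹) ^ m * (Complex.log (Complex.I * y) - c) ^ j
        = ∑ x ∈ S with ¬ 0 < x.1, P.coeff x * monoAt c x y := by
      rw [← Finset.sum_product']
      symm
      refine Finset.sum_of_injOn (fun x => (x.1.natAbs, x.2)) ?_ ?_ ?_ ?_
      · rintro ⟨m, j⟩ hx ⟨m', j'⟩ hx' h
        simp only [Finset.coe_filter, mem_ofPred_eq, Prod.mk.injEq] at hx hx' h ⊢
        omega
      · rintro ⟨m, j⟩ hx
        simp only [Finset.coe_filter, mem_ofPred_eq] at hx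
        have := Finset.le_sup (f := fun x : ℤ × ℕ => max x.1.natAbs x.2) hx.1
        simp only [Finset.coe_product, Finset.coe_range, mem_prod, mem_Iio]
        simp only at this
        omega
      · rintro ⟨m, j⟩ _ hx
        by_cases h0 : P.coeff (-(m : ℤ), j) = 0
        · simp [h0]
        · refine absurd ⟨(-(m : ℤ), j), ?_, ?_⟩ hx
          · simpa [S] using h0
          · simp
      · rintro ⟨m, j⟩ hx
        have hm : m ≤ 0 := by simpa using (Finset.mem_filter.1 hx).2
        obtain ⟨n, rfl⟩ : ∃ n : ℕ, m = -n := ⟨m.natAbs, by omega⟩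
        simp only [Int.natAbs_neg, Int.natAbs_natCast, monoAt, logAt, zpow_neg, zpow_natCast,
          inv_pow, mul_assoc]
    rw [h3, evalAt, Finsupp.sum,
      ← Finset.sum_filter_add_sum_filter_not S (fun x : ℤ × ℕ => 0 < x.1)]
    ring

lemma IsRegValue.unique {c : ℂ} {f : ℂ → ℂ} {v w : ℂ} (hv : IsRegValue c f v)
    (hw : IsRegValue c f w) : v = w := by
  obtain ⟨P, rfl, hP⟩ := isRegValue_iff.1 hv
  obtain ⟨Q, rfl, hQ⟩ := isRegValue_iff.1 hw
  have h : Tendsto (evalAt c (P - Q)) (𝓝[>] 0) (𝓝 0) := by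
    have := hQ.sub hP
    rw [sub_zero] at this
    refine this.congr fun y => ?_
    rw [evalAt_sub]; ring
  have := coeff_eq_zero_of_tendsto h 0 le_rfl
  rwa [AddMonoidAlgebra.coeff_sub, Finsupp.sub_apply, sub_eq_zero] at this

lemma HasExp.isRegValue {c : ℂ} {f : ℂ → ℂ} {P : LogLaurent}
    (h : HasExp c (fun y => f (Complex.I * y)) P) : IsRegValue c f (P.coeff 0) :=
  isRegValue_iff.2 ⟨P, rfl, FlatAtZero.tendsto h⟩

/-! ### Coefficients and primitives -/

/-- The elements of `LogLaurent` whose coefficients lie in `V`. -/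
def coeffsIn (V : Submodule ℚ ℂ) : Submodule ℚ LogLaurent where
  carrier := {P | ∀ x, P.coeff x ∈ V}
  add_mem' hP hQ x := by
    rw [AddMonoidAlgebra.coeff_add]; exact V.add_mem (hP x) (hQ x)
  zero_mem' x := by rw [AddMonoidAlgebra.coeff_zero]; exact V.zero_mem
  smul_mem' a P hP x := by
    rw [AddMonoidAlgebra.coeff_smul_apply]; exact V.smul_mem a (hP x)

lemma coeffsIn_mono {V W : Submodule ℚ ℂ} (h : V ≤ W) : coeffsIn V ≤ coeffsIn W :=
  fun _ hP x => h (hP x)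

lemma single_mem_coeffsIn {V : Submodule ℚ ℂ} {a : ℂ} (ha : a ∈ V) (x : ℤ × ℕ) :
    AddMonoidAlgebra.single x a ∈ coeffsIn V := by
  intro z
  rw [AddMonoidAlgebra.coeff_single, Finsupp.single_apply]
  split_ifs
  exacts [ha, V.zero_mem]

lemma mul_mem_coeffsIn {U V W : Submodule ℚ ℂ} (h : ∀ u ∈ U, ∀ v ∈ V, u * v ∈ W)
    {P Q : LogLaurent} (hP : P ∈ coeffsIn U) (hQ : Q ∈ coeffsIn V) : P * Q ∈ coeffsIn W := by
  rw [AddMonoidAlgebra.mul_def]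
  exact Submodule.sum_mem _ fun x _ => Submodule.sum_mem _ fun z _ =>
    single_mem_coeffsIn (h _ (hP x) _ (hQ z)) _

/-- The elements with rational coefficients. -/
abbrev ratCoeffs : Submodule ℚ LogLaurent := coeffsIn (1 : Submodule ℚ ℂ)

lemma rat_mem_one (q : ℚ) : (q : ℂ) ∈ (1 : Submodule ℚ ℂ) :=
  Submodule.mem_one.2 ⟨q, by simp⟩

lemma ratCoeffs_mul_mem {V : Submodule ℚ ℂ} {P Q : LogLaurent} (hP : P ∈ ratCoeffs)
    (hQ : Q ∈ coeffsIn V) : P * Q ∈ coeffsIn V := by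
  refine mul_mem_coeffsIn ?_ hP hQ
  intro u hu v hv
  obtain ⟨q, rfl⟩ := Submodule.mem_one.1 hu
  rw [← Algebra.smul_def]
  exact V.smul_mem q hv

/-- The coefficientwise induction principle for `coeffsIn V`. -/
lemma coeffsIn_induction {V : Submodule ℚ ℂ} {p : LogLaurent → Prop} (h0 : p 0)
    (hadd : ∀ P Q, p P → p Q → p (P + Q))
    (hsingle : ∀ x, ∀ a ∈ V, p (AddMonoidAlgebra.single x a)) {P : LogLaurent}
    (hP : P ∈ coeffsIn V) : p P := by
  rw [← AddMonoidAlgebra.sum_coeff_single P, Finsupp.sum]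
  exact Finset.sum_induction _ p hadd h0 fun x _ => hsingle x _ (hP x)

/-- `Q` is a primitive of `P` with respect to `τ` and has no constant term. -/
def IsPrim (c : ℂ) (P Q : LogLaurent) : Prop :=
  Q.coeff 0 = 0 ∧ ∀ y, 0 < y → HasDerivAt (evalAt c Q) (Complex.I * evalAt c P y) y

lemma hasDerivAt_I_mul (y : ℝ) : HasDerivAt (fun y : ℝ => Complex.I * (y : ℂ)) Complex.I y := by
  simpa using (Complex.ofRealCLM.hasDerivAt (x := y)).const_mul Complex.I

lemma hasDerivAt_logAt (c : ℂ) {y : ℝ} (hy : 0 < y) :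
    HasDerivAt (logAt c) (Complex.I * (Complex.I * (y : ℂ))⁻¹) y := by
  have h : HasDerivAt (fun y : ℝ => (Real.log y : ℂ) + (Real.pi / 2 * Complex.I - c))
      ((y⁻¹ : ℝ) : ℂ) y := ((Real.hasDerivAt_log hy.ne').ofReal_comp).add_const _
  have e : Complex.I * (Complex.I * (y : ℂ))⁻¹ = ((y⁻¹ : ℝ) : ℂ) := by
    push_cast
    rw [mul_inv, ← mul_assoc, mul_inv_cancel₀ Complex.I_ne_zero, one_mul]
  rw [e]
  refine h.congr_of_eventuallyEq ?_
  filter_upwards [lt_mem_nhds hy] with z hz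
  exact logAt_eq c hz

lemma hasDerivAt_monoAt (c : ℂ) (m : ℤ) (j : ℕ) {y : ℝ} (hy : 0 < y) :
    HasDerivAt (monoAt c (m, j)) (Complex.I *
      (m * monoAt c (m - 1, j) y + j * monoAt c (m - 1, j - 1) y)) y := by
  have hI : Complex.I * (y : ℂ) ≠ 0 := by simp [hy.ne']
  have h1 : HasDerivAt (fun y : ℝ => (Complex.I * (y : ℂ)) ^ m)
      (m * (Complex.I * (y : ℂ)) ^ (m - 1) * Complex.I) y :=
    HasDerivAt.comp (h₂ := fun z : ℂ => z ^ m) y (hasDerivAt_zpow m (Complex.I * (y : ℂ)) (Or.inl hI))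
      (hasDerivAt_I_mul y)
  refine (h1.fun_mul ((hasDerivAt_logAt c hy).fun_pow j)).congr_deriv ?_
  simp only [monoAt, zpow_sub_one₀ hI]
  ring

lemma hasDerivAt_evalAt_single (c : ℂ) (m : ℤ) (j : ℕ) (a : ℂ) {y : ℝ} (hy : 0 < y) :
    HasDerivAt (evalAt c (AddMonoidAlgebra.single (m, j) a)) (a * (Complex.I *
      (m * monoAt c (m - 1, j) y + j * monoAt c (m - 1, j - 1) y))) y := by
  have e : evalAt c (AddMonoidAlgebra.single (m, j) a) = fun y => a * monoAt c (m, j) y :=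
    funext fun y => evalAt_single c _ _ y
  exact e ▸ (hasDerivAt_monoAt c m j hy).const_mul a

/-- For `m = -1` the primitive is a power of the logarithm. Otherwise integration by parts produces
`τ^(m+1)` with `m + 1 ≠ 0` and lowers the power of the logarithm. Only rational factors occur, and
never the constant monomial. -/
lemma exists_isPrim_single (c : ℂ) {V : Submodule ℚ ℂ} {a : ℂ} (ha : a ∈ V) (m : ℤ) (j : ℕ) :
    ∃ Q ∈ coeffsIn V, IsPrim c (AddMonoidAlgebra.single (m, j) a) Q := by
  have hdiv : ∀ {b : ℂ} (n : ℤ), b ∈ V → (n : ℂ)⁻¹ * b ∈ V := fun {b} n hb => by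
    have := V.smul_mem ((n : ℚ)⁻¹) hb
    rwa [Algebra.smul_def, map_inv₀, map_intCast] at this
  by_cases hm : m = -1
  · subst hm
    refine ⟨AddMonoidAlgebra.single (0, j + 1) (((j + 1 : ℤ) : ℂ)⁻¹ * a),
      single_mem_coeffsIn (hdiv _ ha) _, ?_, fun y hy => ?_⟩
    · rw [AddMonoidAlgebra.coeff_single, Finsupp.single_apply, if_neg]
      simp [Prod.ext_iff]
    · have := hasDerivAt_evalAt_single c 0 (j + 1) (((j + 1 : ℤ) : ℂ)⁻¹ * a) hy
      refine this.congr_deriv ?_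
      have hj : (j : ℂ) + 1 ≠ 0 := by exact_mod_cast Nat.succ_ne_zero j
      rw [evalAt_single]
      push_cast
      simp only [zero_mul, zero_add]
      field_simp
  · have hm' : (m : ℂ) + 1 ≠ 0 := by
      intro h
      apply hm
      have : ((m + 1 : ℤ) : ℂ) = 0 := by push_cast; exact h
      rw [Int.cast_eq_zero] at this
      omega
    induction j generalizing a with
    | zero =>
      refine ⟨AddMonoidAlgebra.single (m + 1, 0) (((m + 1 : ℤ) : ℂ)⁻¹ * a),
        single_mem_coeffsIn (hdiv _ ha) _, ?_, fun y hy => ?_⟩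
      · rw [AddMonoidAlgebra.coeff_single, Finsupp.single_apply, if_neg]
        simp only [Prod.ext_iff, Prod.fst_zero]
        omega
      · have := hasDerivAt_evalAt_single c (m + 1) 0 (((m + 1 : ℤ) : ℂ)⁻¹ * a) hy
        refine this.congr_deriv ?_
        rw [evalAt_single]
        push_cast
        simp only [add_sub_cancel_right, zero_mul, add_zero]
        field_simp
    | succ j ih =>
      have hb : -((j + 1 : ℕ) : ℂ) * (((m + 1 : ℤ) : ℂ)⁻¹ * a) ∈ V := by
        have := V.smul_mem (-((j + 1 : ℕ) : ℚ)) (hdiv (m + 1) ha)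
        rwa [Algebra.smul_def, map_neg, map_natCast] at this
      obtain ⟨Q, hQ, hQ0, hQd⟩ := ih hb
      refine ⟨AddMonoidAlgebra.single (m + 1, j + 1) (((m + 1 : ℤ) : ℂ)⁻¹ * a) + Q,
        Submodule.add_mem _ (single_mem_coeffsIn (hdiv _ ha) _) hQ, ?_, fun y hy => ?_⟩
      · rw [AddMonoidAlgebra.coeff_add, Finsupp.add_apply, hQ0, add_zero,
          AddMonoidAlgebra.coeff_single, Finsupp.single_apply, if_neg]
        simp [Prod.ext_iff]
      · have h1 := hasDerivAt_evalAt_single c (m + 1) (j + 1) (((m + 1 : ℤ) : ℂ)⁻¹ * a) hy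
        have h2 := h1.add (hQd y hy)
        have e : evalAt c (AddMonoidAlgebra.single (m + 1, j + 1) (((m + 1 : ℤ) : ℂ)⁻¹ * a) + Q) =
          evalAt c (AddMonoidAlgebra.single (m + 1, j + 1) (((m + 1 : ℤ) : ℂ)⁻¹ * a)) +
            evalAt c Q := funext fun y => evalAt_add c _ _ y
        rw [e]
        refine h2.congr_deriv ?_
        rw [evalAt_single, evalAt_single]
        push_cast
        simp only [add_sub_cancel_right]
        field_simp
        ring

lemma exists_isPrim (c : ℂ) {V : Submodule ℚ ℂ} {P : LogLaurent} (hP : P ∈ coeffsIn V) :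
    ∃ Q ∈ coeffsIn V, IsPrim c P Q := by
  refine coeffsIn_induction (p := fun P => ∃ Q ∈ coeffsIn V, IsPrim c P Q) ?_ ?_ ?_ hP
  · refine ⟨0, Submodule.zero_mem _, rfl, fun y _ => ?_⟩
    have : evalAt c 0 = fun _ => 0 := funext (evalAt_zero c)
    simpa [this] using hasDerivAt_const y (0 : ℂ)
  · rintro P P' ⟨Q, hQ, hQ0, hQd⟩ ⟨Q', hQ', hQ0', hQd'⟩
    refine ⟨Q + Q', Submodule.add_mem _ hQ hQ', ?_, fun y hy => ?_⟩
    · rw [AddMonoidAlgebra.coeff_add, Finsupp.add_apply, hQ0, hQ0', add_zero]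
    · have : evalAt c (Q + Q') = evalAt c Q + evalAt c Q' := funext (evalAt_add c Q Q')
      rw [this, evalAt_add, mul_add]
      exact (hQd y hy).add (hQd' y hy)
  · exact fun x a ha => exists_isPrim_single c ha x.1 x.2

/-! ### Integrating expansions -/

/-- A bounded derivative makes `d` Lipschitz near `0`, so the limit `ρ` exists. Letting `x → 0` in
the mean value estimate on `[x, y]` then gives flatness of `d - ρ`. -/
lemma exists_flat_of_flat_deriv {d e : ℝ → ℂ} (h : ∀ y, 0 < y → HasDerivAt d (e y) y)
    (he : FlatAtZero e) : ∃ ρ : ℂ, FlatAtZero fun y => d y - ρ := by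
  have hb : ∀ N : ℕ, ∃ C δ : ℝ, 0 ≤ C ∧ 0 < δ ∧ ∀ x y : ℝ, 0 < x → x ≤ y → y < δ →
      ‖d y - d x‖ ≤ C * y ^ N * (y - x) := by
    intro N
    obtain ⟨C, hC0, hC⟩ := (he N).exists_nonneg
    obtain ⟨δ, hδ, hδ'⟩ := mem_nhdsGT_iff_exists_Ioo_subset.1 hC.bound
    refine ⟨C, δ, hC0, hδ, fun x y hx hxy hy => ?_⟩
    refine norm_image_sub_le_of_norm_deriv_le_segment' (f' := e) (fun t ht => ?_) (fun t ht => ?_) y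
      (right_mem_Icc.2 hxy)
    · exact (h t (hx.trans_le ht.1)).hasDerivWithinAt
    · have h0 : 0 < t := hx.trans_le ht.1
      have := hδ' ⟨h0, ht.2.trans hy⟩
      simp only [mem_ofPred_eq] at this
      refine this.trans ?_
      rw [Real.norm_of_nonneg (by positivity)]
      gcongr
      exact ht.2.le
  obtain ⟨C, δ, hC0, hδ, hC⟩ := hb 0
  have hcau : Cauchy (map d (𝓝[>] 0)) := by
    have hlip : LipschitzOnWith C.toNNReal d (Ioo 0 δ) := by
      refine LipschitzOnWith.of_dist_le_mul fun x hx y hy => ?_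
      rw [Real.coe_toNNReal _ hC0, dist_eq_norm, Real.dist_eq]
      rcases le_total x y with hxy | hxy
      · have := hC x y hx.1 hxy hy.2
        rw [pow_zero, mul_one] at this
        rwa [norm_sub_rev, abs_sub_comm, abs_of_nonneg (by linarith)]
      · have := hC y x hy.1 hxy hx.2
        rw [pow_zero, mul_one] at this
        rwa [abs_of_nonneg (by linarith)]
    have hne : (𝓝[Ioo 0 δ] (0 : ℝ)).NeBot := by
      rw [nhdsWithin_Ioo_eq_nhdsGT hδ]; infer_instance
    have h1 : Cauchy (𝓝[Ioo 0 δ] (0 : ℝ)) := cauchy_nhds.mono nhdsWithin_le_nhds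
    have h2 := h1.map_of_le hlip.uniformContinuousOn inf_le_right
    rwa [nhdsWithin_Ioo_eq_nhdsGT hδ] at h2
  obtain ⟨ρ, hρ⟩ := CompleteSpace.complete hcau
  refine ⟨ρ, fun N => ?_⟩
  obtain ⟨C, δ, hC0, hδ, hC⟩ := hb N
  refine Asymptotics.IsBigO.of_bound C ?_
  filter_upwards [Ioo_mem_nhdsGT hδ, Ioo_mem_nhdsGT (zero_lt_one (α := ℝ))] with y hy hy1
  have h0 : 0 < y := hy.1
  have h1 : Tendsto (fun x => ‖d y - d x‖) (𝓝[>] 0) (𝓝 ‖d y - ρ‖) :=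
    (tendsto_const_nhds.sub hρ).norm
  rw [Real.norm_of_nonneg (by positivity)]
  refine le_of_tendsto h1 ?_
  filter_upwards [Ioo_mem_nhdsGT h0] with x hx
  refine (hC x y hx.1 hx.2.le hy.2).trans ?_
  refine mul_le_of_le_one_right (by positivity) ?_
  linarith [hx.1, hy1.2]

/-- Expansions may be integrated term by term, by subtracting `Q` and applying
`exists_flat_of_flat_deriv`. Since `Q` has no constant term, the constant of integration `ρ` is
exactly the regularized value. -/
lemma HasExp.of_deriv {c : ℂ} {f g : ℝ → ℂ} {R Q : LogLaurent}
    (hf : ∀ y, 0 < y → HasDerivAt f (Complex.I * g y) y) (hg : HasExp c g R)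
    (hQ : IsPrim c R Q) : ∃ ρ : ℂ, HasExp c f (AddMonoidAlgebra.single 0 ρ + Q) := by
  obtain ⟨ρ, hρ⟩ := exists_flat_of_flat_deriv (d := fun y => f y - evalAt c Q y)
    (e := fun y => Complex.I * (g y - evalAt c R y))
    (fun y hy => ((hf y hy).sub (hQ.2 y hy)).congr_deriv (by ring)) (FlatAtZero.const_mul hg _)
  refine ⟨ρ, FlatAtZero.congr hρ (.of_forall fun y => ?_)⟩
  have : monoAt c 0 y = 1 := by simp [monoAt]
  simp only [evalAt_add, evalAt_single, this]
  ring

/-! ### Rapid decay at infinity -/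

lemma RapidDecay.add {f g : ℝ → ℂ} (hf : RapidDecay f) (hg : RapidDecay g) :
    RapidDecay fun y => f y + g y := fun N => (hf N).add (hg N)

lemma RapidDecay.const_mul {f : ℝ → ℂ} (hf : RapidDecay f) (a : ℂ) :
    RapidDecay fun y => a * f y := fun N => (hf N).const_mul_left a

lemma RapidDecay.congr {f g : ℝ → ℂ} (hf : RapidDecay f) (h : ∀ y, 0 < y → f y = g y) :
    RapidDecay g := fun N => (hf N).congr' (by
      filter_upwards [eventually_gt_atTop 0] with y hy using h y hy) EventuallyEq.rfl

lemma RapidDecay.mul_of_isBigO {f g : ℝ → ℂ} (hf : RapidDecay f) {M : ℕ}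
    (hg : g =O[atTop] fun y : ℝ => y ^ M) : RapidDecay fun y => f y * g y := by
  intro N
  refine ((hf (N + M)).mul hg).congr' EventuallyEq.rfl ?_
  filter_upwards [eventually_gt_atTop 0] with y hy
  field_simp
  ring

lemma RapidDecay.mul_pow {f : ℝ → ℂ} (hf : RapidDecay f) (p : ℕ) :
    RapidDecay fun y => f y * (Complex.I * y) ^ p :=
  hf.mul_of_isBigO (M := p) <| Asymptotics.IsBigO.of_bound 1 <| .of_forall fun y => by simp

lemma RapidDecay.isBigO_one {f : ℝ → ℂ} (hf : RapidDecay f) :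
    f =O[atTop] fun _ : ℝ => (1 : ℝ) := by simpa using hf 0

lemma RapidDecay.mul {f g : ℝ → ℂ} (hf : RapidDecay f) (hg : RapidDecay g) :
    RapidDecay fun y => f y * g y :=
  hf.mul_of_isBigO (M := 0) (by simpa using hg.isBigO_one)

lemma RapidDecay.tendsto {f : ℝ → ℂ} (hf : RapidDecay f) : Tendsto f atTop (𝓝 0) := by
  refine (hf 1).trans_tendsto ?_
  simpa [pow_one] using! tendsto_inv_atTop_zero (𝕜 := ℝ)

lemma RapidDecay.isBigO_rpow {f : ℝ → ℂ} (hf : RapidDecay f) (a : ℝ) :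
    f =O[atTop] fun y : ℝ => y ^ (-a) := by
  obtain ⟨N, hN⟩ := exists_nat_ge a
  refine (hf N).trans (Asymptotics.IsBigO.of_bound 1 ?_)
  filter_upwards [eventually_ge_atTop 1] with y hy
  have h0 : 0 < y := by linarith
  rw [Real.norm_of_nonneg (by positivity), Real.norm_of_nonneg (by positivity), one_mul,
    ← Real.rpow_natCast, ← Real.rpow_neg h0.le]
  exact Real.rpow_le_rpow_of_exponent_le hy (by linarith)

lemma RapidDecay.integrableOn {f : ℝ → ℂ} (hf : RapidDecay f) (hc : ContinuousOn f (Ioi 0))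
    {y : ℝ} (hy : 0 < y) : IntegrableOn f (Ioi y) := by
  refine LocallyIntegrableOn.integrableOn_of_isBigO_atTop (g := fun y : ℝ => y ^ (-2 : ℝ)) ?_
    (hf.isBigO_rpow 2) ?_ |>.mono_set Ioi_subset_Ici_self
  · exact (hc.mono fun z (hz : y ≤ z) => hy.trans_le hz).locallyIntegrableOn measurableSet_Ici
  · exact ⟨Ioi 1, Ioi_mem_atTop 1, integrableOn_Ioi_rpow_of_lt (by norm_num) one_pos⟩

lemma RapidDecay.hasDerivAt_integral {f : ℝ → ℂ} (hf : RapidDecay f)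
    (hc : ContinuousOn f (Ioi 0)) {y : ℝ} (hy : 0 < y) :
    HasDerivAt (fun y => ∫ t in Ioi y, f t) (-f y) y := by
  have hy2 : 0 < y / 2 := by positivity
  have hint := hf.integrableOn hc hy2
  have hev : (fun z => ∫ t in Ioi z, f t) =ᶠ[𝓝 y]
      fun z => (∫ t in Ioi (y / 2), f t) - ∫ t in (y / 2)..z, f t := by
    filter_upwards [lt_mem_nhds (show y / 2 < y by linarith)] with z hz
    rw [eq_sub_iff_add_eq, add_comm]
    exact intervalIntegral.integral_interval_add_Ioi hint (hint.mono_set (Ioi_subset_Ioi hz.le))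
  refine HasDerivAt.congr_of_eventuallyEq ?_ hev
  rw [← zero_sub (f y)]
  refine (hasDerivAt_const y _).sub ?_
  refine intervalIntegral.integral_hasDerivAt_right ?_ ?_ ?_
  · refine ContinuousOn.intervalIntegrable (hc.mono fun t ht => ?_)
    rw [uIcc_of_le (by linarith)] at ht
    exact hy2.trans_le ht.1
  · exact hc.stronglyMeasurableAtFilter isOpen_Ioi y hy
  · exact hc.continuousAt (Ioi_mem_nhds hy)

/-- For `t > y` the bound `t^(-N-2)` is at most `y^(-N) t^(-2)`, and `t^(-2)` is integrable. -/
lemma RapidDecay.integral {f : ℝ → ℂ} (hf : RapidDecay f) :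
    RapidDecay fun y => ∫ t in Ioi y, f t := by
  intro N
  obtain ⟨C, hC0, hC⟩ := (hf (N + 2)).exists_nonneg
  obtain ⟨Y, hY⟩ := eventually_atTop.1 hC.bound
  refine Asymptotics.IsBigO.of_bound C ?_
  filter_upwards [eventually_ge_atTop Y, eventually_ge_atTop 1] with y hy hy1
  have h0 : 0 < y := by linarith
  have hint : IntegrableOn (fun t : ℝ => C * (y ^ N)⁻¹ * t ^ (-2 : ℝ)) (Ioi y) :=
    (integrableOn_Ioi_rpow_of_lt (by norm_num) h0).const_mul _
  have hle : ‖∫ t in Ioi y, f t‖ ≤ ∫ t in Ioi y, C * (y ^ N)⁻¹ * t ^ (-2 : ℝ) := by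
    refine norm_integral_le_of_norm_le hint ?_
    filter_upwards [ae_restrict_mem measurableSet_Ioi] with t ht
    have ht : y < t := ht
    have ht0 : 0 < t := h0.trans ht
    refine (hY t (hy.trans ht.le)).trans ?_
    have e : t ^ (-2 : ℝ) = (t ^ 2)⁻¹ := by
      rw [Real.rpow_neg ht0.le]; norm_cast
    rw [Real.norm_of_nonneg (by positivity), e, pow_add, mul_inv, mul_assoc]
    gcongr
  refine hle.trans ?_
  rw [integral_const_mul, integral_Ioi_rpow_of_lt (by norm_num) h0,
    Real.norm_of_nonneg (by positivity)]
  refine mul_le_of_le_one_right (by positivity) ?_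
  norm_num
  rw [Real.rpow_neg_one]
  exact inv_le_one_of_one_le₀ hy1

/-- Two functions with the same derivative on `(0, ∞)` that vanish at infinity agree. -/
lemma eqOn_of_hasDerivAt {f g h : ℝ → ℂ} (hf : ∀ y, 0 < y → HasDerivAt f (h y) y)
    (hg : ∀ y, 0 < y → HasDerivAt g (h y) y) (hf0 : Tendsto f atTop (𝓝 0))
    (hg0 : Tendsto g atTop (𝓝 0)) {y : ℝ} (hy : 0 < y) : f y = g y := by
  have hd : ∀ z ∈ Ioi (0 : ℝ), HasDerivAt (fun z => f z - g z) 0 z := fun z hz => by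
    simpa using (hf z hz).fun_sub (hg z hz)
  have hconst : ∀ z, 0 < z → f z - g z = f y - g y := fun z hz =>
    isOpen_Ioi.is_const_of_deriv_eq_zero isPreconnected_Ioi
      (fun z hz => (hd z hz).differentiableAt.differentiableWithinAt)
      (fun z hz => (hd z hz).deriv) hz hy
  have h1 : Tendsto (fun z => f z - g z) atTop (𝓝 (f y - g y)) :=
    tendsto_const_nhds.congr' (by
      filter_upwards [eventually_gt_atTop 0] with z hz using (hconst z hz).symm)
  have h2 := hf0.sub hg0
  rw [sub_zero] at h2
  exact sub_eq_zero.1 (tendsto_nhds_unique h1 h2)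

/-! ### Exponential sums -/

/-- The exponential sum `∑ a_i e^{2πi N_i τ}` at `τ = iy`. -/
def expSum {ι : Type*} (a : ι → ℂ) (N : ι → ℕ) (y : ℝ) : ℂ :=
  ∑' i, a i * Complex.exp (2 * Real.pi * Complex.I * (N i) * (Complex.I * y))

/-- Absolute convergence of an exponential sum in the upper half plane. -/
def ExpSummable {ι : Type*} (a : ι → ℂ) (N : ι → ℕ) : Prop :=
  ∀ t : ℝ, 0 < t → Summable fun i => ‖a i‖ * Real.exp (-t * N i)

lemma norm_exp_two_pi (n : ℕ) (y : ℝ) :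
    ‖Complex.exp (2 * Real.pi * Complex.I * n * (Complex.I * y))‖ =
      Real.exp (-(2 * Real.pi * y) * n) := by
  have : 2 * Real.pi * Complex.I * n * (Complex.I * y) = ((-(2 * Real.pi * y) * n : ℝ) : ℂ) := by
    push_cast
    linear_combination (2 * Real.pi * n * y : ℂ) * Complex.I_mul_I
  rw [this, Complex.norm_exp_ofReal]

section
variable {ι : Type*} {a : ι → ℂ} {N : ι → ℕ}

lemma ExpSummable.summable (h : ExpSummable a N) {y : ℝ} (hy : 0 < y) :
    Summable fun i => a i * Complex.exp (2 * Real.pi * Complex.I * (N i) * (Complex.I * y)) := by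
  refine Summable.of_norm ((h (2 * Real.pi * y) (by positivity)).congr fun i => ?_)
  rw [norm_mul, norm_exp_two_pi]

/-- Half of the exponential absorbs the factor `N`, since `N exp(-tN/2) ≤ 2/t`; the other half keeps
the sum convergent. -/
lemma ExpSummable.mul_natCast (h : ExpSummable a N) : ExpSummable (fun i => a i * N i) N := by
  intro t ht
  refine Summable.of_nonneg_of_le (fun i => by positivity) (fun i => ?_)
    ((h (t / 2) (by positivity)).mul_right (2 / t))
  have h1 : (t / 2) * N i ≤ Real.exp (t / 2 * N i) := by
    linarith [Real.add_one_le_exp (t / 2 * N i)]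
  have h2 : Real.exp (-t * N i) = Real.exp (-(t / 2) * N i) * Real.exp (-(t / 2) * N i) := by
    rw [← Real.exp_add]; congr 1; ring
  have h3 : Real.exp (t / 2 * N i) * Real.exp (-(t / 2) * N i) = 1 := by
    rw [← Real.exp_add]; simp
  have h4 : (N i : ℝ) * Real.exp (-(t / 2) * N i) ≤ 2 / t := by
    have := mul_le_mul_of_nonneg_right h1 (Real.exp_nonneg (-(t / 2) * N i))
    rw [h3] at this
    rw [le_div_iff₀ ht]
    linarith
  rw [norm_mul, Complex.norm_natCast, h2]
  calc ‖a i‖ * N i * (Real.exp (-(t / 2) * N i) * Real.exp (-(t / 2) * N i))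
      = ‖a i‖ * Real.exp (-(t / 2) * N i) * (N i * Real.exp (-(t / 2) * N i)) := by ring
    _ ≤ _ := by gcongr

/-- Termwise differentiation is legitimate on `(y/2, ∞)`, where the series of derivatives is
majorized by its value at `y/2`. -/
lemma ExpSummable.hasDerivAt (h : ExpSummable a N) {y : ℝ} (hy : 0 < y) :
    HasDerivAt (expSum a N)
      (Complex.I * (2 * Real.pi * Complex.I * expSum (fun i => a i * N i) N y)) y := by
  have hy2 : 0 < y / 2 := by positivity
  have hu := h.mul_natCast (2 * Real.pi * (y / 2)) (by positivity)
  have hmem : y ∈ Ioi (y / 2) := by simp; linarith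
  have key := hasDerivAt_tsum_of_isPreconnected
    (g := fun i (y : ℝ) => a i * Complex.exp (2 * Real.pi * Complex.I * (N i) * (Complex.I * y)))
    (g' := fun i (y : ℝ) => Complex.I * (2 * Real.pi * Complex.I) *
      (a i * N i * Complex.exp (2 * Real.pi * Complex.I * (N i) * (Complex.I * y))))
    (hu.mul_left (2 * Real.pi)) isOpen_Ioi isPreconnected_Ioi (fun i z hz => ?_) (fun i z hz => ?_)
    hmem (h.summable hy) hmem
  · refine key.congr_deriv ?_
    rw [tsum_mul_left, expSum, mul_assoc]
  · refine ((((hasDerivAt_I_mul z).const_mul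
      (2 * Real.pi * Complex.I * (N i : ℂ))).cexp).const_mul (a i)).congr_deriv ?_
    ring
  · have hz : y / 2 < z := hz
    rw [norm_mul, norm_mul, norm_mul _ (Complex.exp _), norm_exp_two_pi]
    simp only [norm_mul, Complex.norm_I, one_mul, mul_one, Complex.norm_real, Complex.norm_ofNat,
      Complex.norm_natCast, Real.norm_of_nonneg Real.pi_pos.le]
    gcongr ?_ * (_ * Real.exp ?_)
    · have : (0 : ℝ) ≤ N i := by positivity
      have hp := Real.pi_pos
      have : 2 * Real.pi * (y / 2) ≤ 2 * Real.pi * z := by gcongr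
      nlinarith

/-- Since all frequencies are at least `1`, `exp(-2πNy) ≤ exp(-πN) exp(-y)` for `y ≥ 1`, so the sum
is bounded by a convergent constant times `exp(-y)`. -/
lemma ExpSummable.rapidDecay (h : ExpSummable a N) (hN : ∀ i, 1 ≤ N i) :
    RapidDecay (expSum a N) := by
  have h1 := h Real.pi Real.pi_pos
  set C := ∑' i, ‖a i‖ * Real.exp (-Real.pi * N i)
  have hb : ∀ y : ℝ, 1 ≤ y → ‖expSum a N y‖ ≤ C * Real.exp (-y) := by
    intro y hy
    rw [← tsum_mul_right]
    refine tsum_of_norm_bounded (h1.mul_right _).hasSum fun i => ?_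
    rw [norm_mul, norm_exp_two_pi, mul_assoc ‖a i‖, ← Real.exp_add]
    gcongr
    have h2 : (1 : ℝ) ≤ N i := by exact_mod_cast hN i
    have h3 := Real.pi_gt_three
    have h4 : 0 ≤ (Real.pi * y - Real.pi) * N i := by
      have : Real.pi ≤ Real.pi * y := le_mul_of_one_le_right (by linarith) hy
      exact mul_nonneg (by linarith) (by linarith)
    have h5 : y ≤ Real.pi * y * N i := by
      have : 1 * y ≤ Real.pi * y := by gcongr; linarith
      have h6 : Real.pi * y * 1 ≤ Real.pi * y * N i := by gcongr
      linarith
    linarith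
  intro n
  have h2 : (fun y : ℝ => Real.exp (-y)) =O[atTop] fun y : ℝ => (y ^ n)⁻¹ := by
    have := (isLittleO_exp_neg_mul_rpow_atTop one_pos (-(n : ℝ))).isBigO
    refine this.congr' (.of_forall fun y => by simp) ?_
    filter_upwards [eventually_gt_atTop 0] with y hy
    rw [Real.rpow_neg hy.le, Real.rpow_natCast]
  refine Asymptotics.IsBigO.trans ?_ h2
  refine Asymptotics.IsBigO.of_bound C ?_
  filter_upwards [eventually_ge_atTop 1] with y hy
  rw [Real.norm_of_nonneg (Real.exp_nonneg _)]
  exact hb y hy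

lemma ExpSummable.continuousOn (h : ExpSummable a N) : ContinuousOn (expSum a N) (Ioi 0) :=
  fun _ hy => (h.hasDerivAt hy).continuousAt.continuousWithinAt

end

/-- A product of summable functions of one variable each is summable. -/
lemma summable_prod_pi {κ : Type*} : ∀ {r : ℕ} (f : Fin r → κ → ℝ), (∀ i x, 0 ≤ f i x) →
    (∀ i, Summable (f i)) → Summable fun n : Fin r → κ => ∏ i, f i (n i)
  | 0, _, _, _ => (hasSum_fintype _).summable
  | r + 1, f, h0, hf => by
    have h1 := summable_prod_pi (fun i => f i.succ) (fun i => h0 i.succ) (fun i => hf i.succ)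
    rw [← (Fin.consEquiv fun _ => κ).summable_iff]
    refine ((hf 0).mul_of_nonneg h1 (h0 0) fun n =>
      Finset.prod_nonneg fun i _ => h0 i.succ (n i)).congr fun x => ?_
    simp [Fin.prod_univ_succ, Fin.consEquiv]

/-! ### The Eisenstein series on the imaginary axis -/

/-- The restriction of `cuspEis` to the imaginary axis. -/
def eis (k : ℕ) (y : ℝ) : ℂ := cuspEis k (Complex.I * y)

lemma eis_eq_expSum (k : ℕ) :
    eis k = expSum (fun n : ℕ+ => (ArithmeticFunction.sigma (2 * k - 1) (n : ℕ) : ℂ))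
      (fun n : ℕ+ => (n : ℕ)) := rfl

lemma norm_sigma_le (k : ℕ) (n : ℕ+) :
    ‖(ArithmeticFunction.sigma (2 * k - 1) (n : ℕ) : ℂ)‖ ≤ ((n : ℕ) : ℝ) ^ (2 * k + 1) := by
  rw [Complex.norm_natCast]
  refine (Nat.cast_le.2 (ArithmeticFunction.sigma_le_pow_succ (2 * k - 1) n)).trans ?_
  push_cast
  -- The exponent `2k + 1` is generous so that the bound also covers `k = 0`, where `2k - 1`
  -- truncates to `0`.
  exact pow_le_pow_right₀ (by exact_mod_cast n.pos) (by omega)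

lemma expSummable_sigma (k : ℕ) :
    ExpSummable (fun n : ℕ+ => (ArithmeticFunction.sigma (2 * k - 1) (n : ℕ) : ℂ))
      (fun n : ℕ+ => (n : ℕ)) := by
  intro t ht
  have h := Real.summable_pow_mul_exp_neg_nat_mul (2 * k + 1) ht
  have h' := h.comp_injective PNat.coe_injective
  refine Summable.of_nonneg_of_le (fun i => by positivity) (fun n => ?_) h'
  simp only [Function.comp_apply]
  gcongr
  exact norm_sigma_le k n

lemma eis_rapidDecay (k : ℕ) : RapidDecay (eis k) :=
  (expSummable_sigma k).rapidDecay fun n => n.pos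

lemma eis_continuousOn (k : ℕ) : ContinuousOn (eis k) (Ioi 0) := (expSummable_sigma k).continuousOn

/-- By Euler's formula a vanishing `B_{2k}` would force `ζ(2k) = 0`, but `ζ` has no zero with real
part at least `1`. -/
lemma bernoulli_two_mul_ne_zero {k : ℕ} (hk : 1 ≤ k) : bernoulli (2 * k) ≠ 0 := by
  intro h
  have h1 := riemannZeta_two_mul_nat (k := k) (by omega)
  rw [h] at h1
  simp only [Rat.cast_zero, mul_zero, zero_div] at h1
  refine riemannZeta_ne_zero_of_one_le_re (s := 2 * k) ?_ h1
  have : (1 : ℝ) ≤ k := by exact_mod_cast hk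
  simp
  linarith

lemma eis_eq {k : ℕ} (hk : 2 ≤ k) (z : UpperHalfPlane) :
    ModularForm.E (show 3 ≤ 2 * k by omega) z =
      1 - (2 * (2 * k : ℕ) / bernoulli (2 * k)) * cuspEis k z := by
  rw [EisensteinSeries.q_expansion_bernoulli (by omega) (even_two_mul k) z, cuspEis]
  congr 2
  refine tsum_congr fun n => ?_
  rw [zpow_natCast, ← Complex.exp_nat_mul]
  congr 2
  ring

/-- This is the modular transformation of the full Eisenstein series under `S`, applied at `i/y`,
which `S` sends to `iy`. -/
lemma eis_inversion {k : ℕ} (hk : 2 ≤ k) {y : ℝ} (hy : 0 < y) :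
    1 - (2 * (2 * k : ℕ) / bernoulli (2 * k)) * eis k y = (Complex.I * (y : ℂ)) ^ (-(2 * k : ℤ)) *
      (1 - (2 * (2 * k : ℕ) / bernoulli (2 * k)) * eis k y⁻¹) := by
  have hI : Complex.I * (y : ℂ) ≠ 0 := by simp [hy.ne']
  set z : UpperHalfPlane := ⟨Complex.I * ((y⁻¹ : ℝ) : ℂ), by simpa using hy⟩ with hz
  have hzc : (z : ℂ) = Complex.I * ((y⁻¹ : ℝ) : ℂ) := rfl
  have hS : ((ModularGroup.S • z : UpperHalfPlane) : ℂ) = Complex.I * y := by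
    rw [UpperHalfPlane.modular_S_smul]
    simp only [hzc]
    push_cast
    have hy' : (y : ℂ) ≠ 0 := by exact_mod_cast hy.ne'
    field_simp
    simp
  have h := SlashInvariantForm.slash_action_eqn''
    (ModularForm.E (show 3 ≤ 2 * k by omega))
    (γ := Matrix.SpecialLinearGroup.mapGL ℝ ModularGroup.S)
    (MonoidHom.mem_range.2 ⟨ModularGroup.S, rfl⟩) z
  change ModularForm.E (show 3 ≤ 2 * k by omega) (ModularGroup.S • z) = _ at h
  rw [eis_eq hk, eis_eq hk, hS, hzc] at h
  change 1 - _ * eis k y = _ * (1 - _ * eis k y⁻¹) at h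
  rw [h]
  congr 1
  have hd : UpperHalfPlane.denom (Matrix.SpecialLinearGroup.mapGL ℝ ModularGroup.S) z =
      Complex.I * ((y⁻¹ : ℝ) : ℂ) := by
    rw [← hzc]
    exact (ModularGroup.denom_S z)
  rw [hd]
  have h2 : Complex.I * ((y⁻¹ : ℝ) : ℂ) = -(Complex.I * (y : ℂ))⁻¹ := by
    push_cast
    rw [mul_inv, Complex.inv_I]
    ring
  rw [h2]
  push_cast
  -- The automorphy factor is `-(iy)⁻¹`; its sign disappears because the weight is even.
  rw [Even.neg_zpow (even_two_mul _), inv_zpow, zpow_neg]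

/-- The rational number `B_{2k} / (4k)` that appears in the expansion of `eis` at `0`. -/
def eisConst (k : ℕ) : ℚ := bernoulli (2 * k) / (4 * k)

/-- The expansion of the Eisenstein series at `0`. -/
def eisExp (k : ℕ) : LogLaurent :=
  AddMonoidAlgebra.single (-(2 * k : ℤ), 0) ((-eisConst k : ℚ) : ℂ) +
    AddMonoidAlgebra.single 0 ((eisConst k : ℚ) : ℂ)

lemma eisExp_mem (k : ℕ) : eisExp k ∈ ratCoeffs :=
  Submodule.add_mem _ (single_mem_coeffsIn (rat_mem_one _) _)
    (single_mem_coeffsIn (rat_mem_one _) _)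

lemma RapidDecay.flatAtZero_inv {f : ℝ → ℂ} (hf : RapidDecay f) :
    FlatAtZero fun y => f y⁻¹ := by
  intro N
  refine ((hf N).comp_tendsto tendsto_inv_nhdsGT_zero).congr' EventuallyEq.rfl
    (.of_forall fun y => ?_)
  simp

/-- After solving `eis_inversion` for `eis k y`, the remainder is `(iy)^(-2k)` times `eis k y⁻¹`,
and the rapid decay of `eis` at infinity makes this flat at `0`. -/
lemma hasExp_eis (c : ℂ) {k : ℕ} (hk : 2 ≤ k) : HasExp c (eis k) (eisExp k) := by
  refine ((eis_rapidDecay k).flatAtZero_inv.mul_moderate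
    (moderate_monoAt c (-(2 * k : ℤ), 0))).congr ?_
  filter_upwards [self_mem_nhdsWithin] with y hy
  have h := eis_inversion hk hy
  have hb : ((bernoulli (2 * k) : ℚ) : ℂ) ≠ 0 := by
    exact_mod_cast bernoulli_two_mul_ne_zero (show 1 ≤ k by omega)
  have hk0 : (k : ℂ) ≠ 0 := by exact_mod_cast (show k ≠ 0 by omega)
  -- `eisConst k` is the inverse of the factor in front of `E⁰_{2k}` in the normalized Eisenstein
  -- series.
  have hl : (2 * ((2 * k : ℕ) : ℂ) / (bernoulli (2 * k) : ℚ)) * ((eisConst k : ℚ) : ℂ) = 1 := by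
    rw [eisConst]
    push_cast
    field_simp
    norm_num
  have h0 : monoAt c 0 y = 1 := by simp [monoAt]
  rw [eisExp, evalAt_add, evalAt_single, evalAt_single, h0]
  simp only [monoAt, pow_zero, mul_one]
  push_cast at h hl ⊢
  set l : ℂ := 2 * (2 * (k : ℂ)) / (bernoulli (2 * k) : ℚ)
  set z := (Complex.I * (y : ℂ)) ^ (-(2 * k : ℤ))
  linear_combination (eisConst k : ℂ) * h + (eis k y - z * eis k y⁻¹) * hl

/-! ### Words -/

/-- The member of a family whose index is given by a word in the letters `(k, α)`. -/
def Family.word (F : Family) (w : List (ℕ × ℕ)) : ℂ → ℂ :=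
  F w.length (fun i => (w.get i).1) (fun i => (w.get i).2)

/-- The iterated integral of a word, on the imaginary axis. -/
def intW (w : List (ℕ × ℕ)) (y : ℝ) : ℂ := Family.word iterInt w (Complex.I * y)

/-- The multiple L-series of a word, on the imaginary axis. -/
def serW (w : List (ℕ × ℕ)) (y : ℝ) : ℂ := Family.word multL w (Complex.I * y)

/-- The words that are indices. -/
def AdmWord (w : List (ℕ × ℕ)) : Prop := ∀ x ∈ w, 2 ≤ x.1 ∧ 1 ≤ x.2

lemma admWord_nil : AdmWord [] := fun _ h => by simp at h

lemma admWord_cons {k a : ℕ} {w : List (ℕ × ℕ)} :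
    AdmWord ((k, a) :: w) ↔ 2 ≤ k ∧ 1 ≤ a ∧ AdmWord w := by
  simp [AdmWord, and_assoc]

/-- Every index is the index of a word. -/
lemma exists_word {C : (r : ℕ) → (Fin r → ℕ) → (Fin r → ℕ) → Prop}
    (h : ∀ w : List (ℕ × ℕ), C w.length (fun i => (w.get i).1) (fun i => (w.get i).2))
    (r : ℕ) (k α : Fin r → ℕ) : C r k α := by
  have key : ∀ (l : List (ℕ × ℕ)) (hl : l.length = r),
      (∀ i : Fin r, l.get (i.cast hl.symm) = (k i, α i)) → C r k α := by
    rintro l rfl hl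
    have h1 : (fun i => (l.get i).1) = k := funext fun i => congrArg Prod.fst (hl i)
    have h2 : (fun i => (l.get i).2) = α := funext fun i => congrArg Prod.snd (hl i)
    exact h1 ▸ h2 ▸ h l
  exact key (List.ofFn fun i => (k i, α i)) List.length_ofFn fun i => by simp

/-! ### Iterated integrals -/

lemma intW_nil (y : ℝ) : intW [] y = 1 := rfl

/-- The integrand of the outermost integration in an iterated integral. -/
def intKernel (k a : ℕ) (w : List (ℕ × ℕ)) (y : ℝ) : ℂ :=
  eis k y * (Complex.I * y) ^ (a - 1) * intW w y

/-- Translating the variable by `y` turns the ray based at `iy` into a fixed integrand over a moving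
domain, so that the fundamental theorem of calculus applies. -/
lemma intW_cons (k a : ℕ) (w : List (ℕ × ℕ)) (y : ℝ) :
    intW ((k, a) :: w) y = ∫ u in Ioi y, intKernel k a w u * Complex.I := by
  have h1 : intW ((k, a) :: w) y =
      ∫ t in Ioi (0 : ℝ), (fun u => intKernel k a w u * Complex.I) (y + t) := by
    change (∫ t in Ioi (0 : ℝ), _) = _
    refine integral_congr_ae (.of_forall fun t => ?_)
    have : Complex.I * (y : ℂ) + Complex.I * t = Complex.I * ((y + t : ℝ) : ℂ) := by
      push_cast; ring
    simp only [this]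
    rfl
  rw [h1]
  have h2 := (measurePreserving_add_left volume y).setIntegral_preimage_emb
    (measurableEmbedding_addLeft y) (fun u => intKernel k a w u * Complex.I) (Ioi y)
  rw [← h2]
  simp

/-- The properties are proved jointly because each layer of integration needs continuity and decay
of the previous kernel. The empty word is only bounded; one factor `eis` already makes the kernel
decay. -/
lemma intW_props (w : List (ℕ × ℕ)) : ContinuousOn (intW w) (Ioi 0) ∧
    (intW w =O[atTop] fun _ : ℝ => (1 : ℝ)) ∧ (w ≠ [] → RapidDecay (intW w)) ∧
    (∀ k a, RapidDecay (intKernel k a w) ∧ ContinuousOn (intKernel k a w) (Ioi 0)) := by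
  have hK : ∀ w, ContinuousOn (intW w) (Ioi 0) → (intW w =O[atTop] fun _ : ℝ => (1 : ℝ)) →
      ∀ k a, RapidDecay (intKernel k a w) ∧ ContinuousOn (intKernel k a w) (Ioi 0) := by
    intro w hc hb k a
    refine ⟨((eis_rapidDecay k).mul_pow (a - 1)).mul_of_isBigO (M := 0) (by simpa using hb), ?_⟩
    exact ((eis_continuousOn k).mul (by fun_prop)).mul hc
  induction w with
  | nil =>
    have h0 : intW [] = fun _ => 1 := funext intW_nil
    have h1 : ContinuousOn (intW []) (Ioi 0) := h0 ▸ continuousOn_const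
    have h2 : intW [] =O[atTop] fun _ : ℝ => (1 : ℝ) :=
      h0 ▸ Asymptotics.isBigO_const_const _ one_ne_zero _
    exact ⟨h1, h2, fun h => absurd rfl h, hK _ h1 h2⟩
  | cons x w ih =>
    obtain ⟨k, a⟩ := x
    obtain ⟨hr, hc⟩ := ih.2.2.2 k a
    have hr' : RapidDecay fun u => intKernel k a w u * Complex.I :=
      (hr.const_mul Complex.I).congr fun y _ => mul_comm _ _
    have hc' : ContinuousOn (fun u => intKernel k a w u * Complex.I) (Ioi 0) :=
      hc.mul continuousOn_const
    have e : intW ((k, a) :: w) = fun y => ∫ u in Ioi y, intKernel k a w u * Complex.I :=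
      funext (intW_cons k a w)
    have h1 : ContinuousOn (intW ((k, a) :: w)) (Ioi 0) := fun y hy => by
      rw [e]
      exact (hr'.hasDerivAt_integral hc' hy).continuousAt.continuousWithinAt
    have h2 : RapidDecay (intW ((k, a) :: w)) := e ▸ hr'.integral
    exact ⟨h1, h2.isBigO_one, fun _ => h2, hK _ h1 h2.isBigO_one⟩

lemma intW_continuousOn (w : List (ℕ × ℕ)) : ContinuousOn (intW w) (Ioi 0) := (intW_props w).1

lemma intW_rapidDecay {w : List (ℕ × ℕ)} (hw : w ≠ []) : RapidDecay (intW w) :=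
  (intW_props w).2.2.1 hw

lemma intKernel_rapidDecay (k a : ℕ) (w : List (ℕ × ℕ)) : RapidDecay (intKernel k a w) :=
  ((intW_props w).2.2.2 k a).1

lemma intKernel_continuousOn (k a : ℕ) (w : List (ℕ × ℕ)) :
    ContinuousOn (intKernel k a w) (Ioi 0) := ((intW_props w).2.2.2 k a).2

lemma hasDerivAt_intW (k a : ℕ) (w : List (ℕ × ℕ)) {y : ℝ} (hy : 0 < y) :
    HasDerivAt (intW ((k, a) :: w)) (Complex.I * (-intKernel k a w y)) y := by
  have e : intW ((k, a) :: w) = fun y => ∫ u in Ioi y, intKernel k a w u * Complex.I :=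
    funext (intW_cons k a w)
  rw [e]
  refine (RapidDecay.hasDerivAt_integral (((intKernel_rapidDecay k a w).const_mul
    Complex.I).congr fun y _ => mul_comm _ _)
    ((intKernel_continuousOn k a w).mul continuousOn_const) hy).congr_deriv ?_
  ring

/-! ### Multiple L-series -/

/-- The coefficient of a multiple L-series. -/
def serCoeff {r : ℕ} (k α : Fin r → ℕ) (n : Fin r → ℕ+) : ℂ :=
  (∏ i, (ArithmeticFunction.sigma (2 * k i - 1) (n i : ℕ) : ℂ)) / (∏ i, (tailSum n i : ℂ) ^ α i)

/-- The frequency of a term of a multiple L-series. -/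
def totalSum {r : ℕ} (n : Fin r → ℕ+) : ℕ := ∑ i, (n i : ℕ)

lemma tailSum_pos {r : ℕ} (n : Fin r → ℕ+) (i : Fin r) : 1 ≤ tailSum n i :=
  (n i).pos.trans_le (Finset.single_le_sum (f := fun j => (n j : ℕ)) (fun _ _ => Nat.zero_le _)
    (Finset.mem_Ici.2 le_rfl))

lemma tailSum_zero {r : ℕ} (n : Fin (r + 1) → ℕ+) : tailSum n 0 = totalSum n := by
  rw [tailSum, totalSum]
  congr 1
  ext i
  simp

lemma totalSum_pos {r : ℕ} (n : Fin (r + 1) → ℕ+) : 1 ≤ totalSum n :=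
  tailSum_zero n ▸ tailSum_pos n 0

lemma tailSum_cons_succ {r : ℕ} (m : ℕ+) (n : Fin r → ℕ+) (i : Fin r) :
    tailSum (Fin.cons m n : Fin (r + 1) → ℕ+) i.succ = tailSum n i := by
  rw [tailSum, tailSum, ← Fin.map_succEmb_Ici, Finset.sum_map]
  simp

lemma totalSum_cons {r : ℕ} (m : ℕ+) (n : Fin r → ℕ+) :
    totalSum (Fin.cons m n : Fin (r + 1) → ℕ+) = m + totalSum n := by
  simp [totalSum, Fin.sum_univ_succ]

lemma norm_serCoeff_le {r : ℕ} (k α : Fin r → ℕ) (n : Fin r → ℕ+) :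
    ‖serCoeff k α n‖ ≤ ∏ i, ‖(ArithmeticFunction.sigma (2 * k i - 1) (n i : ℕ) : ℂ)‖ := by
  rw [serCoeff, norm_div, norm_prod, norm_prod]
  refine div_le_self (Finset.prod_nonneg fun i _ => norm_nonneg _) ?_
  refine Finset.one_le_prod fun i _ => ?_
  rw [norm_pow, Complex.norm_natCast]
  exact one_le_pow₀ (by exact_mod_cast tailSum_pos n i)

lemma expSummable_serCoeff {r : ℕ} (k α : Fin r → ℕ) :
    ExpSummable (serCoeff k α) totalSum := by
  intro t ht
  refine Summable.of_nonneg_of_le (fun i => by positivity) (fun n => ?_)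
    (summable_prod_pi (fun i (m : ℕ+) =>
      ‖(ArithmeticFunction.sigma (2 * k i - 1) (m : ℕ) : ℂ)‖ * Real.exp (-t * (m : ℕ)))
      (fun i m => by positivity) fun i => expSummable_sigma (k i) t ht)
  rw [Finset.prod_mul_distrib, ← Real.exp_sum]
  have : ∑ i, -t * ((n i : ℕ) : ℝ) = -t * totalSum n := by
    rw [totalSum, ← Finset.mul_sum]; push_cast; rfl
  rw [this]
  gcongr
  exact norm_serCoeff_le k α n

lemma multL_eq {r : ℕ} (k α : Fin r → ℕ) (y : ℝ) : multL r k α (Complex.I * y) =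
    ((2 * Real.pi * Complex.I) ^ (∑ i, α i))⁻¹ * expSum (serCoeff k α) totalSum y := by
  simp only [multL, expSum, serCoeff, totalSum, Nat.cast_sum]

lemma serCoeff_mul_totalSum {r : ℕ} (k : Fin (r + 1) → ℕ) {α β : Fin (r + 1) → ℕ}
    (h0 : α 0 = β 0 + 1) (hs : ∀ i : Fin r, α i.succ = β i.succ) (n : Fin (r + 1) → ℕ+) :
    serCoeff k α n * totalSum n = serCoeff k β n := by
  have h1 : (totalSum n : ℂ) ≠ 0 := by
    exact_mod_cast (Nat.pos_iff_ne_zero.1 (totalSum_pos n))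
  rw [serCoeff, serCoeff, Fin.prod_univ_succ (f := fun i => (tailSum n i : ℂ) ^ α i),
    Fin.prod_univ_succ (f := fun i => (tailSum n i : ℂ) ^ β i), h0, tailSum_zero]
  simp only [hs]
  rw [pow_succ, div_mul_eq_mul_div, mul_right_comm, mul_div_mul_right _ _ h1]

/-- Differentiation brings down `2πi (n₁ + ⋯ + n_r)`, which cancels one factor of the first
denominator and one factor of the normalization. -/
lemma hasDerivAt_multL {r : ℕ} (k : Fin (r + 1) → ℕ) {α β : Fin (r + 1) → ℕ}
    (h0 : α 0 = β 0 + 1) (hs : ∀ i : Fin r, α i.succ = β i.succ) {y : ℝ} (hy : 0 < y) :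
    HasDerivAt (fun y : ℝ => multL (r + 1) k α (Complex.I * y))
      (Complex.I * multL (r + 1) k β (Complex.I * y)) y := by
  simp only [multL_eq]
  refine (((expSummable_serCoeff k α).hasDerivAt hy).const_mul _).congr_deriv ?_
  simp only [serCoeff_mul_totalSum k h0 hs]
  have h1 : ∑ i, α i = ∑ i, β i + 1 := by
    rw [Fin.sum_univ_succ, Fin.sum_univ_succ (f := β), h0]
    simp only [hs]
    ring
  have h2 : (2 * Real.pi * Complex.I : ℂ) ≠ 0 := Complex.two_pi_I_ne_zero
  rw [h1, pow_succ]
  field_simp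

/-- With exponent `0` the variable `n₁` leaves the denominator, since the later tail sums do not
involve it, and the sum over `n₁` splits off. -/
lemma multL_of_zero {r : ℕ} (k α : Fin (r + 1) → ℕ) (h0 : α 0 = 0) {y : ℝ} (hy : 0 < y) :
    multL (r + 1) k α (Complex.I * y) =
      eis (k 0) y * multL r (Fin.tail k) (Fin.tail α) (Complex.I * y) := by
  rw [multL_eq, multL_eq, mul_left_comm, eis_eq_expSum]
  have h1 : ∑ i, α i = ∑ i, Fin.tail α i := by
    rw [Fin.sum_univ_succ, h0, zero_add]; rfl
  rw [h1]
  congr 1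
  have s1 := (expSummable_sigma (k 0)).summable hy
  have s2 := (expSummable_serCoeff (Fin.tail k) (Fin.tail α)).summable hy
  rw [expSum, expSum, expSum, tsum_mul_tsum_of_summable_norm s1.norm s2.norm,
    ← (Fin.consEquiv fun _ => ℕ+).tsum_eq]
  refine tsum_congr fun x => ?_
  obtain ⟨m, n⟩ := x
  have e1 : serCoeff k α (Fin.cons m n : Fin (r + 1) → ℕ+) =
      (ArithmeticFunction.sigma (2 * k 0 - 1) (m : ℕ) : ℂ) *
        serCoeff (Fin.tail k) (Fin.tail α) n := by
    rw [serCoeff, serCoeff, Fin.prod_univ_succ, Fin.prod_univ_succ]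
    simp only [h0, pow_zero, one_mul, tailSum_cons_succ, Fin.cons_zero, Fin.cons_succ]
    rw [mul_div_assoc]
    rfl
  change serCoeff k α (Fin.cons m n : Fin (r + 1) → ℕ+) * Complex.exp (2 * Real.pi * Complex.I *
    (totalSum (Fin.cons m n : Fin (r + 1) → ℕ+) : ℕ) * _) = _
  rw [e1, totalSum_cons]
  push_cast
  rw [mul_add, add_mul, Complex.exp_add]
  ring

lemma serW_nil (y : ℝ) : serW [] y = 1 := by
  simp [serW, Family.word, multL]

lemma hasDerivAt_serW_succ (k a : ℕ) (w : List (ℕ × ℕ)) {y : ℝ} (hy : 0 < y) :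
    HasDerivAt (serW ((k, a + 1) :: w)) (Complex.I * serW ((k, a) :: w) y) y := by
  have h := hasDerivAt_multL (r := w.length) (fun i => (((k, a + 1) :: w).get i).1)
    (α := fun i => (((k, a + 1) :: w).get i).2) (β := fun i => (((k, a) :: w).get i).2) rfl
    (fun _ => rfl) hy
  have hk : (fun i : Fin (w.length + 1) => (((k, a + 1) :: w).get i).1) =
      fun i => (((k, a) :: w).get i).1 := funext fun i => by
    refine Fin.cases ?_ (fun j => ?_) i <;> rfl
  refine h.congr_deriv ?_
  rw [hk]
  rfl

lemma serW_zero (k : ℕ) (w : List (ℕ × ℕ)) {y : ℝ} (hy : 0 < y) :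
    serW ((k, 0) :: w) y = eis k y * serW w y :=
  multL_of_zero (r := w.length) (fun i => (((k, 0) :: w).get i).1)
    (fun i => (((k, 0) :: w).get i).2) rfl hy

lemma serW_rapidDecay {w : List (ℕ × ℕ)} (hw : w ≠ []) : RapidDecay (serW w) := by
  obtain ⟨x, w, rfl⟩ := List.exists_cons_of_ne_nil hw
  have h := (expSummable_serCoeff (r := w.length + 1) (fun i => ((x :: w).get i).1)
    (fun i => ((x :: w).get i).2)).rapidDecay totalSum_pos
  exact (h.const_mul _).congr fun y _ => (multL_eq (r := w.length + 1) _ _ y).symm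

/-! ### Convergence of the multiple Dirichlet series -/

lemma pow_prod_le {r : ℕ} (K : ℕ) (n : Fin (r + 1) → ℕ+) :
    ∏ i, ((n i : ℕ) : ℝ) ^ K ≤ (totalSum n : ℝ) ^ (K * (r + 1)) := by
  have h : ∀ i ∈ Finset.univ, ((n i : ℕ) : ℝ) ^ K ≤ (totalSum n : ℝ) ^ K := fun i _ => by
    gcongr
    exact Finset.single_le_sum (f := fun j => (n j : ℕ)) (fun _ _ => Nat.zero_le _)
      (Finset.mem_univ i)
  refine (Finset.prod_le_prod (fun i _ => by positivity) h).trans ?_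
  simp [pow_mul]

lemma exists_summable_serCoeff {r : ℕ} (k α : Fin (r + 1) → ℕ) : ∃ A : ℝ, ∀ x : ℝ, A < x →
    Summable fun n : Fin (r + 1) → ℕ+ => ‖serCoeff k α n‖ / (totalSum n : ℝ) ^ x := by
  set K := ∑ i, (2 * k i + 1)
  -- The total sum dominates every `n_i`, so this exponent dominates `∏ n_i^(K+2)`. The coefficients
  -- grow at most like `∏ n_i^K`, which leaves the summable `∏ n_i^(-2)`.
  refine ⟨((K + 2) * (r + 1) : ℕ), fun x hx => ?_⟩
  have hs : Summable fun m : ℕ+ => (((m : ℕ) : ℝ) ^ 2)⁻¹ :=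
    (Real.summable_nat_pow_inv.2 one_lt_two).comp_injective PNat.coe_injective
  refine Summable.of_nonneg_of_le (fun n => by positivity) (fun n => ?_)
    (summable_prod_pi (r := r + 1) (fun _ (m : ℕ+) => (((m : ℕ) : ℝ) ^ 2)⁻¹)
      (fun i m => by positivity) fun i => hs)
  have hT : (1 : ℝ) ≤ totalSum n := by exact_mod_cast totalSum_pos n
  have h1 : ∏ i, ((n i : ℕ) : ℝ) ^ (K + 2) ≤ (totalSum n : ℝ) ^ x := by
    refine (pow_prod_le _ n).trans ?_
    rw [← Real.rpow_natCast]
    exact Real.rpow_le_rpow_of_exponent_le hT hx.le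
  have h2 : ‖serCoeff k α n‖ ≤ ∏ i, ((n i : ℕ) : ℝ) ^ K := by
    refine (norm_serCoeff_le k α n).trans (Finset.prod_le_prod (fun i _ => norm_nonneg _) ?_)
    intro i _
    refine (norm_sigma_le (k i) (n i)).trans (pow_le_pow_right₀ (by exact_mod_cast (n i).pos) ?_)
    exact Finset.single_le_sum (f := fun i => 2 * k i + 1) (fun _ _ => Nat.zero_le _)
      (Finset.mem_univ i)
  have h3 : 0 < ∏ i, ((n i : ℕ) : ℝ) ^ (K + 2) :=
    Finset.prod_pos fun i _ => pow_pos (by exact_mod_cast (n i).pos) _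
  calc ‖serCoeff k α n‖ / (totalSum n : ℝ) ^ x
      ≤ (∏ i, ((n i : ℕ) : ℝ) ^ K) / ∏ i, ((n i : ℕ) : ℝ) ^ (K + 2) := by gcongr
    _ = ∏ i, (((n i : ℕ) : ℝ) ^ 2)⁻¹ := by
      rw [← Finset.prod_div_distrib]
      refine Finset.prod_congr rfl fun i _ => ?_
      have : ((n i : ℕ) : ℝ) ≠ 0 := by exact_mod_cast (n i).ne_zero
      rw [pow_add]
      field_simp

/-! ### Filtrations by weighted words -/

/-- The weight of a word, a letter `(k, α)` having weight `p + q k + s α`. -/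
def wt (p q s : ℕ) (w : List (ℕ × ℕ)) : ℕ := (w.map fun x => p + q * x.1 + s * x.2).sum

lemma wt_nil (p q s : ℕ) : wt p q s [] = 0 := rfl

lemma wt_cons (p q s k a : ℕ) (w : List (ℕ × ℕ)) :
    wt p q s ((k, a) :: w) = p + q * k + s * a + wt p q s w := by simp [wt]

lemma wt_le_of_suffix {p q s : ℕ} {t w : List (ℕ × ℕ)} (h : t <:+ w) :
    wt p q s t ≤ wt p q s w := by
  obtain ⟨u, rfl⟩ := h
  simp [wt]

/-- The `ℚ`-span of the regularized values of the words of weight at most `n`. -/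
def regFil (c : ℂ) (F : Family) (p q s n : ℕ) : Submodule ℚ ℂ :=
  Submodule.span ℚ {v | ∃ w, AdmWord w ∧ wt p q s w ≤ n ∧ IsRegValue c (F.word w) v}

lemma regFil_mono (c : ℂ) (F : Family) (p q s : ℕ) {m n : ℕ} (h : m ≤ n) :
    regFil c F p q s m ≤ regFil c F p q s n :=
  Submodule.span_mono fun _ ⟨w, hw, hm, hv⟩ => ⟨w, hw, hm.trans h, hv⟩

lemma mem_regFil {c : ℂ} {F : Family} {p q s n : ℕ} {w : List (ℕ × ℕ)} {v : ℂ} (hw : AdmWord w)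
    (hn : wt p q s w ≤ n) (hv : IsRegValue c (F.word w) v) : v ∈ regFil c F p q s n :=
  Submodule.subset_span ⟨w, hw, hn, hv⟩

/-- The `ℚ`-span of the regularized values of the suffixes of a word. -/
def sufSpan (c : ℂ) (F : Family) (w : List (ℕ × ℕ)) : Submodule ℚ ℂ :=
  Submodule.span ℚ {v | ∃ t, t <:+ w ∧ IsRegValue c (F.word t) v}

lemma mem_sufSpan {c : ℂ} {F : Family} {w : List (ℕ × ℕ)} {v : ℂ}
    (hv : IsRegValue c (F.word w) v) : v ∈ sufSpan c F w :=
  Submodule.subset_span ⟨w, List.suffix_rfl, hv⟩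

lemma AdmWord.of_suffix {t w : List (ℕ × ℕ)} (hw : AdmWord w) (h : t <:+ w) : AdmWord t :=
  fun x hx => hw x (h.subset hx)

lemma sufSpan_le_regFil {c : ℂ} {F : Family} {p q s n : ℕ} {w : List (ℕ × ℕ)} (hw : AdmWord w)
    (hn : wt p q s w ≤ n) : sufSpan c F w ≤ regFil c F p q s n :=
  Submodule.span_mono fun _ ⟨t, ht, hv⟩ => ⟨t, hw.of_suffix ht, (wt_le_of_suffix ht).trans hn, hv⟩

lemma sufSpan_cons_le (c : ℂ) (F : Family) (x : ℕ × ℕ) (w : List (ℕ × ℕ)) :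
    sufSpan c F w ≤ sufSpan c F (x :: w) :=
  Submodule.span_mono fun _ ⟨t, ht, hv⟩ => ⟨t, ht.trans (List.suffix_cons x w), hv⟩

/-! ### Expansions of the elementary factors -/

lemma monoAt_zero (c : ℂ) (y : ℝ) : monoAt c 0 y = 1 := by simp [monoAt]

lemma hasExp_one (c : ℂ) : HasExp c (fun _ => 1) (AddMonoidAlgebra.single 0 1) :=
  (hasExp_evalAt c _).congr fun y _ => by rw [evalAt_single, monoAt_zero, one_mul]

lemma one_mem_ratOne : (1 : ℂ) ∈ (1 : Submodule ℚ ℂ) := Submodule.one_le.1 le_rfl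

lemma hasExp_pow (c : ℂ) (m : ℕ) :
    HasExp c (fun y => (Complex.I * y) ^ m) (AddMonoidAlgebra.single ((m : ℤ), 0) 1) :=
  (hasExp_evalAt c _).congr fun y _ => by simp [evalAt_single, monoAt]

lemma HasExp.pow_mul {c : ℂ} {V : Submodule ℚ ℂ} {f : ℝ → ℂ} {P : LogLaurent} (m : ℕ)
    (hP : P ∈ coeffsIn V) (h : HasExp c f P) :
    ∃ R ∈ coeffsIn V, HasExp c (fun y => (Complex.I * y) ^ m * f y) R :=
  ⟨_, ratCoeffs_mul_mem (single_mem_coeffsIn one_mem_ratOne _) hP, (hasExp_pow c m).mul h⟩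

lemma HasExp.eis_mul {c : ℂ} {V : Submodule ℚ ℂ} {f : ℝ → ℂ} {P : LogLaurent} {k : ℕ}
    (hk : 2 ≤ k) (hP : P ∈ coeffsIn V) (h : HasExp c f P) :
    ∃ R ∈ coeffsIn V, HasExp c (fun y => eis k y * f y) R :=
  ⟨_, ratCoeffs_mul_mem (eisExp_mem k) hP, (hasExp_eis c hk).mul h⟩

lemma coeff_zero_single_add {Q : LogLaurent} (hQ : Q.coeff 0 = 0) (ρ : ℂ) :
    (AddMonoidAlgebra.single 0 ρ + Q).coeff 0 = ρ := by
  rw [AddMonoidAlgebra.coeff_add, Finsupp.add_apply, hQ, add_zero, AddMonoidAlgebra.coeff_single,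
    Finsupp.single_eq_same]

/-! ### Expansions of iterated integrals and of L-series -/

lemma isRegValue_nil {c : ℂ} {F : Family} (h : ∀ y : ℝ, F.word [] (Complex.I * y) = 1) :
    IsRegValue c (F.word []) 1 := by
  have h1 : HasExp c (fun y : ℝ => F.word [] (Complex.I * y)) (AddMonoidAlgebra.single 0 1) :=
    (hasExp_one c).congr fun y _ => (h y).symm
  simpa using h1.isRegValue

/-- The Eisenstein expansion, the power of `τ` and the formal primitive are all rational, so only
the constant of integration `ρ` can leave `V`. -/
lemma exists_hasExp_intW_cons {c : ℂ} {V : Submodule ℚ ℂ} {k a : ℕ} {w : List (ℕ × ℕ)}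
    (hk : 2 ≤ k) {P : LogLaurent} (hP : P ∈ coeffsIn V) (h : HasExp c (intW w) P) :
    ∃ (ρ : ℂ) (Q : LogLaurent), Q ∈ coeffsIn V ∧ Q.coeff 0 = 0 ∧
      HasExp c (intW ((k, a) :: w)) (AddMonoidAlgebra.single 0 ρ + Q) := by
  obtain ⟨R, hR, hR'⟩ := h.pow_mul (a - 1) hP
  obtain ⟨S, hS, hS'⟩ := hR'.eis_mul hk hR
  obtain ⟨Q, hQ, hQ'⟩ := exists_isPrim c (Submodule.smul_mem _ (-1 : ℚ) hS)
  have h1 : HasExp c (fun y => -intKernel k a w y) ((-1 : ℚ) • S) := by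
    have := hS'.const_mul (-1)
    have e : (-1 : ℂ) • S = (-1 : ℚ) • S := by simp
    rw [e] at this
    refine this.congr fun y _ => ?_
    rw [intKernel]; ring
  obtain ⟨ρ, hρ⟩ := HasExp.of_deriv (fun y hy => hasDerivAt_intW k a w hy) h1 hQ'
  exact ⟨ρ, Q, hQ, hQ'.1, hρ⟩

/-- Prepending a letter adds one integration constant, the regularized value of the longer word.
Recording suffixes, rather than a weight bound alone, is what makes the induction on length for
products possible. -/
lemma exists_hasExp_intW (c : ℂ) {w : List (ℕ × ℕ)} (hw : AdmWord w) :
    ∃ P ∈ coeffsIn (sufSpan c iterInt w), HasExp c (intW w) P := by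
  induction w with
  | nil =>
    refine ⟨AddMonoidAlgebra.single 0 1, single_mem_coeffsIn (mem_sufSpan
      (isRegValue_nil fun y => intW_nil y)) _, ?_⟩
    exact (hasExp_one c).congr fun y _ => (intW_nil y).symm
  | cons x w ih =>
    obtain ⟨k, a⟩ := x
    obtain ⟨hk, ha, hw'⟩ := admWord_cons.1 hw
    obtain ⟨P, hP, hP'⟩ := ih hw'
    obtain ⟨ρ, Q, hQ, hQ0, hE⟩ := exists_hasExp_intW_cons (a := a) hk hP hP'
    refine ⟨_, Submodule.add_mem _ (single_mem_coeffsIn (mem_sufSpan ?_) _)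
      (coeffsIn_mono (sufSpan_cons_le c _ _ _) hQ), hE⟩
    have := hE.isRegValue
    rwa [coeff_zero_single_add hQ0] at this

lemma exists_hasExp_intW_mem (c : ℂ) (p q s : ℕ) {n : ℕ} {w : List (ℕ × ℕ)} (hw : AdmWord w)
    (hn : wt p q s w ≤ n) : ∃ P ∈ coeffsIn (regFil c iterInt p q s n), HasExp c (intW w) P := by
  obtain ⟨P, hP, h⟩ := exists_hasExp_intW c hw
  exact ⟨P, coeffsIn_mono (sufSpan_le_regFil hw hn) hP, h⟩

/-- The recursion also lowers the first exponent, so words other than suffixes occur and only their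
weights are tracked. -/
lemma exists_hasExp_serW_mem (c : ℂ) (p q s : ℕ) {n : ℕ} {w : List (ℕ × ℕ)} (hw : AdmWord w)
    (hn : wt p q s w ≤ n) : ∃ P ∈ coeffsIn (regFil c multL p q s n), HasExp c (serW w) P := by
  induction w with
  | nil =>
    refine ⟨AddMonoidAlgebra.single 0 1, single_mem_coeffsIn (mem_regFil hw hn
      (isRegValue_nil fun y => serW_nil y)) _, ?_⟩
    exact (hasExp_one c).congr fun y _ => (serW_nil y).symm
  | cons x w ih =>
    obtain ⟨k, a⟩ := x
    obtain ⟨hk, ha, hw'⟩ := admWord_cons.1 hw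
    have step : ∀ a, wt p q s ((k, a + 1) :: w) ≤ n →
        (∃ P ∈ coeffsIn (regFil c multL p q s n), HasExp c (serW ((k, a) :: w)) P) →
        ∃ P ∈ coeffsIn (regFil c multL p q s n), HasExp c (serW ((k, a + 1) :: w)) P := by
      rintro a hn ⟨P, hP, hP'⟩
      obtain ⟨Q, hQ, hQ'⟩ := exists_isPrim c hP
      obtain ⟨ρ, hρ⟩ := HasExp.of_deriv (fun y hy => hasDerivAt_serW_succ k a w hy) hP' hQ'
      have hv := hρ.isRegValue
      rw [coeff_zero_single_add hQ'.1] at hv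
      exact ⟨_, Submodule.add_mem _ (single_mem_coeffsIn (mem_regFil
        (admWord_cons.2 ⟨hk, by omega, hw'⟩) hn hv) _) hQ, hρ⟩
    clear hw
    induction a, ha using Nat.le_induction with
    | base =>
      -- The letter `(k, 0)` is not admissible, but it enters only through the product of `eis k`
      -- with the series of the tail; its own constant term is never used as a generator.
      refine step 0 hn ?_
      obtain ⟨P, hP, hP'⟩ := ih hw' (by rw [wt_cons] at hn; omega)
      obtain ⟨R, hR, hR'⟩ := hP'.eis_mul hk hP
      exact ⟨R, hR, hR'.congr fun y hy => (serW_zero k w hy).symm⟩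
    | succ a ha iha =>
      refine step a hn (iha ?_)
      rw [wt_cons] at hn ⊢
      refine le_trans ?_ hn
      gcongr
      omega

/-! ### Shuffle products -/

lemma rapidDecay_zero : RapidDecay fun _ => 0 := fun _ => Asymptotics.isBigO_zero _ _

lemma rapidDecay_list_sum {κ : Type*} (l : List κ) (f : κ → ℝ → ℂ)
    (h : ∀ x ∈ l, RapidDecay (f x)) : RapidDecay fun y => (l.map fun x => f x y).sum := by
  induction l with
  | nil => simpa using rapidDecay_zero
  | cons x l ih =>
    simp only [List.map_cons, List.sum_cons]
    exact (h x (by simp)).add (ih fun z hz => h z (by simp [hz]))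

lemma hasDerivAt_list_intW (k a : ℕ) (l : List (List (ℕ × ℕ))) {y : ℝ} (hy : 0 < y) :
    HasDerivAt (fun y => (l.map fun w => intW ((k, a) :: w) y).sum)
      (Complex.I * -(eis k y * (Complex.I * y) ^ (a - 1) * (l.map fun w => intW w y).sum)) y := by
  induction l with
  | nil => simpa using hasDerivAt_const y (0 : ℂ)
  | cons w l ih =>
    simp only [List.map_cons, List.sum_cons]
    refine ((hasDerivAt_intW k a w hy).fun_add ih).congr_deriv ?_
    rw [intKernel]; ring

/-- Differentiating the product removes the first letter of `u` or of `v`. By induction the sum over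
shuffles has the same derivative, and both sides vanish at infinity. -/
theorem intW_mul_intW (p q s : ℕ) : ∀ (u v : List (ℕ × ℕ)), AdmWord u → AdmWord v →
    ∃ l : List (List (ℕ × ℕ)),
      (∀ w ∈ l, AdmWord w ∧ wt p q s w = wt p q s u + wt p q s v) ∧
      ∀ y, 0 < y → intW u y * intW v y = (l.map fun w => intW w y).sum
  | [], v, _, hv => ⟨[v], by simp [hv, wt_nil], by simp [intW_nil]⟩
  | x :: u, [], hu, _ => ⟨[x :: u], by simp [hu, wt_nil], by simp [intW_nil]⟩
  | (k, a) :: u, (k', a') :: v, hu, hv => by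
    obtain ⟨hk, ha, hu'⟩ := admWord_cons.1 hu
    obtain ⟨hk', ha', hv'⟩ := admWord_cons.1 hv
    obtain ⟨l₁, h₁, e₁⟩ := intW_mul_intW p q s u ((k', a') :: v) hu' hv
    obtain ⟨l₂, h₂, e₂⟩ := intW_mul_intW p q s ((k, a) :: u) v hu hv'
    refine ⟨l₁.map (fun w => (k, a) :: w) ++ l₂.map (fun w => (k', a') :: w), ?_, ?_⟩
    · intro w hw
      rw [List.mem_append, List.mem_map, List.mem_map] at hw
      rcases hw with ⟨w, hw, rfl⟩ | ⟨w, hw, rfl⟩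
      · refine ⟨admWord_cons.2 ⟨hk, ha, (h₁ w hw).1⟩, ?_⟩
        rw [wt_cons, (h₁ w hw).2, wt_cons p q s k a u]; ring
      · refine ⟨admWord_cons.2 ⟨hk', ha', (h₂ w hw).1⟩, ?_⟩
        rw [wt_cons, (h₂ w hw).2, wt_cons p q s k' a' v]; ring
    · intro y hy
      simp only [List.map_append, List.sum_append, List.map_map, Function.comp_def]
      refine eqOn_of_hasDerivAt (f := fun y => intW ((k, a) :: u) y * intW ((k', a') :: v) y)
        (g := fun y => (l₁.map fun w => intW ((k, a) :: w) y).sum +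
          (l₂.map fun w => intW ((k', a') :: w) y).sum)
        (fun z hz => (hasDerivAt_intW k a u hz).fun_mul (hasDerivAt_intW k' a' v hz))
        (fun z hz => ?_) ?_ ?_ hy
      · refine ((hasDerivAt_list_intW k a l₁ hz).fun_add
          (hasDerivAt_list_intW k' a' l₂ hz)).congr_deriv ?_
        rw [← e₁ z hz, ← e₂ z hz, intKernel, intKernel]
        ring
      · exact ((intW_rapidDecay (List.cons_ne_nil _ _)).mul
          (intW_rapidDecay (List.cons_ne_nil _ _))).tendsto
      · exact ((rapidDecay_list_sum _ _ fun w _ => intW_rapidDecay (List.cons_ne_nil _ _)).add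
          (rapidDecay_list_sum _ _ fun w _ => intW_rapidDecay (List.cons_ne_nil _ _))).tendsto
  termination_by u v => u.length + v.length

lemma exists_hasExp_list_sum {c : ℂ} {V : Submodule ℚ ℂ} {κ : Type*} (l : List κ)
    (f : κ → ℝ → ℂ) (h : ∀ x ∈ l, ∃ P ∈ coeffsIn V, HasExp c (f x) P) :
    ∃ P ∈ coeffsIn V, HasExp c (fun y => (l.map fun x => f x y).sum) P := by
  induction l with
  | nil =>
    refine ⟨0, Submodule.zero_mem _, FlatAtZero.hasExp fun N => ?_⟩
    simpa using! Asymptotics.isBigO_zero _ _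
  | cons x l ih =>
    obtain ⟨P, hP, hP'⟩ := h x (by simp)
    obtain ⟨Q, hQ, hQ'⟩ := ih fun z hz => h z (by simp [hz])
    simp only [List.map_cons, List.sum_cons]
    exact ⟨_, Submodule.add_mem _ hP hQ, hP'.add hQ'⟩

lemma mul_mem_of_span {U W : Set ℂ} {V : Submodule ℚ ℂ} (h : ∀ u ∈ U, ∀ w ∈ W, u * w ∈ V) :
    ∀ u ∈ Submodule.span ℚ U, ∀ w ∈ Submodule.span ℚ W, u * w ∈ V := by
  intro u hu w hw
  have h1 : Submodule.span ℚ U * Submodule.span ℚ W ≤ V := by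
    rw [Submodule.span_mul_span, Submodule.span_le]
    rintro _ ⟨u, hu, w, hw, rfl⟩
    exact h u hu w hw
  exact h1 (Submodule.mul_mem_mul hu hw)

/-- Compare constant terms in the shuffle identity. The shuffle side lies in the filtration; on the
product side the surplus over `x * y` comes from coefficients attached to suffixes of the two tails,
handled by induction on the bound `N` for the total length. -/
lemma isRegValue_mul_mem (c : ℂ) (p q s : ℕ) : ∀ (N : ℕ) (u v : List (ℕ × ℕ)),
    u.length + v.length ≤ N → AdmWord u → AdmWord v → ∀ x y : ℂ,
    IsRegValue c (Family.word iterInt u) x → IsRegValue c (Family.word iterInt v) y →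
    x * y ∈ regFil c iterInt p q s (wt p q s u + wt p q s v)
  | N, [], v, _, _, hv, x, y, hx, hy => by
    rw [hx.unique (isRegValue_nil fun y => intW_nil y), one_mul]
    exact mem_regFil hv (by simp [wt_nil]) hy
  | N, z :: u, [], _, hu, _, x, y, hx, hy => by
    rw [hy.unique (isRegValue_nil fun y => intW_nil y), mul_one]
    exact mem_regFil hu (by simp [wt_nil]) hx
  | 0, z :: u, z' :: v, hN, _, _, _, _, _, _ => by simp at hN
  | N + 1, (k, a) :: u, (k', a') :: v, hN, hu, hv, x, y, hx, hy => by
    obtain ⟨hk, ha, hu'⟩ := admWord_cons.1 hu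
    obtain ⟨hk', ha', hv'⟩ := admWord_cons.1 hv
    obtain ⟨P, hP, hP'⟩ := exists_hasExp_intW c hu'
    obtain ⟨P₂, hP₂, hP₂'⟩ := exists_hasExp_intW c hv'
    obtain ⟨ρ, Q, hQ, hQ0, hE⟩ := exists_hasExp_intW_cons (a := a) hk hP hP'
    obtain ⟨ρ₂, Q₂, hQ₂, hQ₂0, hE₂⟩ := exists_hasExp_intW_cons (a := a') hk' hP₂ hP₂'
    have e1 : x = ρ := by
      refine hx.unique ?_
      have := hE.isRegValue
      rwa [coeff_zero_single_add hQ0] at this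
    have e2 : y = ρ₂ := by
      refine hy.unique ?_
      have := hE₂.isRegValue
      rwa [coeff_zero_single_add hQ₂0] at this
    subst e1 e2
    set V := regFil c iterInt p q s (wt p q s ((k, a) :: u) + wt p q s ((k', a') :: v))
    obtain ⟨l, hl, el⟩ := intW_mul_intW p q s _ _ hu hv
    obtain ⟨R, hR, hR'⟩ := exists_hasExp_list_sum (V := V) l intW fun w hw =>
      exists_hasExp_intW_mem c p q s (hl w hw).1 (hl w hw).2.le
    have h1 := (hE.mul hE₂).unique (hR'.congr fun y hy => (el y hy).symm) 0 le_rfl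
    have h2 : Q * Q₂ ∈ coeffsIn V := by
      refine mul_mem_coeffsIn (mul_mem_of_span ?_) hQ hQ₂
      rintro x ⟨t, ht, hx⟩ y ⟨t', ht', hy⟩
      have h3 := ht.length_le
      have h4 := ht'.length_le
      simp only [List.length_cons] at hN
      refine regFil_mono c _ p q s ?_ (isRegValue_mul_mem c p q s N t t' (by omega)
        (hu'.of_suffix ht) (hv'.of_suffix ht') x y hx hy)
      exact add_le_add (wt_le_of_suffix (ht.trans (List.suffix_cons _ _)))
        (wt_le_of_suffix (ht'.trans (List.suffix_cons _ _)))
    -- The mixed terms drop out because neither `Q` nor `Q₂` has a constant term; `Q * Q₂` may have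
    -- one, through opposite powers of `τ`.
    have h3 : ((AddMonoidAlgebra.single 0 x + Q) * (AddMonoidAlgebra.single 0 y + Q₂)).coeff 0 =
        x * y + (Q * Q₂).coeff 0 := by
      rw [add_mul, mul_add, mul_add, AddMonoidAlgebra.single_mul_single]
      simp only [AddMonoidAlgebra.coeff_add, Finsupp.add_apply, AddMonoidAlgebra.coeff_single,
        AddMonoidAlgebra.coeff_single_zero_mul, AddMonoidAlgebra.coeff_mul_single_zero, hQ0, hQ₂0]
      simp
    rw [h3] at h1
    have h4 : x * y = R.coeff 0 - (Q * Q₂).coeff 0 := by rw [← h1]; ring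
    rw [h4]
    exact V.sub_mem (hR 0) (h2 0)

theorem regFil_iterInt_mul_mem (c : ℂ) (p q s m n : ℕ) : ∀ x ∈ regFil c iterInt p q s m,
    ∀ y ∈ regFil c iterInt p q s n, x * y ∈ regFil c iterInt p q s (m + n) := by
  refine mul_mem_of_span ?_
  rintro x ⟨u, hu, hm, hx⟩ y ⟨v, hv, hn, hy⟩
  exact regFil_mono c _ p q s (add_le_add hm hn)
    (isRegValue_mul_mem c p q s _ u v le_rfl hu hv x y hx hy)

/-! ### Comparison of the two families -/

/-- The span of the functions `τ ^ m * f_w(τ)`, for a family `f` indexed by words; the weight of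
such a function is `s m` plus the weight of the word. -/
def powSpan (f : List (ℕ × ℕ) → ℝ → ℂ) (p q s n : ℕ) : Submodule ℚ (ℝ → ℂ) :=
  Submodule.span ℚ {g | ∃ (m : ℕ) (w : List (ℕ × ℕ)), AdmWord w ∧ w ≠ [] ∧
    s * m + wt p q s w ≤ n ∧ g = fun y => (Complex.I * y) ^ m * f w y}

lemma mem_powSpan {f : List (ℕ × ℕ) → ℝ → ℂ} {p q s n m : ℕ} {w : List (ℕ × ℕ)} (hw : AdmWord w)
    (h0 : w ≠ []) (hn : s * m + wt p q s w ≤ n) :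
    (fun y : ℝ => (Complex.I * y) ^ m * f w y) ∈ powSpan f p q s n :=
  Submodule.subset_span ⟨m, w, hw, h0, hn, rfl⟩

lemma powSpan_mono (f : List (ℕ × ℕ) → ℝ → ℂ) (p q s : ℕ) {m n : ℕ} (h : m ≤ n) :
    powSpan f p q s m ≤ powSpan f p q s n :=
  Submodule.span_mono fun _ ⟨i, w, hw, h0, hm, e⟩ => ⟨i, w, hw, h0, hm.trans h, e⟩

/-- `f` has a primitive on the upper half plane that decays at `i∞` and belongs to `S`. -/
def HasDecayingPrim (S : Submodule ℚ (ℝ → ℂ)) (f : ℝ → ℂ) : Prop :=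
  ∃ F ∈ S, RapidDecay F ∧ ∀ y, 0 < y → HasDerivAt F (Complex.I * f y) y

/-- The functions that have a decaying primitive in `S` form a subspace. -/
def decayingPrims (S : Submodule ℚ (ℝ → ℂ)) : Submodule ℚ (ℝ → ℂ) where
  carrier := {f | HasDecayingPrim S f}
  add_mem' := by
    rintro f g ⟨F, hF, hF', hFd⟩ ⟨G, hG, hG', hGd⟩
    refine ⟨F + G, S.add_mem hF hG, hF'.add hG', fun y hy => ?_⟩
    exact ((hFd y hy).add (hGd y hy)).congr_deriv (by rw [Pi.add_apply]; ring)
  zero_mem' := ⟨0, S.zero_mem, rapidDecay_zero, fun y _ => by simp⟩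
  smul_mem' := by
    rintro a f ⟨F, hF, hF', hFd⟩
    have e : a • F = fun y => (a : ℂ) * F y := funext fun y => by
      rw [Pi.smul_apply, Algebra.smul_def]; rfl
    refine ⟨a • F, S.smul_mem a hF, e ▸ hF'.const_mul _, fun y hy => e ▸ ?_⟩
    refine ((hFd y hy).const_mul (a : ℂ)).congr_deriv ?_
    rw [Pi.smul_apply, Algebra.smul_def]
    change _ = Complex.I * ((a : ℂ) * f y)
    ring

lemma HasDecayingPrim.mono {S T : Submodule ℚ (ℝ → ℂ)} (h : S ≤ T) {f : ℝ → ℂ}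
    (hf : HasDecayingPrim S f) : HasDecayingPrim T f := by
  obtain ⟨F, hF, h'⟩ := hf
  exact ⟨F, h hF, h'⟩

lemma HasDecayingPrim.congr {S : Submodule ℚ (ℝ → ℂ)} {f g : ℝ → ℂ}
    (hf : HasDecayingPrim S f) (h : ∀ y, 0 < y → f y = g y) : HasDecayingPrim S g := by
  obtain ⟨F, hF, hr, hd⟩ := hf
  exact ⟨F, hF, hr, fun y hy => h y hy ▸ hd y hy⟩

/-- Multiplication by a function, as a linear map. -/
def mulMap (h : ℝ → ℂ) : (ℝ → ℂ) →ₗ[ℚ] (ℝ → ℂ) := LinearMap.mulLeft ℚ h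

lemma exists_eqOn_of_hasDecayingPrim {S : Submodule ℚ (ℝ → ℂ)} {f g : ℝ → ℂ}
    (hg : HasDecayingPrim S g) (hf : RapidDecay f)
    (h : ∀ y, 0 < y → HasDerivAt f (Complex.I * g y) y) :
    ∃ F ∈ S, ∀ y, 0 < y → f y = F y := by
  obtain ⟨F, hF, hr, hd⟩ := hg
  exact ⟨F, hF, fun y hy => eqOn_of_hasDerivAt h hd hf.tendsto hr.tendsto hy⟩

/-- Integration by parts: the primitive of `τ^m L(b)` is `τ^m L(b+1)` minus `m` times that of
`τ^(m-1) L(b+1)`. A power of `τ` is exchanged for a unit of `b`, so the weight stays constant after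
the first increase by `s`. -/
lemma hasDecayingPrim_serW_aux (p q s k : ℕ) (hk : 2 ≤ k) {w : List (ℕ × ℕ)} (hw : AdmWord w)
    (m : ℕ) : ∀ b : ℕ, HasDecayingPrim (powSpan serW p q s (s * m + wt p q s ((k, b) :: w) + s))
      fun y => (Complex.I * y) ^ m * serW ((k, b) :: w) y := by
  induction m with
  | zero =>
    intro b
    have h0 : (fun y : ℝ => (Complex.I * y) ^ 0 * serW ((k, b + 1) :: w) y) =
        serW ((k, b + 1) :: w) := funext fun y => by simp
    refine ⟨serW ((k, b + 1) :: w), ?_, serW_rapidDecay (List.cons_ne_nil _ _), fun y hy => ?_⟩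
    · rw [← h0]
      refine mem_powSpan (admWord_cons.2 ⟨hk, by omega, hw⟩) (List.cons_ne_nil _ _) ?_
      rw [wt_cons, wt_cons]
      exact le_of_eq (by ring)
    · simpa using hasDerivAt_serW_succ k b w hy
  | succ m ih =>
    intro b
    obtain ⟨F, hF, hr, hd⟩ := ih (b + 1)
    have e1 : s * m + wt p q s ((k, b + 1) :: w) + s =
        s * (m + 1) + wt p q s ((k, b) :: w) + s := by rw [wt_cons, wt_cons]; ring
    rw [e1] at hF
    have e2 : (fun y : ℝ => (Complex.I * y) ^ (m + 1) * serW ((k, b + 1) :: w) y) +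
        (-((m + 1 : ℕ) : ℚ)) • F = fun y : ℝ => (Complex.I * y) ^ (m + 1) *
          serW ((k, b + 1) :: w) y + (-((m + 1 : ℕ) : ℂ)) * F y := funext fun y => by
      rw [Pi.add_apply, Pi.smul_apply, Algebra.smul_def]
      simp
    refine ⟨_, Submodule.add_mem _ (mem_powSpan (m := m + 1) (w := (k, b + 1) :: w)
      (admWord_cons.2 ⟨hk, by omega, hw⟩) (List.cons_ne_nil _ _) ?_)
      (Submodule.smul_mem _ (-((m + 1 : ℕ) : ℚ)) hF), ?_, fun y hy => ?_⟩
    · rw [wt_cons, wt_cons]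
      exact le_of_eq (by ring)
    · rw [e2]
      exact (((serW_rapidDecay (List.cons_ne_nil _ _)).mul_pow (m + 1)).congr
        fun y _ => mul_comm _ _).add (hr.const_mul _)
    · rw [e2]
      refine ((((hasDerivAt_I_mul y).fun_pow (m + 1)).fun_mul
        (hasDerivAt_serW_succ k b w hy)).fun_add ((hd y hy).const_mul _)).congr_deriv ?_
      simp only [Nat.add_sub_cancel]
      ring

/-- The factor `eis k` turns the series of `w` into that of `(k, 0) :: w`, so this is the previous
lemma with power `m + (a - 1)`; its extra `s` completes the weight of the letter `(k, a)`. -/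
lemma hasDecayingPrim_serW (p q s : ℕ) {k a : ℕ} (hk : 2 ≤ k) (ha : 1 ≤ a) {w : List (ℕ × ℕ)}
    (hw : AdmWord w) (m : ℕ) :
    HasDecayingPrim (powSpan serW p q s (p + q * k + s * a + (s * m + wt p q s w)))
      fun y => eis k y * (Complex.I * y) ^ (a - 1) * ((Complex.I * y) ^ m * serW w y) := by
  refine ((hasDecayingPrim_serW_aux p q s k hk hw (m + (a - 1)) 0).mono
    (powSpan_mono _ _ _ _ ?_)).congr fun y hy => ?_
  · obtain ⟨b, rfl⟩ := Nat.exists_eq_add_of_le' ha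
    rw [wt_cons, Nat.add_sub_cancel]
    exact le_of_eq (by ring)
  · rw [serW_zero k w hy, pow_add]; ring

/-- Insert the expression of the tail into the kernel and integrate each summand. Primitives
decaying at infinity are unique, which identifies the result with the iterated integral. -/
theorem intW_mem_powSpan_serW (p q s : ℕ) {w : List (ℕ × ℕ)} (hw : AdmWord w) (h0 : w ≠ []) :
    ∃ g ∈ powSpan serW p q s (wt p q s w), ∀ y, 0 < y → intW w y = g y := by
  induction w with
  | nil => exact absurd rfl h0
  | cons x w ih =>
    obtain ⟨k, a⟩ := x
    obtain ⟨hk, ha, hw'⟩ := admWord_cons.1 hw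
    set S := powSpan serW p q s (wt p q s ((k, a) :: w))
    suffices h : HasDecayingPrim S fun y => eis k y * (Complex.I * y) ^ (a - 1) * intW w y by
      refine exists_eqOn_of_hasDecayingPrim (g := fun y => -intKernel k a w y) ?_
        (intW_rapidDecay h0) fun y hy => hasDerivAt_intW k a w hy
      exact (decayingPrims S).neg_mem h
    by_cases hw0 : w = []
    · subst hw0
      have := hasDecayingPrim_serW p q s hk ha hw' 0
      refine (this.mono (powSpan_mono _ _ _ _ ?_)).congr fun y hy => ?_
      · rw [wt_cons, mul_zero, zero_add]
      · rw [pow_zero, one_mul, serW_nil, intW_nil]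
    · obtain ⟨g, hg, e⟩ := ih hw' hw0
      have h1 : powSpan serW p q s (wt p q s w) ≤ (decayingPrims S).comap
          (mulMap fun y => eis k y * (Complex.I * y) ^ (a - 1)) := by
        refine Submodule.span_le.2 ?_
        rintro _ ⟨m, v, hv, -, hn, rfl⟩
        refine (hasDecayingPrim_serW p q s hk ha hv m).mono (powSpan_mono _ _ _ _ ?_)
        rw [wt_cons]
        omega
      exact HasDecayingPrim.congr (h1 hg) fun y hy => by rw [e y hy]; rfl

/-- The letter `(k, m + 1)` absorbs `τ^m`; the sign appears because the integral has `τ` as its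
lower limit. -/
lemma hasDecayingPrim_eis_intW (p q s : ℕ) {k : ℕ} (hk : 2 ≤ k) {w : List (ℕ × ℕ)}
    (hw : AdmWord w) (m : ℕ) :
    HasDecayingPrim (powSpan intW p q s (p + q * k + s * (m + 1) + wt p q s w))
      fun y => eis k y * ((Complex.I * y) ^ m * intW w y) := by
  have e : (-1 : ℚ) • (fun y : ℝ => (Complex.I * y) ^ 0 * intW ((k, m + 1) :: w) y) =
      fun y : ℝ => -1 * intW ((k, m + 1) :: w) y := funext fun y => by simp
  refine ⟨_, Submodule.smul_mem _ (-1 : ℚ) (mem_powSpan (m := 0) (w := (k, m + 1) :: w)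
    (admWord_cons.2 ⟨hk, by omega, hw⟩) (List.cons_ne_nil _ _) ?_), ?_, fun y hy => ?_⟩
  · rw [wt_cons, mul_zero, zero_add]
  · rw [e]; exact (intW_rapidDecay (List.cons_ne_nil _ _)).const_mul _
  · rw [e]
    refine ((hasDerivAt_intW k (m + 1) w hy).const_mul _).congr_deriv ?_
    rw [intKernel, Nat.add_sub_cancel]; ring

/-- Integrate `τ^m` and differentiate the iterated integral; the remaining integrand contains a
factor `eis` and is covered by the previous lemma. For the empty word there would be no decaying
primitive. -/
lemma hasDecayingPrim_intW (p q s : ℕ) {w : List (ℕ × ℕ)} (hw : AdmWord w) (h0 : w ≠ [])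
    (m : ℕ) : HasDecayingPrim (powSpan intW p q s (s * m + wt p q s w + s))
      fun y => (Complex.I * y) ^ m * intW w y := by
  obtain ⟨⟨k, b⟩, v, rfl⟩ := List.exists_cons_of_ne_nil h0
  obtain ⟨hk, hb, hv⟩ := admWord_cons.1 hw
  obtain ⟨F, hF, hr, hd⟩ := hasDecayingPrim_eis_intW p q s hk hv (m + b)
  have hm : ((m : ℂ) + 1) ≠ 0 := by exact_mod_cast Nat.succ_ne_zero m
  have e : ((m + 1 : ℚ)⁻¹) • ((fun y : ℝ => (Complex.I * y) ^ (m + 1) * intW ((k, b) :: v) y) + F) =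
      fun y : ℝ => ((m : ℂ) + 1)⁻¹ * ((Complex.I * y) ^ (m + 1) * intW ((k, b) :: v) y + F y) :=
    funext fun y => by
      rw [Pi.smul_apply, Pi.add_apply, Algebra.smul_def]
      simp
  refine ⟨_, Submodule.smul_mem _ ((m + 1 : ℚ)⁻¹) (Submodule.add_mem _ (mem_powSpan (m := m + 1)
    (w := (k, b) :: v) hw h0 ?_) (powSpan_mono _ _ _ _ ?_ hF)), ?_, fun y hy => ?_⟩
  · exact le_of_eq (by ring)
  · rw [wt_cons]; exact le_of_eq (by ring)
  · rw [e]
    exact ((((intW_rapidDecay h0).mul_pow (m + 1)).congr fun y _ => mul_comm _ _).add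
      hr).const_mul _
  · rw [e]
    refine (((((hasDerivAt_I_mul y).fun_pow (m + 1)).fun_mul
      (hasDerivAt_intW k b v hy)).fun_add (hd y hy)).const_mul _).congr_deriv ?_
    obtain ⟨b, rfl⟩ := Nat.exists_eq_add_of_le' hb
    rw [intKernel]
    push_cast
    field_simp
    ring

/-- Double induction on the word and on its first exponent: exponent `1` comes from integrating `eis
k` times the tail, and each further unit from one more integration, at a cost of `s` in weight. -/
theorem serW_mem_powSpan_intW (p q s : ℕ) {w : List (ℕ × ℕ)} (hw : AdmWord w) (h0 : w ≠ []) :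
    ∃ g ∈ powSpan intW p q s (wt p q s w), ∀ y, 0 < y → serW w y = g y := by
  induction w with
  | nil => exact absurd rfl h0
  | cons x w ih =>
    obtain ⟨k, a⟩ := x
    obtain ⟨hk, ha, hw'⟩ := admWord_cons.1 hw
    clear hw h0
    induction a, ha using Nat.le_induction with
    | base =>
      set S := powSpan intW p q s (wt p q s ((k, 1) :: w))
      suffices h : HasDecayingPrim S fun y => eis k y * serW w y by
        refine exists_eqOn_of_hasDecayingPrim h (serW_rapidDecay (List.cons_ne_nil _ _))
          fun y hy => ?_
        have := hasDerivAt_serW_succ k 0 w hy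
        rwa [serW_zero k w hy] at this
      by_cases hw0 : w = []
      · subst hw0
        refine ((hasDecayingPrim_eis_intW p q s hk hw' 0).mono
          (powSpan_mono _ _ _ _ ?_)).congr fun y hy => ?_
        · rw [wt_cons]
        · rw [pow_zero, one_mul, serW_nil, intW_nil]
      · obtain ⟨g, hg, e⟩ := ih hw' hw0
        have h1 : powSpan intW p q s (wt p q s w) ≤ (decayingPrims S).comap (mulMap (eis k)) := by
          refine Submodule.span_le.2 ?_
          rintro _ ⟨m, v, hv, -, hn, rfl⟩
          refine (hasDecayingPrim_eis_intW p q s hk hv m).mono (powSpan_mono _ _ _ _ ?_)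
          rw [wt_cons, mul_add]
          omega
        exact HasDecayingPrim.congr (h1 hg) fun y hy => by rw [e y hy]; rfl
    | succ a ha iha =>
      obtain ⟨g, hg, e⟩ := iha
      refine exists_eqOn_of_hasDecayingPrim (g := serW ((k, a) :: w)) ?_
        (serW_rapidDecay (List.cons_ne_nil _ _)) fun y hy => hasDerivAt_serW_succ k a w hy
      set S := powSpan intW p q s (wt p q s ((k, a + 1) :: w))
      have h1 : powSpan intW p q s (wt p q s ((k, a) :: w)) ≤ decayingPrims S := by
        refine Submodule.span_le.2 ?_
        rintro _ ⟨m, v, hv, hv0, hn, rfl⟩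
        refine (hasDecayingPrim_intW p q s hv hv0 m).mono (powSpan_mono _ _ _ _ ?_)
        rw [wt_cons, mul_add]
        rw [wt_cons] at hn
        omega
      exact HasDecayingPrim.congr (h1 hg) fun y hy => (e y hy).symm

/-- A family whose members are combinations of `τ ^ m` times members of another family has its
regularized values in the filtration spanned by the values of the latter. -/
lemma regFil_le_of_powSpan {c : ℂ} {F G : Family} {p q s n : ℕ}
    (hF : ∀ y : ℝ, F.word [] (Complex.I * y) = 1) (hG : ∀ y : ℝ, G.word [] (Complex.I * y) = 1)
    (hexp : ∀ w, AdmWord w → wt p q s w ≤ n →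
      ∃ P ∈ coeffsIn (regFil c G p q s n), HasExp c (fun y => G.word w (Complex.I * y)) P)
    (hmem : ∀ w, AdmWord w → w ≠ [] →
      ∃ g ∈ powSpan (fun w y => G.word w (Complex.I * y)) p q s (wt p q s w),
        ∀ y : ℝ, 0 < y → F.word w (Complex.I * y) = g y) :
    regFil c F p q s n ≤ regFil c G p q s n := by
  refine Submodule.span_le.2 ?_
  rintro v ⟨w, hw, hn, hv⟩
  by_cases h0 : w = []
  · subst h0
    rw [hv.unique (isRegValue_nil hF)]
    exact mem_regFil admWord_nil hn (isRegValue_nil hG)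
  · obtain ⟨g, hg, e⟩ := hmem w hw h0
    obtain ⟨P, hP, hP'⟩ : ∃ P ∈ coeffsIn (regFil c G p q s n), HasExp c g P := by
      have hg := powSpan_mono _ p q s hn hg
      refine Submodule.span_induction ?_ ?_ ?_ ?_ hg
      · rintro _ ⟨m, u, hu, -, hm, rfl⟩
        obtain ⟨P, hP, hP'⟩ := hexp u hu (by omega)
        exact hP'.pow_mul m hP
      · exact ⟨0, Submodule.zero_mem _, FlatAtZero.hasExp fun N => by
          simpa using! Asymptotics.isBigO_zero _ _⟩
      · rintro f f' - - ⟨P, hP, hP'⟩ ⟨Q, hQ, hQ'⟩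
        exact ⟨_, Submodule.add_mem _ hP hQ, hP'.add hQ'⟩
      · rintro a f - ⟨P, hP, hP'⟩
        refine ⟨a • P, Submodule.smul_mem _ a hP, ?_⟩
        have e1 : (a : ℂ) • P = a • P := by
          ext x
          rw [AddMonoidAlgebra.coeff_smul_apply, AddMonoidAlgebra.coeff_smul_apply,
            Algebra.smul_def a]
          rfl
        rw [← e1]
        refine (hP'.const_mul (a : ℂ)).congr fun y _ => ?_
        rw [Pi.smul_apply, Algebra.smul_def]; rfl
    have h1 : HasExp c (fun y : ℝ => F.word w (Complex.I * y)) P :=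
      hP'.congr fun y hy => (e y hy).symm
    rw [hv.unique h1.isRegValue]
    exact hP 0

theorem regFil_multL_eq (c : ℂ) (p q s n : ℕ) :
    regFil c multL p q s n = regFil c iterInt p q s n :=
  le_antisymm
    (regFil_le_of_powSpan serW_nil intW_nil (fun _ hw hn => exists_hasExp_intW_mem c p q s hw hn)
      fun _ hw h0 => serW_mem_powSpan_intW p q s hw h0)
    (regFil_le_of_powSpan intW_nil serW_nil (fun _ hw hn => exists_hasExp_serW_mem c p q s hw hn)
      fun _ hw h0 => intW_mem_powSpan_serW p q s hw h0)

/-! ### Mellin transforms -/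

/-- The Mellin transform of the `j`-th power of the normalized logarithm on `(0, 1]`; here `κ` is
the value of the normalized logarithm at `1`. -/
def logMellin (κ : ℂ) : ℕ → ℂ → ℂ
  | 0, s => 1 / s
  | j + 1, s => (κ ^ (j + 1) - (j + 1) * logMellin κ j s) / s

lemma analyticAt_logMellin (κ : ℂ) (j : ℕ) {s : ℂ} (hs : s ≠ 0) :
    AnalyticAt ℂ (logMellin κ j) s := by
  induction j with
  | zero =>
    have e : logMellin κ 0 = fun s => 1 / s := rfl
    rw [e]; exact analyticAt_const.div analyticAt_id hs
  | succ j ih =>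
    have e : logMellin κ (j + 1) = fun s => (κ ^ (j + 1) - (j + 1) * logMellin κ j s) / s := rfl
    rw [e]
    exact (analyticAt_const.sub (analyticAt_const.mul ih)).div analyticAt_id hs

lemma meromorphicAt_logMellin (κ : ℂ) (j : ℕ) (s : ℂ) : MeromorphicAt (logMellin κ j) s := by
  induction j with
  | zero =>
    have e : logMellin κ 0 = fun s => 1 / s := rfl
    rw [e]; exact (MeromorphicAt.const _ _).div (MeromorphicAt.id _)
  | succ j ih =>
    have e : logMellin κ (j + 1) = fun s => (κ ^ (j + 1) - (j + 1) * logMellin κ j s) / s := rfl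
    rw [e]
    exact ((MeromorphicAt.const _ _).sub ((MeromorphicAt.const _ _).mul ih)).div
      (MeromorphicAt.id _)

/-- Differentiating in `s` inserts `log y` under the integral, and `log y` is the normalized
logarithm minus `κ`. -/
lemma hasDerivAt_logMellin (κ : ℂ) (j : ℕ) {s : ℂ} (hs : s ≠ 0) :
    HasDerivAt (logMellin κ j) (logMellin κ (j + 1) s - κ * logMellin κ j s) s := by
  induction j with
  | zero =>
    have e : logMellin κ 0 = fun s => s⁻¹ := funext fun s => one_div s
    have h := hasDerivAt_inv hs
    rw [e]
    refine h.congr_deriv ?_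
    simp only [logMellin]
    field_simp
    simp
  | succ j ih =>
    have e : logMellin κ (j + 1) = fun s => (κ ^ (j + 1) - (j + 1) * logMellin κ j s) / s := rfl
    have h := ((ih.const_mul ((j : ℂ) + 1)).const_sub (κ ^ (j + 1))).fun_div (hasDerivAt_id s) hs
    rw [e]
    refine h.congr_deriv ?_
    simp only [logMellin, id]
    push_cast
    field_simp
    ring

/-- The recursion, which is an integration by parts, raises the pole order at `0` by one and
multiplies the leading coefficient by `-(j + 1)`. -/
lemma tendsto_pow_mul_logMellin (κ : ℂ) (j : ℕ) :
    Tendsto (fun s : ℂ => s ^ (j + 1) * logMellin κ j s) (𝓝[≠] 0) (𝓝 ((-1) ^ j * j.factorial)) := by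
  induction j with
  | zero =>
    refine tendsto_const_nhds.congr' ?_
    filter_upwards [self_mem_nhdsWithin] with s hs
    have hs : s ≠ 0 := hs
    simp [logMellin, hs]
  | succ j ih =>
    have h0 : Tendsto (fun s : ℂ => s ^ (j + 1) * κ ^ (j + 1)) (𝓝[≠] 0) (𝓝 0) := by
      have : Tendsto (fun s : ℂ => s ^ (j + 1) * κ ^ (j + 1)) (𝓝 0)
          (𝓝 (0 ^ (j + 1) * κ ^ (j + 1))) := by
        exact Continuous.tendsto (by fun_prop) 0
      simp only [ne_eq, Nat.succ_ne_zero, not_false_eq_true, zero_pow, zero_mul] at this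
      exact this.mono_left nhdsWithin_le_nhds
    have h1 := h0.sub (ih.const_mul ((j : ℂ) + 1))
    have e : (0 : ℂ) - ((j : ℂ) + 1) * ((-1) ^ j * j.factorial) =
        (-1) ^ (j + 1) * (j + 1).factorial := by
      rw [Nat.factorial_succ]; push_cast; ring
    rw [e] at h1
    refine h1.congr' ?_
    filter_upwards [self_mem_nhdsWithin] with s hs
    have hs : s ≠ 0 := hs
    simp only [logMellin]
    field_simp
    ring

lemma locallyIntegrableOn_indicator {f : ℝ → ℂ} (hf : ContinuousOn f (Ioi 0)) {S : Set ℝ}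
    (hS : MeasurableSet S) : LocallyIntegrableOn (S.indicator f) (Ioi 0) := by
  intro x hx
  obtain ⟨t, ht, hi⟩ := (hf.locallyIntegrableOn (μ := volume) measurableSet_Ioi) x hx
  exact ⟨t, ht, hi.indicator hS⟩

lemma logAt_continuousOn (c : ℂ) : ContinuousOn (logAt c) (Ioi 0) :=
  fun _ hy => (hasDerivAt_logAt c hy).continuousAt.continuousWithinAt

/-- The truncation of a function to `(0, 1]`. -/
def trunc (f : ℝ → ℂ) : ℝ → ℂ := (Ioc (0 : ℝ) 1).indicator f

lemma trunc_isBigO_atTop (f : ℝ → ℂ) (g : ℝ → ℝ) : trunc f =O[atTop] g := by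
  refine Asymptotics.IsBigO.of_bound 0 ?_
  filter_upwards [eventually_gt_atTop 1] with y hy
  rw [trunc, indicator_of_notMem (fun h => absurd h.2 (not_le.2 hy))]
  simp

lemma trunc_eventuallyEq (f : ℝ → ℂ) : trunc f =ᶠ[𝓝[>] 0] f := by
  filter_upwards [Ioc_mem_nhdsGT (zero_lt_one (α := ℝ))] with y hy
  exact indicator_of_mem hy f

lemma ModerateAtZero.isBigO_rpow {f : ℝ → ℂ} (hf : ModerateAtZero f) :
    ∃ b : ℝ, f =O[𝓝[>] 0] fun y : ℝ => y ^ (-b) := by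
  obtain ⟨M, hM⟩ := hf
  refine ⟨M, hM.congr' EventuallyEq.rfl ?_⟩
  filter_upwards [self_mem_nhdsWithin] with y hy
  rw [Real.rpow_neg (le_of_lt hy), Real.rpow_natCast]

lemma trunc_logAt_isBigO (c : ℂ) (j : ℕ) :
    trunc (fun y => logAt c y ^ j) =O[𝓝[>] 0] fun y : ℝ => y ^ (-(1 : ℝ)) := by
  refine Asymptotics.IsBigO.congr' (f₁ := fun y => logAt c y ^ j) (g₁ := fun y : ℝ => y⁻¹) ?_
    (trunc_eventuallyEq _).symm (.of_forall fun y => by simp only [Real.rpow_neg_one])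
  have h := (tendsto_pow_mul_logAt c j one_ne_zero).isBigO_one ℝ
  have h' : (fun y : ℝ => ((y : ℂ) ^ 1)⁻¹) =O[𝓝[>] 0] fun y : ℝ => y⁻¹ :=
    Asymptotics.isBigO_of_le _ fun y => by simp
  refine (h.mul h').congr' ?_ (.of_forall fun y => one_mul _)
  filter_upwards [self_mem_nhdsWithin] with y hy
  have hy : (y : ℂ) ≠ 0 := by exact_mod_cast (ne_of_gt hy : y ≠ 0)
  field_simp

/-- Induction on `j` by differentiating the transform in `s`. The half-plane is not optimal; it
suits the crude bound of the logarithms by `y⁻¹`. -/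
lemma hasMellin_trunc_logAt (c : ℂ) (j : ℕ) {s : ℂ} (hs : 1 < s.re) :
    HasMellin (trunc fun y => logAt c y ^ j) s
      (logMellin (Real.pi / 2 * Complex.I - c) j s) := by
  induction j generalizing s with
  | zero =>
    simp only [pow_zero]
    exact hasMellin_one_Ioc (by linarith)
  | succ j ih =>
    set κ := Real.pi / 2 * Complex.I - c
    have hs0 : s ≠ 0 := by rintro rfl; simp at hs; linarith
    have hloc : LocallyIntegrableOn (trunc fun y => logAt c y ^ j) (Ioi 0) :=
      locallyIntegrableOn_indicator ((logAt_continuousOn c).pow j) measurableSet_Ioc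
    obtain ⟨h1, h2⟩ := mellin_hasDerivAt_of_isBigO_rpow (a := s.re + 1) (b := 1) hloc
      (trunc_isBigO_atTop _ _) (by linarith) (trunc_logAt_isBigO c j) hs
    have h3 : mellin (fun t => Real.log t • trunc (fun y => logAt c y ^ j) t) s =
        logMellin κ (j + 1) s - κ * logMellin κ j s := by
      refine h2.unique ((hasDerivAt_logMellin κ j hs0).congr_of_eventuallyEq ?_)
      have : ∀ᶠ z in 𝓝 s, 1 < z.re := Complex.continuous_re.continuousAt.eventually_const_lt hs
      filter_upwards [this] with z hz using (ih hz).2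
    have h4 := hasMellin_add h1 ((ih hs).1.const_smul κ)
    have h5 : ∀ t : ℝ, t ∈ Ioi (0 : ℝ) → Real.log t • trunc (fun y => logAt c y ^ j) t +
        κ • trunc (fun y => logAt c y ^ j) t = trunc (fun y => logAt c y ^ (j + 1)) t := by
      intro t ht
      by_cases h : t ∈ Ioc (0 : ℝ) 1
      · simp only [trunc, indicator_of_mem h, smul_eq_mul, Complex.real_smul]
        rw [pow_succ, logAt_eq c ht]
        ring
      · simp [trunc, indicator_of_notMem h]
    constructor
    · refine IntegrableOn.congr_fun h4.1 (fun t ht => ?_) measurableSet_Ioi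
      simp only [h5 t ht]
    · have h6 : mellin (trunc fun y => logAt c y ^ (j + 1)) s = mellin (fun t =>
          Real.log t • trunc (fun y => logAt c y ^ j) t +
            κ • trunc (fun y => logAt c y ^ j) t) s := by
        refine setIntegral_congr_fun measurableSet_Ioi fun t ht => ?_
        simp only [h5 t ht]
      rw [h6, h4.2, h3, mellin_const_smul, (ih hs).2, smul_eq_mul]
      ring

/-- The Mellin transform of a truncated element of `LogLaurent`. -/
def truncMellin (c : ℂ) (P : LogLaurent) (s : ℂ) : ℂ :=
  P.coeff.sum fun x a => a * (Complex.I ^ x.1 *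
    logMellin (Real.pi / 2 * Complex.I - c) x.2 (s + x.1))

lemma hasMellin_trunc_monoAt (c : ℂ) (x : ℤ × ℕ) {s : ℂ} (hs : 1 < (s + x.1).re) :
    HasMellin (trunc (monoAt c x)) s
      (Complex.I ^ x.1 * logMellin (Real.pi / 2 * Complex.I - c) x.2 (s + x.1)) := by
  have h1 := hasMellin_trunc_logAt c x.2 hs
  have h2 : ∀ t : ℝ, t ∈ Ioi (0 : ℝ) → trunc (monoAt c x) t =
      (Complex.I ^ x.1) • ((t : ℂ) ^ (x.1 : ℂ) • trunc (fun y => logAt c y ^ x.2) t) := by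
    intro t ht
    by_cases h : t ∈ Ioc (0 : ℝ) 1
    · simp only [trunc, indicator_of_mem h, monoAt, mul_zpow, Complex.cpow_intCast, smul_eq_mul]
      ring
    · simp [trunc, indicator_of_notMem h]
  constructor
  · have h3 := (MellinConvergent.cpow_smul.2 h1.1).const_smul (Complex.I ^ x.1)
    refine IntegrableOn.congr_fun h3 (fun t ht => ?_) measurableSet_Ioi
    simp only [h2 t ht]
  · have h3 : mellin (trunc (monoAt c x)) s = mellin (fun t : ℝ => (Complex.I ^ x.1) •
        ((t : ℂ) ^ (x.1 : ℂ) • trunc (fun y => logAt c y ^ x.2) t)) s := by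
      refine setIntegral_congr_fun measurableSet_Ioi fun t ht => ?_
      simp only [h2 t ht]
    rw [h3, mellin_const_smul, mellin_cpow_smul, h1.2, smul_eq_mul]

lemma exists_hasMellin_trunc (c : ℂ) (P : LogLaurent) :
    ∃ A : ℝ, ∀ s : ℂ, A < s.re → HasMellin (trunc (evalAt c P)) s (truncMellin c P s) := by
  induction P using AddMonoidAlgebra.induction_linear with
  | zero =>
    refine ⟨0, fun s _ => ?_⟩
    have : trunc (evalAt c 0) = fun _ => 0 := by
      have : evalAt c 0 = fun _ => 0 := funext (evalAt_zero c)
      rw [trunc, this]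
      exact indicator_zero _ _
    rw [this]
    simp [HasMellin, MellinConvergent, mellin, truncMellin]
  | add P Q hP hQ =>
    obtain ⟨A, hA⟩ := hP
    obtain ⟨B, hB⟩ := hQ
    refine ⟨max A B, fun s hs => ?_⟩
    have h1 := hA s ((le_max_left _ _).trans_lt hs)
    have h2 := hB s ((le_max_right _ _).trans_lt hs)
    have e1 : trunc (evalAt c (P + Q)) = fun y => trunc (evalAt c P) y + trunc (evalAt c Q) y := by
      have : evalAt c (P + Q) = fun y => evalAt c P y + evalAt c Q y := funext (evalAt_add c P Q)
      rw [trunc, this]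
      exact indicator_add _ _ _
    have e2 : truncMellin c (P + Q) s = truncMellin c P s + truncMellin c Q s := by
      simp only [truncMellin, AddMonoidAlgebra.coeff_add]
      exact Finsupp.sum_add_index' (by simp) (by intros; ring)
    rw [e1, e2, ← h1.2, ← h2.2]
    exact hasMellin_add h1.1 h2.1
  | single x a =>
    refine ⟨1 - x.1, fun s hs => ?_⟩
    have h1 := hasMellin_trunc_monoAt c x (s := s) (by
      rw [Complex.add_re, Complex.intCast_re]; linarith)
    have e1 : trunc (evalAt c (AddMonoidAlgebra.single x a)) =
        fun y => a • trunc (monoAt c x) y := by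
      have : evalAt c (AddMonoidAlgebra.single x a) = fun y => a • monoAt c x y :=
        funext (evalAt_single c x a)
      rw [trunc, this]
      exact indicator_const_smul _ _ _
    have e2 : truncMellin c (AddMonoidAlgebra.single x a) s = a • (Complex.I ^ x.1 *
        logMellin (Real.pi / 2 * Complex.I - c) x.2 (s + x.1)) := by
      simp [truncMellin]
    rw [e1, e2, ← h1.2]
    exact hasMellin_const_smul h1.1 a

lemma meromorphicAt_truncMellin (c : ℂ) (P : LogLaurent) (s : ℂ) :
    MeromorphicAt (truncMellin c P) s := by
  refine MeromorphicAt.fun_sum fun x _ => (MeromorphicAt.const _ _).mul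
    ((MeromorphicAt.const _ _).mul ?_)
  exact (meromorphicAt_logMellin _ _ _).comp_analyticAt (by fun_prop)

/-- Monomials with `m ≠ 0` have their pole at `-m` and are analytic at `0`; those with `m = 0` and
`j < J` have a pole of smaller order. Only `(0, J)` survives. -/
lemma tendsto_pow_mul_truncMellin (c : ℂ) {P : LogLaurent} {J : ℕ}
    (h : ∀ j, J < j → P.coeff (0, j) = 0) :
    Tendsto (fun s : ℂ => s ^ (J + 1) * truncMellin c P s) (𝓝[≠] 0)
      (𝓝 (P.coeff (0, J) * ((-1) ^ J * J.factorial))) := by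
  set κ := Real.pi / 2 * Complex.I - c
  have h0 : P.coeff (0, J) * ((-1) ^ J * J.factorial) = ∑ x ∈ insert (0, J) P.coeff.support,
      P.coeff x * (if x = (0, J) then (-1 : ℂ) ^ J * J.factorial else 0) := by
    simp
  have h1 : ∀ s : ℂ, ∑ x ∈ insert (0, J) P.coeff.support, P.coeff x *
      (s ^ (J + 1) * (Complex.I ^ x.1 * logMellin κ x.2 (s + x.1))) =
      s ^ (J + 1) * truncMellin c P s := by
    intro s
    have : truncMellin c P s = ∑ x ∈ insert (0, J) P.coeff.support, P.coeff x *
        (Complex.I ^ x.1 * logMellin κ x.2 (s + x.1)) := by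
      rw [truncMellin]
      exact Finsupp.sum_of_support_subset _ (Finset.subset_insert _ _) _ (by simp)
    rw [this, Finset.mul_sum]
    exact Finset.sum_congr rfl fun x _ => by ring
  have hid : Tendsto (fun s : ℂ => s) (𝓝[≠] 0) (𝓝 0) := tendsto_id.mono_left nhdsWithin_le_nhds
  rw [h0]
  refine Tendsto.congr h1 (tendsto_finsetSum _ fun x _ => ?_)
  obtain ⟨m, j⟩ := x
  by_cases hm : m = 0
  · subst hm
    simp only [zpow_zero, one_mul, Int.cast_zero, add_zero]
    rcases lt_trichotomy j J with hj | hj | hj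
    · refine Tendsto.const_mul _ ?_
      rw [if_neg (by simp; omega)]
      obtain ⟨d, rfl⟩ := Nat.exists_eq_add_of_lt hj
      have h2 := (hid.pow (d + 1)).mul (tendsto_pow_mul_logMellin κ j)
      rw [zero_pow (Nat.succ_ne_zero d), zero_mul] at h2
      refine h2.congr fun s => ?_
      ring
    · subst hj
      rw [if_pos rfl]
      exact (tendsto_pow_mul_logMellin κ j).const_mul _
    · rw [h j hj]
      simp
  · refine Tendsto.const_mul _ ?_
    rw [if_neg (by simp [hm])]
    have h2 : ContinuousAt (fun s : ℂ => Complex.I ^ m * logMellin κ j (s + m)) 0 := by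
      refine continuousAt_const.mul (ContinuousAt.comp (g := logMellin κ j) ?_ (by fun_prop))
      exact (analyticAt_logMellin κ j (by simpa using hm)).continuousAt
    have h3 := (hid.pow (J + 1)).mul (h2.tendsto.mono_left nhdsWithin_le_nhds)
    rwa [zero_pow (Nat.succ_ne_zero J), zero_mul] at h3

/-- The Mellin transform of a rapidly decaying function with an asymptotic expansion at `0` has a
meromorphic continuation, whose residue at `0`, when the pole is simple, is the constant term of
the expansion. -/
theorem exists_mellin_continuation {c : ℂ} {f : ℝ → ℂ} {P : LogLaurent}
    (hc : ContinuousOn f (Ioi 0)) (hr : RapidDecay f) (hf : HasExp c f P) :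
    ∃ M : ℂ → ℂ, (∀ s, MeromorphicAt M s) ∧ (∃ A : ℝ, ∀ s : ℂ, A < s.re → HasMellin f s (M s)) ∧
      ∀ w : ℂ, Tendsto (fun s => s * M s) (𝓝[≠] 0) (𝓝 w) → P.coeff 0 = w := by
  -- The difference is flat at `0` and decays rapidly at infinity, so its Mellin transform is
  -- entire; all poles come from the explicit `truncMellin`.
  set g : ℝ → ℂ := fun y => f y - trunc (evalAt c P) y
  have hcP : ContinuousOn (evalAt c P) (Ioi 0) := by
    refine continuousOn_finsetSum _ fun x _ => continuousOn_const.mul fun y hy => ?_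
    exact (hasDerivAt_monoAt c x.1 x.2 hy).continuousAt.continuousWithinAt
  have hloc : LocallyIntegrableOn g (Ioi 0) :=
    (hc.locallyIntegrableOn measurableSet_Ioi).sub
      (locallyIntegrableOn_indicator hcP measurableSet_Ioc)
  have htop : ∀ a : ℝ, g =O[atTop] fun y : ℝ => y ^ (-a) := fun a =>
    (hr.isBigO_rpow a).sub (trunc_isBigO_atTop _ _)
  have hbot : ∀ b : ℕ, g =O[𝓝[>] 0] fun y : ℝ => y ^ (-(-(b : ℝ))) := by
    intro b
    refine (hf b).congr' ?_ (.of_forall fun y => by simp)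
    filter_upwards [trunc_eventuallyEq (evalAt c P)] with y hy
    simp only [g, hy]
  have hg : ∀ s : ℂ, MellinConvergent g s ∧ DifferentiableAt ℂ (mellin g) s := by
    intro s
    obtain ⟨b, hb⟩ := exists_nat_gt (-s.re)
    exact ⟨mellinConvergent_of_isBigO_rpow hloc (htop (s.re + 1)) (by linarith) (hbot b)
      (by linarith), mellin_differentiableAt_of_isBigO_rpow hloc (htop (s.re + 1)) (by linarith)
      (hbot b) (by linarith)⟩
  have hga : ∀ s : ℂ, AnalyticAt ℂ (mellin g) s :=
    fun s => Differentiable.analyticAt (fun s => (hg s).2) s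
  refine ⟨fun s => mellin g s + truncMellin c P s, fun s =>
    (hga s).meromorphicAt.add (meromorphicAt_truncMellin c P s), ?_, fun w hw => ?_⟩
  · obtain ⟨A, hA⟩ := exists_hasMellin_trunc c P
    refine ⟨A, fun s hs => ?_⟩
    have h1 := hasMellin_add (hg s).1 (hA s hs).1
    rw [(hA s hs).2] at h1
    simpa [g] using h1
  · have hid : Tendsto (fun s : ℂ => s) (𝓝[≠] 0) (𝓝 0) := tendsto_id.mono_left nhdsWithin_le_nhds
    have key : ∀ J, (∀ j, J < j → P.coeff (0, j) = 0) →
        Tendsto (fun s : ℂ => s ^ J * (s * (mellin g s + truncMellin c P s))) (𝓝[≠] 0)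
          (𝓝 (P.coeff (0, J) * ((-1) ^ J * J.factorial))) := by
      intro J hJ
      have h1 := ((hid.pow (J + 1)).mul
        ((hga 0).continuousAt.tendsto.mono_left nhdsWithin_le_nhds)).add
        (tendsto_pow_mul_truncMellin c hJ)
      rw [zero_pow (Nat.succ_ne_zero J), zero_mul, zero_add] at h1
      refine h1.congr fun s => ?_
      ring
    -- Descending induction on the highest logarithm next to `τ^0`: it would give `s M(s)` a genuine
    -- pole, contradicting the finite limit.
    have hno : ∀ J, (∀ j, J < j → P.coeff (0, j) = 0) → ∀ j, 0 < j → P.coeff (0, j) = 0 := by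
      intro J
      induction J with
      | zero => exact fun h => h
      | succ J ih =>
        intro hJ
        refine ih fun j hj => ?_
        rcases Nat.lt_or_ge (J + 1) j with h | h
        · exact hJ j h
        · obtain rfl : j = J + 1 := by omega
          have h1 := key (J + 1) hJ
          have h2 := (hid.pow (J + 1)).mul hw
          rw [zero_pow (Nat.succ_ne_zero J), zero_mul] at h2
          have h3 := tendsto_nhds_unique h1 h2
          have h4 : ((-1 : ℂ) ^ (J + 1) * (J + 1).factorial) ≠ 0 :=
            mul_ne_zero (pow_ne_zero _ (by norm_num)) (by exact_mod_cast Nat.factorial_ne_zero _)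
          exact (mul_eq_zero.1 h3).resolve_right h4
    have hfin : ∀ j, P.coeff.support.sup (fun x => x.2) < j → P.coeff (0, j) = 0 := by
      intro j hj
      by_contra h
      have := Finset.le_sup (f := fun x : ℤ × ℕ => x.2) (Finsupp.mem_support_iff.2 h)
      exact absurd hj (not_lt.2 this)
    have h1 := key 0 (hno _ hfin)
    simp only [pow_zero, one_mul, Nat.factorial_zero, Nat.cast_one, mul_one] at h1
    exact tendsto_nhds_unique h1 hw

/-! ### Regularized values by analytic continuation -/

lemma meromorphicAt_comp_sub_const {M : ℂ → ℂ} (hM : ∀ s, MeromorphicAt M s) (a s : ℂ) :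
    MeromorphicAt (fun s => M (s - a)) s :=
  (hM (s - a)).comp_analyticAt (g := fun s => s - a) (by fun_prop)

lemma tendsto_add_const_punctured (a : ℂ) : Tendsto (fun s : ℂ => s + a) (𝓝[≠] 0) (𝓝[≠] a) := by
  refine tendsto_nhdsWithin_iff.2 ⟨?_, ?_⟩
  · have : Tendsto (fun s : ℂ => s + a) (𝓝 0) (𝓝 (0 + a)) := Continuous.tendsto (by fun_prop) 0
    rw [zero_add] at this
    exact this.mono_left nhdsWithin_le_nhds
  · filter_upwards [self_mem_nhdsWithin] with s hs
    have hs : s ≠ 0 := hs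
    simpa using hs

lemma hasExp_multL (c : ℂ) (r : ℕ) (k α : Fin r → ℕ) : Admissible k α →
    ∃ P, HasExp c (fun y => multL r k α (Complex.I * y)) P := by
  refine exists_word (C := fun r k α => Admissible k α →
    ∃ P, HasExp c (fun y => multL r k α (Complex.I * y)) P) (fun w hw => ?_) r k α
  have hw' : AdmWord w := fun x hx => by
    obtain ⟨i, rfl⟩ := List.get_of_mem hx
    exact hw i
  obtain ⟨P, -, hP⟩ := exists_hasExp_serW_mem c 0 0 0 (n := wt 0 0 0 w) hw' le_rfl
  exact ⟨P, hP⟩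

lemma hasExp_iterInt (c : ℂ) (r : ℕ) (k α : Fin r → ℕ) : Admissible k α →
    ∃ P, HasExp c (fun y => iterInt r k α (Complex.I * y)) P := by
  refine exists_word (C := fun r k α => Admissible k α →
    ∃ P, HasExp c (fun y => iterInt r k α (Complex.I * y)) P) (fun w hw => ?_) r k α
  have hw' : AdmWord w := fun x hx => by
    obtain ⟨i, rfl⟩ := List.get_of_mem hx
    exact hw i
  obtain ⟨P, -, hP⟩ := exists_hasExp_intW c hw'
  exact ⟨P, hP⟩

lemma expTerm_eq (n : ℕ) (y : ℝ) :
    Complex.exp (2 * Real.pi * Complex.I * n * (Complex.I * y)) =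
      ((Real.exp (-(2 * Real.pi * n) * y) : ℝ) : ℂ) := by
  rw [Complex.ofReal_exp]
  congr 1
  push_cast
  linear_combination (2 * Real.pi * n * y : ℂ) * Complex.I_mul_I

/-- Shifting `s` by `α 0` makes the series the Dirichlet series of the coefficients of `multL`
itself, so the point of interest becomes `0`. -/
lemma dirichletTerm_eq {r : ℕ} (k α : Fin (r + 1) → ℕ) (s : ℂ) (n : Fin (r + 1) → ℕ+) :
    dirichletTerm k α s n = serCoeff k α n / (totalSum n : ℂ) ^ (s - (α 0 : ℂ)) := by
  have h : (totalSum n : ℂ) ≠ 0 := by exact_mod_cast (Nat.pos_iff_ne_zero.1 (totalSum_pos n))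
  rw [dirichletTerm, serCoeff, Fin.prod_univ_succ (f := fun i => (tailSum n i : ℂ) ^ α i),
    tailSum_zero, Complex.cpow_sub _ _ h, Complex.cpow_natCast]
  have h1 : (totalSum n : ℂ) ^ s ≠ 0 := by
    rw [Complex.cpow_def_of_ne_zero h]; exact Complex.exp_ne_zero _
  have h2 : ∏ i : Fin r, (tailSum n i.succ : ℂ) ^ α i.succ ≠ 0 :=
    Finset.prod_ne_zero_iff.2 fun i _ => pow_ne_zero _ (by
      exact_mod_cast (Nat.pos_iff_ne_zero.1 (tailSum_pos n i.succ)))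
  field_simp

/-- Termwise Mellin transform: `exp(-2πNy)` contributes `Γ(s) (2πN)^(-s)`. -/
lemma exists_hasSum_mellin_expSum {r : ℕ} (k α : Fin (r + 1) → ℕ) : ∃ A : ℝ, ∀ s : ℂ, A < s.re →
    HasSum (fun n => serCoeff k α n / (totalSum n : ℂ) ^ s)
      ((2 * Real.pi : ℂ) ^ s * (Complex.Gamma s)⁻¹ * mellin (expSum (serCoeff k α) totalSum) s) := by
  obtain ⟨A, hA⟩ := exists_summable_serCoeff k α
  refine ⟨max A 0, fun s hs => ?_⟩
  have hs0 : 0 < s.re := (le_max_right _ _).trans_lt hs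
  have hp : ∀ n : Fin (r + 1) → ℕ+, 0 < 2 * Real.pi * totalSum n := fun n => by
    have : (0 : ℝ) < totalSum n := by exact_mod_cast totalSum_pos n
    positivity
  have h2p : (2 * Real.pi : ℂ) ≠ 0 := by exact_mod_cast Real.two_pi_pos.ne'
  have h1 := hasSum_mellin (a := serCoeff k α) (p := fun n => 2 * Real.pi * totalSum n)
    (F := expSum (serCoeff k α) totalSum) (s := s) (fun n => Or.inr (hp n)) hs0
    (fun t ht => by
      have := ((expSummable_serCoeff k α).summable ht).hasSum
      simp only [← expTerm_eq]
      exact this) (by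
      have h2 := (hA s.re ((le_max_left _ _).trans_lt hs)).mul_left (((2 * Real.pi) ^ s.re)⁻¹)
      refine h2.congr fun n => ?_
      rw [Real.mul_rpow Real.two_pi_pos.le (Nat.cast_nonneg _)]
      field_simp)
  have h3 := h1.mul_left ((2 * Real.pi : ℂ) ^ s * (Complex.Gamma s)⁻¹)
  convert! h3 using 1
  funext n
  have hG := Complex.Gamma_ne_zero_of_re_pos hs0
  have hN : (totalSum n : ℂ) ≠ 0 := by exact_mod_cast (Nat.pos_iff_ne_zero.1 (totalSum_pos n))
  have h4 : ((2 * Real.pi * totalSum n : ℝ) : ℂ) ^ s =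
      (2 * Real.pi : ℂ) ^ s * (totalSum n : ℂ) ^ s := by
    have := Complex.mul_cpow_ofReal_nonneg Real.two_pi_pos.le
      (Nat.cast_nonneg (α := ℝ) (totalSum n)) s
    push_cast at this ⊢
    exact this
  have h5 : (2 * Real.pi : ℂ) ^ s ≠ 0 := by
    rw [Complex.cpow_def_of_ne_zero h2p]; exact Complex.exp_ne_zero _
  rw [h4]
  field_simp

/-- Since `1/Γ(s) = s/Γ(s+1)`, the shifted series is `(2π)^s/Γ(s+1)` times `s M(s)`. The first
factor is entire and equals `1` at `0`, so a finite value of the series is a finite limit of `s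
M(s)`, that is, a constant term. -/
theorem dirichlet_continuation (c : ℂ) {r : ℕ} (k α : Fin (r + 1) → ℕ) (h : Admissible k α) :
    ∃ g : ℂ → ℂ, MeromorphicOn g Set.univ ∧
        (∃ A : ℝ, ∀ s : ℂ, A < s.re → HasSum (dirichletTerm k α s) (g s)) ∧
        ∀ w : ℂ, Tendsto g (𝓝[≠] (α 0 : ℂ)) (𝓝 w) →
          IsRegValue c (multL (r + 1) k α)
            (((2 * Real.pi * Complex.I) ^ (∑ i, α i))⁻¹ * w) := by
  obtain ⟨P, hP⟩ := hasExp_multL c (r + 1) k α h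
  set C : ℂ := (2 * Real.pi * Complex.I) ^ (∑ i, α i)
  have hC : C ≠ 0 := pow_ne_zero _ Complex.two_pi_I_ne_zero
  have hE : HasExp c (expSum (serCoeff k α) totalSum) (C • P) :=
    (hP.const_mul C).congr fun y _ => by rw [multL_eq, mul_inv_cancel_left₀ hC]
  obtain ⟨M, hM, ⟨A, hA⟩, hlim⟩ := exists_mellin_continuation
    (expSummable_serCoeff k α).continuousOn
    ((expSummable_serCoeff k α).rapidDecay totalSum_pos) hE
  have h2p : (2 * Real.pi : ℂ) ≠ 0 := by exact_mod_cast Real.two_pi_pos.ne'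
  set B : ℂ → ℂ := fun s => (2 * Real.pi : ℂ) ^ s * (Complex.Gamma (s + 1))⁻¹
  have hB : Differentiable ℂ B := by
    refine Differentiable.mul (fun s => ?_) (Complex.differentiable_one_div_Gamma.comp (by fun_prop))
    exact (differentiableAt_id.const_cpow (Or.inl h2p))
  set G : ℂ → ℂ := fun s => B s * (s * M s)
  have hG : ∀ s, MeromorphicAt G s := fun s =>
    (hB.analyticAt s).meromorphicAt.mul ((MeromorphicAt.id s).mul (hM s))
  refine ⟨fun s => G (s - α 0), fun s _ => meromorphicAt_comp_sub_const hG _ s, ?_, fun w hw => ?_⟩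
  · obtain ⟨A', hA'⟩ := exists_hasSum_mellin_expSum k α
    refine ⟨max (max A A') 0 + α 0, fun s hs => ?_⟩
    have hs' : max (max A A') 0 < (s - (α 0 : ℂ)).re := by
      rw [Complex.sub_re, Complex.natCast_re]; linarith
    have h1 := hA' _ (((le_max_right _ _).trans (le_max_left _ _)).trans_lt hs')
    have h0 : s - (α 0 : ℂ) ≠ 0 := fun h0 => by
      rw [h0] at hs'
      exact absurd hs' (not_lt.2 (le_max_right _ _))
    rw [(hA _ (((le_max_left _ _).trans (le_max_left _ _)).trans_lt hs')).2] at h1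
    have e : (fun n => serCoeff k α n / (totalSum n : ℂ) ^ (s - (α 0 : ℂ))) = dirichletTerm k α s :=
      funext fun n => (dirichletTerm_eq k α s n).symm
    rw [e] at h1
    have e2 : G (s - (α 0 : ℂ)) = (2 * Real.pi : ℂ) ^ (s - (α 0 : ℂ)) *
        (Complex.Gamma (s - (α 0 : ℂ)))⁻¹ * M (s - (α 0 : ℂ)) := by
      simp only [G, B]
      rw [Complex.Gamma_add_one _ h0, mul_inv]
      field_simp
    change HasSum (dirichletTerm k α s) (G (s - (α 0 : ℂ)))
    rwa [e2]
  · have h1 := hw.comp (tendsto_add_const_punctured (α 0 : ℂ))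
    have hB0 : B 0 = 1 := by simp [B]
    have h2 := h1.div ((hB.continuous.tendsto 0).mono_left nhdsWithin_le_nhds)
      (by rw [hB0]; exact one_ne_zero)
    rw [hB0, div_one] at h2
    have hne : ∀ᶠ s in 𝓝[≠] (0 : ℂ), B s ≠ 0 :=
      (hB.continuous.continuousAt.eventually_ne (by rw [hB0]; exact one_ne_zero)).filter_mono
        nhdsWithin_le_nhds
    have h3 : Tendsto (fun s => s * M s) (𝓝[≠] 0) (𝓝 w) := by
      refine h2.congr' ?_
      filter_upwards [hne] with s hs
      simp only [Function.comp_apply, G, Pi.div_apply, add_sub_cancel_right]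
      exact mul_div_cancel_left₀ _ hs
    have h4 := hlim w h3
    rw [AddMonoidAlgebra.coeff_smul_apply, smul_eq_mul] at h4
    have h5 := hP.isRegValue
    rwa [← h4, inv_mul_cancel_left₀ hC]

/-- The continuation statement for iterated integrals, for indices of arbitrary length. -/
def IntContinuation (c : ℂ) : (r : ℕ) → (Fin r → ℕ) → (Fin r → ℕ) → Prop
  | 0, _, _ => True
  | r + 1, k, α => Admissible k α → ∃ g : ℂ → ℂ, MeromorphicOn g Set.univ ∧
        (∃ A : ℝ, ∀ s : ℂ, A < s.re →
          IntegrableOn (mellinIntegrand k α s) (Set.Ioi 0) ∧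
          g s = ∫ y in Set.Ioi (0 : ℝ), mellinIntegrand k α s y) ∧
        ∀ w : ℂ, Tendsto g (𝓝[≠] (α 0 : ℂ)) (𝓝 w) →
          IsRegValue c (iterInt (r + 1) k α) w

lemma I_mul_cpow {y : ℝ} (hy : 0 < y) (s : ℂ) :
    (Complex.I * (y : ℂ)) ^ s = Complex.I ^ s * (y : ℂ) ^ s := by
  have hyc : (y : ℂ) ≠ 0 := by exact_mod_cast hy.ne'
  rw [Complex.cpow_def_of_ne_zero (mul_ne_zero Complex.I_ne_zero hyc),
    Complex.cpow_def_of_ne_zero Complex.I_ne_zero, Complex.cpow_def_of_ne_zero hyc,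
    mul_comm Complex.I, Complex.log_ofReal_mul hy Complex.I_ne_zero, Complex.ofReal_log hy.le,
    ← Complex.exp_add]
  congr 1
  ring

/-- Integration by parts against `y^s`, the derivative of the iterated integral being its kernel up
to a factor; it supplies the `s` that cancels a simple pole. -/
lemma exists_mellin_intW {c : ℂ} {k a : ℕ} {w : List (ℕ × ℕ)} (hw : AdmWord ((k, a) :: w)) :
    ∃ A : ℝ, ∀ s : ℂ, A < s.re → MellinConvergent (intW ((k, a) :: w)) s →
      MellinConvergent (intKernel k a w) (s + 1) ∧
      s * mellin (intW ((k, a) :: w)) s = Complex.I * mellin (intKernel k a w) (s + 1) := by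
  obtain ⟨hk, ha, hw'⟩ := admWord_cons.1 hw
  obtain ⟨P, hP, hP'⟩ := exists_hasExp_intW c hw'
  obtain ⟨Q, hQ, hQ'⟩ := hP'.pow_mul (a - 1) hP
  obtain ⟨R, hR, hR'⟩ := hQ'.eis_mul hk hQ
  have hK : HasExp c (intKernel k a w) R := hR'.congr fun y _ => by rw [intKernel]; ring
  obtain ⟨b, hb⟩ := hK.moderate.isBigO_rpow
  obtain ⟨S, -, hS⟩ := exists_hasExp_intW c hw
  obtain ⟨b', hb'⟩ := hS.moderate.isBigO_rpow
  -- Positivity gives `s ≠ 0`, `b` gives convergence of the kernel's transform, and `b'` makes the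
  -- boundary term at `0` vanish.
  refine ⟨max 0 (max b b'), fun s hs hconv => ?_⟩
  have hs0 : 0 < s.re := (le_max_left _ _).trans_lt hs
  have hsb : b < s.re := ((le_max_left _ _).trans (le_max_right _ _)).trans_lt hs
  have hsb' : b' < s.re := ((le_max_right _ _).trans (le_max_right _ _)).trans_lt hs
  have h1 : MellinConvergent (intKernel k a w) (s + 1) :=
    mellinConvergent_of_isBigO_rpow
      ((intKernel_continuousOn k a w).locallyIntegrableOn measurableSet_Ioi)
      ((intKernel_rapidDecay k a w).isBigO_rpow (s.re + 2))
      (by rw [Complex.add_re, Complex.one_re]; linarith) hb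
      (by rw [Complex.add_re, Complex.one_re]; linarith)
  refine ⟨h1, ?_⟩
  have hs1 : s ≠ 0 := by rintro rfl; simp at hs0
  have hnorm : ∀ (l : Filter ℝ), (∀ᶠ y in l, 0 < y) → ∀ x : ℝ,
      (intW ((k, a) :: w) =O[l] fun y : ℝ => y ^ (-x)) →
      Tendsto (fun y : ℝ => y ^ (s.re - x)) l (𝓝 0) →
      Tendsto ((fun y : ℝ => (y : ℂ) ^ s) * intW ((k, a) :: w)) l (𝓝 0) := by
    intro l hl x hO ht
    have h2 : (fun y : ℝ => (y : ℂ) ^ s) =O[l] fun y : ℝ => y ^ s.re := by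
      refine Asymptotics.IsBigO.of_bound 1 ?_
      filter_upwards [hl] with y hy
      rw [Complex.norm_cpow_eq_rpow_re_of_pos hy, one_mul]
      exact le_abs_self _
    refine ((h2.mul hO).congr' EventuallyEq.rfl ?_).trans_tendsto ht
    filter_upwards [hl] with y hy
    rw [← Real.rpow_add hy, sub_eq_add_neg]
  have hz := hnorm (𝓝[>] 0) self_mem_nhdsWithin b' hb' (by
    have := (Real.continuousAt_rpow_const 0 (s.re - b') (Or.inr (by linarith))).tendsto
    rw [Real.zero_rpow (by linarith)] at this
    exact this.mono_left nhdsWithin_le_nhds)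
  have hi := hnorm atTop (eventually_gt_atTop 0) (s.re + 1)
    ((intW_rapidDecay (List.cons_ne_nil _ _)).isBigO_rpow _) (by
    have e : (fun y : ℝ => y ^ (s.re - (s.re + 1))) = fun y : ℝ => y ^ (-(1 : ℝ)) := by
      funext y; congr 1; ring
    rw [e]
    exact tendsto_rpow_neg_atTop one_pos)
  have hu : ∀ y ∈ Ioi (0 : ℝ), HasDerivAt (fun y : ℝ => (y : ℂ) ^ s) (s * (y : ℂ) ^ (s - 1)) y :=
    fun y hy => hasDerivAt_ofReal_cpow_const (ne_of_gt hy) hs1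
  have hc1 : IntegrableOn ((fun y : ℝ => (y : ℂ) ^ s) *
      fun y => Complex.I * (-intKernel k a w y)) (Ioi 0) := by
    refine IntegrableOn.congr_fun (h1.const_smul (-Complex.I)) (fun y _ => ?_) measurableSet_Ioi
    simp only [Pi.mul_apply, smul_eq_mul, add_sub_cancel_right]
    ring
  have hc2 : IntegrableOn ((fun y : ℝ => s * (y : ℂ) ^ (s - 1)) * intW ((k, a) :: w)) (Ioi 0) := by
    refine IntegrableOn.congr_fun (hconv.const_smul s) (fun y _ => ?_) measurableSet_Ioi
    simp only [Pi.mul_apply, smul_eq_mul]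
    ring
  have key := integral_Ioi_mul_deriv_eq_deriv_mul hu
    (fun y hy => hasDerivAt_intW k a w hy) hc1 hc2 hz hi
  have e1 : ∫ y in Ioi (0 : ℝ), (y : ℂ) ^ s * (Complex.I * (-intKernel k a w y)) =
      -(Complex.I * mellin (intKernel k a w) (s + 1)) := by
    rw [mellin, ← integral_const_mul, ← integral_neg]
    refine integral_congr_ae (.of_forall fun y => ?_)
    simp only [smul_eq_mul, add_sub_cancel_right]
    ring
  have e2 : ∫ y in Ioi (0 : ℝ), s * (y : ℂ) ^ (s - 1) * intW ((k, a) :: w) y =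
      s * mellin (intW ((k, a) :: w)) s := by
    rw [mellin, ← integral_const_mul]
    refine integral_congr_ae (.of_forall fun y => ?_)
    simp only [smul_eq_mul]
    ring
  rw [e1, e2] at key
  linear_combination key

/-- After the shift by `a` the integral is `i^s` times `s M(s)`, with `M` the Mellin transform of
the iterated integral; `i^s` is entire, without zeros, and equals `1` at `0`. -/
theorem int_continuation (c : ℂ) (r : ℕ) (k α : Fin r → ℕ) : IntContinuation c r k α := by
  refine exists_word (C := IntContinuation c) (fun w => ?_) r k α
  obtain - | ⟨⟨k, a⟩, w⟩ := w
  · trivial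
  intro hadm
  have hw : AdmWord ((k, a) :: w) := fun x hx => by
    obtain ⟨i, rfl⟩ := List.get_of_mem hx
    exact hadm i
  obtain ⟨hk, ha, hw'⟩ := admWord_cons.1 hw
  obtain ⟨P, -, hP⟩ := exists_hasExp_intW c hw
  obtain ⟨M, hM, ⟨A, hA⟩, hlim⟩ := exists_mellin_continuation (intW_continuousOn _)
    (intW_rapidDecay (List.cons_ne_nil (k, a) w)) hP
  obtain ⟨A', hA'⟩ := exists_mellin_intW (c := c) hw
  set B : ℂ → ℂ := fun s => Complex.I ^ s
  have hB : Differentiable ℂ B := fun s =>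
    differentiableAt_id.const_cpow (Or.inl Complex.I_ne_zero)
  set G : ℂ → ℂ := fun s => B s * (s * M s)
  have hG : ∀ s, MeromorphicAt G s := fun s =>
    (hB.analyticAt s).meromorphicAt.mul ((MeromorphicAt.id s).mul (hM s))
  change ∃ g : ℂ → ℂ, MeromorphicOn g Set.univ ∧ _ ∧ ∀ w : ℂ, Tendsto g (𝓝[≠] (a : ℂ)) (𝓝 w) → _
  have hint : ∀ (s : ℂ) (y : ℝ), 0 < y → mellinIntegrand (r := w.length)
      (fun i => (((k, a) :: w).get i).1) (fun i => (((k, a) :: w).get i).2) s y =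
      (Complex.I * B (s - a)) * ((y : ℂ) ^ (s - a + 1 - 1) • intKernel k a w y) := by
    intro s y hy
    have hI : Complex.I * (y : ℂ) ≠ 0 := by simp [hy.ne']
    change eis k y * (Complex.I * (y : ℂ)) ^ (s - 1) * intW w y * Complex.I = _
    -- The integer part of the exponent belongs to the kernel, the rest to the Mellin variable; `1 ≤
    -- a` makes the natural subtraction exact.
    have e : s - 1 = ((a - 1 : ℕ) : ℂ) + (s - a) := by
      rw [Nat.cast_sub ha]; push_cast; ring
    rw [e, Complex.cpow_add _ _ hI, Complex.cpow_natCast, I_mul_cpow hy (s - a), intKernel,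
      add_sub_cancel_right, smul_eq_mul]
    ring
  refine ⟨fun s => G (s - a), fun s _ => meromorphicAt_comp_sub_const hG _ s, ?_, fun v hv => ?_⟩
  · refine ⟨max A A' + a, fun s hs => ?_⟩
    have hs' : max A A' < (s - (a : ℂ)).re := by
      rw [Complex.sub_re, Complex.natCast_re]; linarith
    obtain ⟨hm1, hm2⟩ := hA _ ((le_max_left _ _).trans_lt hs')
    obtain ⟨h1, h2⟩ := hA' _ ((le_max_right _ _).trans_lt hs') hm1
    constructor
    · exact IntegrableOn.congr_fun (h1.const_mul (Complex.I * B (s - a)))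
        (fun y hy => (hint s y hy).symm) measurableSet_Ioi
    · refine Eq.trans ?_ (setIntegral_congr_fun measurableSet_Ioi fun y hy => hint s y hy).symm
      rw [integral_const_mul]
      change B (s - a) * ((s - a) * M (s - a)) =
        Complex.I * B (s - a) * mellin (intKernel k a w) (s - a + 1)
      rw [← hm2, h2]
      ring
  · have h1 := hv.comp (tendsto_add_const_punctured (a : ℂ))
    have hB0 : B 0 = 1 := by simp [B]
    have hne : ∀ s, B s ≠ 0 := fun s => by
      simp only [B, Complex.cpow_def_of_ne_zero Complex.I_ne_zero]; exact Complex.exp_ne_zero _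
    have h2 := h1.div ((hB.continuous.tendsto 0).mono_left nhdsWithin_le_nhds)
      (by rw [hB0]; exact one_ne_zero)
    rw [hB0, div_one] at h2
    have h3 : Tendsto (fun s => s * M s) (𝓝[≠] 0) (𝓝 v) := by
      refine h2.congr fun s => ?_
      simp only [Function.comp_apply, G, Pi.div_apply, add_sub_cancel_right]
      exact mul_div_cancel_left₀ _ (hne s)
    have h5 := hP.isRegValue
    rwa [hlim v h3] at h5

/-! ### The filtrations -/

/-- Reduces each filtration of the statement to a choice of letter weights, with indices replaced by
words. -/
lemma regSpan_eq_regFil (c : ℂ) (F : Family) (Q : (r : ℕ) → (Fin r → ℕ) → (Fin r → ℕ) → Prop)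
    (p q s n : ℕ) (h : ∀ w : List (ℕ × ℕ),
      Q w.length (fun i => (w.get i).1) (fun i => (w.get i).2) ↔ wt p q s w ≤ n) :
    regSpan c F Q = regFil c F p q s n := by
  refine le_antisymm (Submodule.span_le.2 ?_) (Submodule.span_mono ?_)
  · rintro v ⟨r, k, α, hadm, hQ, hv⟩
    revert hadm hQ hv
    refine exists_word (C := fun r k α => Admissible k α → Q r k α → IsRegValue c (F r k α) v →
      v ∈ regFil c F p q s n) (fun w hadm hQ hv => ?_) r k α
    refine mem_regFil (w := w) (fun x hx => ?_) ((h w).1 hQ) hv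
    obtain ⟨i, rfl⟩ := List.get_of_mem hx
    exact hadm i
  · rintro v ⟨w, hw, hn, hv⟩
    exact ⟨w.length, _, _, fun i => hw _ (List.get_mem w i), (h w).2 hn, hv⟩

lemma wt_eq (p q s : ℕ) (w : List (ℕ × ℕ)) : wt p q s w =
    p * w.length + q * ∑ i, (w.get i).1 + s * ∑ i, (w.get i).2 := by
  induction w with
  | nil => simp [wt]
  | cons x w ih =>
    rw [wt_cons p q s x.1 x.2, ih]
    simp only [List.length_cons, Fin.sum_univ_succ, List.get_eq_getElem, Fin.val_zero,
      List.getElem_cons_zero, Fin.val_succ, List.getElem_cons_succ]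
    ring

lemma total_eq (c : ℂ) (F : Family) : total c F = regFil c F 0 0 0 0 :=
  regSpan_eq_regFil c F _ _ _ _ _ fun w => by simp [wt_eq]

lemma lengthFil_eq (c : ℂ) (F : Family) (n : ℕ) : lengthFil c F n = regFil c F 1 0 0 n :=
  regSpan_eq_regFil c F _ _ _ _ _ fun w => by simp [wt_eq]

lemma upperFil_eq (c : ℂ) (F : Family) (n : ℕ) : upperFil c F n = regFil c F 0 1 0 n :=
  regSpan_eq_regFil c F _ _ _ _ _ fun w => by simp [wt_eq]

lemma lowerFil_eq (c : ℂ) (F : Family) (n : ℕ) : lowerFil c F n = regFil c F 0 0 1 n :=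
  regSpan_eq_regFil c F _ _ _ _ _ fun w => by simp [wt_eq]

lemma one_mem_regFil (c : ℂ) (p q s n : ℕ) : (1 : ℂ) ∈ regFil c iterInt p q s n :=
  mem_regFil admWord_nil (Nat.zero_le _) (isRegValue_nil intW_nil)

lemma IEI_isSubalgebra (c : ℂ) : ∃ S : Subalgebra ℚ ℂ, Subalgebra.toSubmodule S = IEI c := by
  have e : IEI c = regFil c iterInt 0 0 0 0 := total_eq c iterInt
  rw [e]
  exact ⟨(regFil c iterInt 0 0 0 0).toSubalgebra (one_mem_regFil c 0 0 0 0)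
    (fun x y hx hy => regFil_iterInt_mul_mem c 0 0 0 0 0 x hx y hy),
    Submodule.toSubalgebra_toSubmodule _ _ _⟩

lemma MEL_eq_IEI (c : ℂ) : MEL c = IEI c := by
  rw [MEL, IEI, total_eq, total_eq, regFil_multL_eq]

end

end IterEis

/-! ### The main theorem -/

theorem mainTheorem4 (c : ℂ) :
    -- every regularized value exists and is unique
    (∀ (r : ℕ) (k α : Fin r → ℕ), IterEis.Admissible k α →
      (∃! v : ℂ, IterEis.IsRegValue c (IterEis.multL r k α) v) ∧
      (∃! v : ℂ, IterEis.IsRegValue c (IterEis.iterInt r k α) v)) ∧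
    -- it is the value given by analytic continuation, wherever the latter is finite
    (∀ (r : ℕ) (k α : Fin (r + 1) → ℕ), IterEis.Admissible k α →
      (∃ g : ℂ → ℂ, MeromorphicOn g Set.univ ∧
        (∃ A : ℝ, ∀ s : ℂ, A < s.re → HasSum (IterEis.dirichletTerm k α s) (g s)) ∧
        ∀ w : ℂ, Tendsto g (𝓝[≠] (α 0 : ℂ)) (𝓝 w) →
          IterEis.IsRegValue c (IterEis.multL (r + 1) k α)
            (((2 * Real.pi * Complex.I) ^ (∑ i, α i))⁻¹ * w)) ∧
      (∃ g : ℂ → ℂ, MeromorphicOn g Set.univ ∧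
        (∃ A : ℝ, ∀ s : ℂ, A < s.re →
          IntegrableOn (IterEis.mellinIntegrand k α s) (Set.Ioi 0) ∧
          g s = ∫ y in Set.Ioi (0 : ℝ), IterEis.mellinIntegrand k α s y) ∧
        ∀ w : ℂ, Tendsto g (𝓝[≠] (α 0 : ℂ)) (𝓝 w) →
          IterEis.IsRegValue c (IterEis.iterInt (r + 1) k α) w)) ∧
    -- both spaces are `ℚ`-algebras
    (∃ S : Subalgebra ℚ ℂ, Subalgebra.toSubmodule S = IterEis.MEL c) ∧
    (∃ S : Subalgebra ℚ ℂ, Subalgebra.toSubmodule S = IterEis.IEI c) ∧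
    -- they coincide, together with their filtrations
    IterEis.MEL c = IterEis.IEI c ∧
    (∀ n : ℕ, IterEis.lengthFil c IterEis.multL n = IterEis.lengthFil c IterEis.iterInt n ∧
      IterEis.upperFil c IterEis.multL n = IterEis.upperFil c IterEis.iterInt n ∧
      IterEis.lowerFil c IterEis.multL n = IterEis.lowerFil c IterEis.iterInt n) ∧
    -- products are additive in the filtrations
    (∀ l₁ j₁ k₁ l₂ j₂ k₂ : ℕ,
      ∀ x ∈ IterEis.fil c IterEis.multL l₁ j₁ k₁, ∀ y ∈ IterEis.fil c IterEis.multL l₂ j₂ k₂,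
        x * y ∈ IterEis.fil c IterEis.multL (l₁ + l₂) (j₁ + j₂) (k₁ + k₂)) := by
  refine ⟨fun r k α h => ⟨?_, ?_⟩, fun r k α h => ⟨IterEis.dirichlet_continuation c k α h,
    IterEis.int_continuation c (r + 1) k α h⟩, ?_, IterEis.IEI_isSubalgebra c,
    IterEis.MEL_eq_IEI c, fun n => ⟨?_, ?_, ?_⟩, ?_⟩
  · obtain ⟨P, hP⟩ := IterEis.hasExp_multL c r k α h
    exact ⟨_, hP.isRegValue, fun v hv => hv.unique hP.isRegValue⟩
  · obtain ⟨P, hP⟩ := IterEis.hasExp_iterInt c r k α h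
    exact ⟨_, hP.isRegValue, fun v hv => hv.unique hP.isRegValue⟩
  -- The algebra structure of the L-values is inherited from the integrals, where the shuffle
  -- product is available.
  · rw [IterEis.MEL_eq_IEI]
    exact IterEis.IEI_isSubalgebra c
  · rw [IterEis.lengthFil_eq, IterEis.lengthFil_eq, IterEis.regFil_multL_eq]
  · rw [IterEis.upperFil_eq, IterEis.upperFil_eq, IterEis.regFil_multL_eq]
  · rw [IterEis.lowerFil_eq, IterEis.lowerFil_eq, IterEis.regFil_multL_eq]
  -- Membership in an intersection is checked in each filtration separately, after passing to the
  -- integrals.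
  · simp only [IterEis.fil, IterEis.lengthFil_eq, IterEis.upperFil_eq, IterEis.lowerFil_eq,
      IterEis.regFil_multL_eq, Submodule.mem_inf]
    rintro l₁ j₁ k₁ l₂ j₂ k₂ x ⟨⟨hx₁, hx₂⟩, hx₃⟩ y ⟨⟨hy₁, hy₂⟩, hy₃⟩
    exact ⟨⟨IterEis.regFil_iterInt_mul_mem c _ _ _ _ _ x hx₁ y hy₁,
      IterEis.regFil_iterInt_mul_mem c _ _ _ _ _ x hx₂ y hy₂⟩,
      IterEis.regFil_iterInt_mul_mem c _ _ _ _ _ x hx₃ y hy₃⟩
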